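/- Let $d,p\in\mathbb N$, $f:\mathbb R^p\to\mathbb R$, $r:\mathbb R^d\to\mathbb R$, and let $g_\xi:\mathbb R^d\to\mathbb R^p$ be a family of mappings. Let $\bar g=\frac1n\sum_{i=1}^n g_i$ with $n\ge 1$ (finite-sum problem $(\Sigma^1)$) or $\bar g=\mathbb E_\xi g_\xi$ (online problem $(\mathbb E^1)$); put $F=f\circ\bar g$ and $\Phi=F+r$. Assume that * $f$ is differentiable and $l_f$-Lipschitz, and $\nabla f$ is $L_f$-Lipschitz; * every $g_\xi$ is differentiable and $l_g$-Lipschitz, and its Jacobian $g_\xi'$ is $L_g$-Lipschitz in the Frobenius norm; * $r$ is convex and $\Phi^*:=\inf_x\Phi(x)>-\infty$; * for the online problem, $\mathbb E_\xi\|g_\xi(x)-\bar g(x)\|^2\le\sigma_g^2$ and $\mathbb E_\xi\|g_\xi'(x)-\bar g'(x)\|_F^2\le\sigma_{g'}^2$ for all $x$. Put $L_F=l_g^2L_f+l_fL_g$, $G_0=2(l_g^4L_f^2+l_f^2L_g^2)$, and $\sigma_0=\sqrt{2(l_g^2L_f^2\sigma_g^2+l_f^2\sigma_{g'}^2)}$.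 For $\lambda>0$ let $\operatorname{prox}_{\lambda r}(x)=\arg\min_u\{r(u)+\frac1{2\lambda}\|u-x\|^2\}$ and $\mathcal G_\lambda(x)=\frac1\lambda\big(x-\operatorname{prox}_{\lambda r}(x-\lambda\nabla F(x))\big)$. The algorithm MVRC-1 starts from $x_0=y_0\in\mathbb R^d$ and for $t=0,\dots,T-1$ computes $z_t=(1-\alpha_{t+1})y_t+\alpha_{t+1}x_t$ and draws a minibatch $\mathcal A_t$, independently of the past: for $(\Sigma^1)$ a uniformly random subset of $\{1,\dots,n\}$ of the prescribed size, for $(\mathbb E^1)$ the prescribed number of independent samples of $\xi$. If $\tau$ divides $t$, it sets $\widetilde g_t=\frac1{|\mathcal A_t|}\sum_{\xi\in\mathcal A_t}g_\xi(z_t)$ and $\widetilde g_t'=\frac1{|\mathcal A_t|}\sum_{\xi\in\mathcal A_t}g_\xi'(z_t)$; otherwise $\widetilde g_t=\widetilde g_{t-1}+\frac1{|\mathcal A_t|}\sum_{\xi\in\mathcal A_t}(g_\xi(z_t)-g_\xi(z_{t-1}))$ and $\widetilde g_t'=\widetilde g_{t-1}'+\frac1{|\mathcal A_t|}\sum_{\xi\in\mathcal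 A_t}(g_\xi'(z_t)-g_\xi'(z_{t-1}))$. Then $x_{t+1}=\operatorname{prox}_{\lambda_tr}\big(x_t-\lambda_t\widetilde g_t'^{\top}\nabla f(\widetilde g_t)\big)$ and $y_{t+1}=z_t+\frac{\beta}{\lambda_t}(x_{t+1}-x_t)$. The output is $z_\zeta$, where $\zeta$ is uniform on $\{0,\dots,T-1\}$ and independent of the samples. The parameters are $\alpha_t=\frac2{t+1}$, $\lambda_t\in[\beta,(1+\alpha_t)\beta]$ for $0\le t<T$, and $0<\beta\le\big(2\sqrt{16L_F^2+6G_0}+8L_F\big)^{-1}$ (no upper bound on $\beta$ if $L_F=G_0=0$). There are universal constants $C,c>0$ such that the following holds. 1. $(\Sigma^1)$: let $\tau=\lfloor\sqrt n\rfloor$, $|\mathcal A_t|=n$ if $\tau\mid t$, and $|\mathcal A_t|=\lfloor\sqrt n\rfloor$ otherwise. Then for every $T\ge1$ $$\mathbb E\|\mathcal G_{\lambda_\zeta}(z_\zeta)\|^2\le C\,\frac{\Phi(x_0)-\Phi^*}{T\beta}.$$ Moreover, for every $\varepsilon>0$ there is a $T\ge 1$ for which $\mathbb E\|\mathcal G_{\lambda_\zeta}(z_\zeta)\|\le\varepsilon$,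 while almost surely the number of evaluations of the $g_\xi$ and $g_\xi'$ is at most $C\big(n+\sqrt n\,\frac{\Phi(x_0)-\Phi^*}{\beta}\,\varepsilon^{-2}\big)$, that is, $O(n+\sqrt n\,\varepsilon^{-2})$. 2. $(\mathbb E^1)$: for $0<\varepsilon\le\sqrt2\,\sigma_0$ let $\tau=\lfloor\sqrt{2\sigma_0^2\varepsilon^{-2}}\rfloor$, $|\mathcal A_t|=\lceil2\sigma_0^2\varepsilon^{-2}\rceil$ if $\tau\mid t$, and $|\mathcal A_t|=\tau$ otherwise. Then for every $T\ge1$ $$\mathbb E\|\mathcal G_{\lambda_\zeta}(z_\zeta)\|^2\le C\Big(\varepsilon^2+\frac{\Phi(x_0)-\Phi^*}{T\beta}\Big).$$ Moreover, for every $\varepsilon>0$ with $c\,\varepsilon\le\sqrt2\,\sigma_0$ there is a $T\ge1$ such that, when $\tau$ and $|\mathcal A_t|$ are chosen as above with $c\,\varepsilon$ in place of $\varepsilon$, $\mathbb E\|\mathcal G_{\lambda_\zeta}(z_\zeta)\|\le\varepsilon$, while almost surely the number of evaluations of the $g_\xi$ and $g_\xi'$ is at most $C\big(\sigma_0^3+\sigma_0\frac{\Phi(x_0)-\Phi^*}{\beta}\big)\varepsilon^{-3}$,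 that is, $O(\varepsilon^{-3})$. -/

import Mathlib

open MeasureTheory ProbabilityTheory
open scoped NNReal Gradient

universe u v

namespace MVRC

/-- Euclidean space `ℝ^d`. -/
abbrev Vec (d : ℕ) : Type := EuclideanSpace ℝ (Fin d)

/-- The Frobenius norm of (the matrix of) a linear map `ℝ^d → ℝ^p`. -/
noncomputable def frob {d p : ℕ} (J : Vec d →L[ℝ] Vec p) : ℝ :=
  √(∑ j : Fin d, ‖J (EuclideanSpace.single j 1)‖ ^ 2)

/-- The proximal mapping `argmin_u { r u + ‖u - x‖² / (2 lam) }`. For `lam > 0` and convex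
`r : ℝ^d → ℝ` the minimizer exists and is unique, so the choice below is not a choice. -/
noncomputable def prox {d : ℕ} (r : Vec d → ℝ) (lam : ℝ) (x : Vec d) : Vec d :=
  Classical.epsilon fun y : Vec d =>
    IsMinOn (fun u : Vec d => r u + 1 / (2 * lam) * ‖u - x‖ ^ 2) Set.univ y

/-- The generalized gradient mapping of `F + r` at `x` with parameter `lam`. -/
noncomputable def gradMap {d : ℕ} (F r : Vec d → ℝ) (lam : ℝ) (x : Vec d) : Vec d :=
  (1 / lam) • (x - prox r lam (x - lam • ∇ F x))

/-- The smooth part `F = f ∘ gbar` of the objective. -/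
def smoothPart {d p : ℕ} (f : Vec p → ℝ) (gbar : Vec d → Vec p) (x : Vec d) : ℝ :=
  f (gbar x)

/-- The objective `Φ = f ∘ gbar + r`. -/
def objective {d p : ℕ} (f : Vec p → ℝ) (gbar : Vec d → Vec p) (r : Vec d → ℝ)
    (x : Vec d) : ℝ :=
  smoothPart f gbar x + r x

/-- The initial gap `Φ(x₀) - Φ^*` with `Φ^* = inf_x Φ(x)`. -/
noncomputable def gap {d p : ℕ} (f : Vec p → ℝ) (gbar : Vec d → Vec p) (r : Vec d → ℝ)
    (x₀ : Vec d) : ℝ :=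
  objective f gbar r x₀ - ⨅ x : Vec d, objective f gbar r x

/-- The inner mapping of the finite-sum problem. -/
noncomputable def finiteMean {d p n : ℕ} (g : Fin n → Vec d → Vec p) (x : Vec d) : Vec p :=
  (1 / (n : ℝ)) • ∑ i : Fin n, g i x

/-- The inner mapping of the online problem. -/
noncomputable def onlineMean {d p : ℕ} {Ξ : Type*} [MeasurableSpace Ξ] (P : Measure Ξ)
    (g : Ξ → Vec d → Vec p) (x : Vec d) : Vec p :=
  ∫ k, g k x ∂P

/-- Regularity of the objective: `f` and all `g k` are Lipschitz with Lipschitz derivatives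
(Jacobians in Frobenius norm), `r` is convex, and `Φ` is bounded below. -/
structure Regular {d p : ℕ} {Ξ : Type*} (f : Vec p → ℝ) (g : Ξ → Vec d → Vec p)
    (gbar : Vec d → Vec p) (r : Vec d → ℝ) (lf Lf lg Lg : ℝ≥0) : Prop where
  f_diff : Differentiable ℝ f
  f_lip : LipschitzWith lf f
  f_grad_lip : LipschitzWith Lf (∇ f)
  g_diff : ∀ k, Differentiable ℝ (g k)
  g_lip : ∀ k, LipschitzWith lg (g k)
  g_jac_lip : ∀ k x y, frob (fderiv ℝ (g k) x - fderiv ℝ (g k) y) ≤ Lg * ‖x - y‖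
  r_convex : ConvexOn ℝ Set.univ r
  bdd_below : BddBelow (Set.range (objective f gbar r))

/-- Bounded variance of `g_ξ` and of its Jacobian for `ξ` distributed as `P`. -/
structure BoundedVariance {d p : ℕ} {Ξ : Type*} [MeasurableSpace Ξ] (P : Measure Ξ)
    (g : Ξ → Vec d → Vec p) (sg sg' : ℝ≥0) : Prop where
  meas : ∀ x, Measurable fun k => g k x
  g_int : ∀ x, Integrable (fun k => ‖g k x - onlineMean P g x‖ ^ 2) P
  g_var : ∀ x, ∫ k, ‖g k x - onlineMean P g x‖ ^ 2 ∂P ≤ (sg : ℝ) ^ 2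
  jac_int : ∀ x,
    Integrable (fun k => frob (fderiv ℝ (g k) x - fderiv ℝ (onlineMean P g) x) ^ 2) P
  jac_var : ∀ x,
    ∫ k, frob (fderiv ℝ (g k) x - fderiv ℝ (onlineMean P g) x) ^ 2 ∂P ≤ (sg' : ℝ) ^ 2

/-- `L_F = l_g² L_f + l_f L_g`. -/
def LF (lf Lf lg Lg : ℝ≥0) : ℝ := (lg : ℝ) ^ 2 * Lf + lf * Lg

/-- `G_0 = 2 (l_g⁴ L_f² + l_f² L_g²)`. -/
def G0 (lf Lf lg Lg : ℝ≥0) : ℝ := 2 * ((lg : ℝ) ^ 4 * Lf ^ 2 + (lf : ℝ) ^ 2 * Lg ^ 2)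

/-- `σ_0² = 2 (l_g² L_f² σ_g² + l_f² σ_{g'}²)`. -/
def sigma0Sq (lf Lf lg sg sg' : ℝ≥0) : ℝ :=
  2 * ((lg : ℝ) ^ 2 * Lf ^ 2 * sg ^ 2 + (lf : ℝ) ^ 2 * sg' ^ 2)

/-! ### The algorithm -/

/-- Average of `h` over a minibatch (a multiset of samples). -/
noncomputable def batchMean {Ξ V : Type*} [AddCommGroup V] [Module ℝ V] (A : Multiset Ξ)
    (h : Ξ → V) : V :=
  (1 / (Multiset.card A : ℝ)) • (A.map h).sum

/-- Hyperparameters: epoch length, momentum `α_t`, and step sizes `β_t`, `λ_t`. -/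
structure Params where
  τ : ℕ
  α : ℕ → ℝ
  β : ℕ → ℝ
  lam : ℕ → ℝ

/-- The state after `t` iterations: `x_t`, `y_t`, the last query point `z_{t-1}`, the last
estimates of the inner mapping and of its Jacobian, and the number of evaluations of component
mappings `g_ξ` and component Jacobians `g_ξ'` made so far. -/
structure State (d p : ℕ) where
  x : Vec d
  y : Vec d
  zLast : Vec d
  gEst : Vec p
  jEst : Vec d →L[ℝ] Vec p
  evals : ℕ

/-- The query point `z_t`, computed from the state after `t` iterations. -/
noncomputable def queryPoint {d p : ℕ} (par : Params) (t : ℕ) (s : State d p) : Vec d :=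
  (1 - par.α (t + 1)) • s.y + par.α (t + 1) • s.x

/-- The estimate of the inner mapping used in iteration `t`. -/
noncomputable def newG {d p : ℕ} {Ξ : Type*} (g : Ξ → Vec d → Vec p) (par : Params)
    (A : Multiset Ξ) (t : ℕ) (s : State d p) : Vec p :=
  if t % par.τ = 0 then batchMean A fun k => g k (queryPoint par t s)
  else s.gEst + batchMean A fun k => g k (queryPoint par t s) - g k s.zLast

/-- The estimate of the Jacobian of the inner mapping used in iteration `t`. -/
noncomputable def newJ {d p : ℕ} {Ξ : Type*} (g : Ξ → Vec d → Vec p) (par : Params)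
    (A : Multiset Ξ) (t : ℕ) (s : State d p) : Vec d →L[ℝ] Vec p :=
  if t % par.τ = 0 then batchMean A fun k => fderiv ℝ (g k) (queryPoint par t s)
  else s.jEst + batchMean A fun k => fderiv ℝ (g k) (queryPoint par t s) - fderiv ℝ (g k) s.zLast

/-- The point `x_{t+1} = prox (x_t - λ_t J^T ∇f(G))`, with the new estimates `G`, `J`. -/
noncomputable def newX {d p : ℕ} {Ξ : Type*} (f : Vec p → ℝ) (g : Ξ → Vec d → Vec p)
    (r : Vec d → ℝ) (par : Params) (A : Multiset Ξ) (t : ℕ) (s : State d p) : Vec d :=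
  prox r (par.lam t) (s.x - par.lam t •
    ContinuousLinearMap.adjoint (newJ g par A t s) (∇ f (newG g par A t s)))

/-- Iteration `t` of MVRC-1 with minibatch `A`. -/
noncomputable def step {d p : ℕ} {Ξ : Type*} (f : Vec p → ℝ) (g : Ξ → Vec d → Vec p)
    (r : Vec d → ℝ) (par : Params) (A : Multiset Ξ) (t : ℕ) (s : State d p) : State d p where
  x := newX f g r par A t s
  y := queryPoint par t s + (par.β t / par.lam t) • (newX f g r par A t s - s.x)
  zLast := queryPoint par t s
  gEst := newG g par A t s
  jEst := newJ g par A t s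
  evals := s.evals +
    if t % par.τ = 0 then 2 * Multiset.card A else 4 * Multiset.card A

/-- The state of MVRC-1 after `t` iterations, started at `x₀`, with minibatches
`A 0, A 1, …`. The initial estimates are placeholders: iteration `0` overwrites them. -/
noncomputable def run {d p : ℕ} {Ξ : Type*} (f : Vec p → ℝ) (g : Ξ → Vec d → Vec p)
    (r : Vec d → ℝ) (par : Params) (x₀ : Vec d) (A : ℕ → Multiset Ξ) : ℕ → State d p
  | 0 => { x := x₀, y := x₀, zLast := x₀, gEst := 0, jEst := 0, evals := 0 }
  | t + 1 => step f g r par (A t) t (run f g r par x₀ A t)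

/-- The query point `z_t` of the run. -/
noncomputable def zIter {d p : ℕ} {Ξ : Type*} (f : Vec p → ℝ) (g : Ξ → Vec d → Vec p)
    (r : Vec d → ℝ) (par : Params) (x₀ : Vec d) (A : ℕ → Multiset Ξ) (t : ℕ) : Vec d :=
  queryPoint par t (run f g r par x₀ A t)

/-! ### Parameter choices -/

/-- Diminishing momentum `α_t = 2 / (t + 1)`. -/
noncomputable def dimMomentum (t : ℕ) : ℝ := 2 / ((t : ℝ) + 1)

/-- Epoch length `τ`, momentum `α_t = 2 / (t + 1)`, `β_t ≡ β`, and step sizes `λ_t`. -/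
noncomputable def dimParams (τ : ℕ) (β : ℝ) (lam : ℕ → ℝ) : Params where
  τ := τ
  α := dimMomentum
  β := fun _ => β
  lam := lam

/-- `0 < β ≤ (2 √(16 L_F² + 6 G_0) + 8 L_F)⁻¹` (no upper bound if the inverted number
is zero). -/
def AdmissibleBeta (lf Lf lg Lg : ℝ≥0) (β : ℝ) : Prop :=
  0 < β ∧ β * (2 * √(16 * LF lf Lf lg Lg ^ 2 + 6 * G0 lf Lf lg Lg) + 8 * LF lf Lf lg Lg) ≤ 1

/-- `λ_t ∈ [β, (1 + α_t) β]` in each of the `T` iterations. -/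
def AdmissibleLam (T : ℕ) (β : ℝ) (lam : ℕ → ℝ) : Prop :=
  ∀ t < T, lam t ∈ Set.Icc β ((1 + dimMomentum t) * β)

/-- Batch sizes for the finite-sum problem; the epoch length is `⌊√n⌋ = Nat.sqrt n`. -/
def finiteBatch (n t : ℕ) : ℕ := if t % Nat.sqrt n = 0 then n else Nat.sqrt n

/-- Epoch length `⌊√(2 σ_0² ε⁻²)⌋` for the online problem. -/
noncomputable def onlineTau (s0sq ε : ℝ) : ℕ := ⌊√(2 * s0sq / ε ^ 2)⌋₊

/-- Batch sizes for the online problem. -/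
noncomputable def onlineBatch (s0sq ε : ℝ) (t : ℕ) : ℕ :=
  if t % onlineTau s0sq ε = 0 then ⌈2 * s0sq / ε ^ 2⌉₊ else onlineTau s0sq ε

/-! ### Randomness -/

/-- `A 0, …, A (T - 1)` are independent, `A t` is a uniformly random subset of size `b t` of the
`n` indices, and `ζ` is uniform on `{0, …, T - 1}` and independent of the samples. -/
structure FiniteSampling {Ω : Type*} [MeasurableSpace Ω] (μ : Measure Ω) {n : ℕ} (T : ℕ)
    (b : ℕ → ℕ) (A : ℕ → Ω → Finset (Fin n)) (ζ : Ω → ℕ) : Prop where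
  meas : ∀ t < T, Measurable (A t)
  law : ∀ t < T, μ.map (A t) = uniformOn {s : Finset (Fin n) | s.card = b t}
  indep : iIndepFun (fun t : Fin T => A t) μ
  ζ_meas : Measurable ζ
  ζ_law : μ.map ζ = uniformOn (Set.Iio T)
  ζ_indep : IndepFun ζ (fun ω (t : Fin T) => A t ω) μ

/-- The samples `ξ t i`, `t < T`, `i < b t`, are independent with distribution `P`, and `ζ` is
uniform on `{0, …, T - 1}` and independent of the samples. -/
structure OnlineSampling {Ω Ξ : Type*} [MeasurableSpace Ω] [MeasurableSpace Ξ] (μ : Measure Ω)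
    (P : Measure Ξ) (T : ℕ) (b : ℕ → ℕ) (ξ : ℕ → ℕ → Ω → Ξ) (ζ : Ω → ℕ) : Prop where
  meas : ∀ t < T, ∀ i < b t, Measurable (ξ t i)
  law : ∀ t < T, ∀ i < b t, μ.map (ξ t i) = P
  indep : iIndepFun (fun q : (t : Fin T) × Fin (b t) => ξ q.1 q.2) μ
  ζ_meas : Measurable ζ
  ζ_law : μ.map ζ = uniformOn (Set.Iio T)
  ζ_indep : IndepFun ζ (fun ω (q : (t : Fin T) × Fin (b t)) => ξ q.1 q.2 ω) μ

/-- The minibatches of the finite-sum run for the outcome `ω`. -/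
def finiteBatches {Ω : Type*} {n : ℕ} (A : ℕ → Ω → Finset (Fin n)) (ω : Ω) (t : ℕ) :
    Multiset (Fin n) :=
  (A t ω).val

/-- The minibatches of the online run for the outcome `ω`: `b t` samples in iteration `t`. -/
def onlineBatches {Ω Ξ : Type*} (b : ℕ → ℕ) (ξ : ℕ → ℕ → Ω → Ξ) (ω : Ω) (t : ℕ) :
    Multiset Ξ :=
  (Multiset.range (b t)).map fun i => ξ t i ω

/-- The accuracy `‖G_{λ_t}(z_t)‖` of the query point `z_t`, to be used with `t = ζ ω`. -/
noncomputable def accuracy {d p : ℕ} {Ξ : Type*} (f : Vec p → ℝ) (g : Ξ → Vec d → Vec p)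
    (gbar : Vec d → Vec p) (r : Vec d → ℝ) (par : Params) (x₀ : Vec d) (A : ℕ → Multiset Ξ)
    (t : ℕ) : ℝ :=
  ‖gradMap (smoothPart f gbar) r (par.lam t) (zIter f g r par x₀ A t)‖

end MVRC

/-! Progress is measured by the squared steps D_t = ‖x_{t+1} - x_t‖². A proximal step decreases Φ at
x_t by a multiple of D_t / β, up to two losses: the gradient is taken at z_t instead of x_t, which
costs L_F ‖z_t - x_t‖², and the direction v_t is only an estimate, which costs β ‖v_t - ∇F(z_t)‖²
(`objective_step_le`). Both losses are paid for by the sum of the D_t.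

The first loss is deterministic. The difference x - y obeys a recursion with contraction factor 1 -
2/(t+2); multiplied by t + 2 it telescopes, so the sums of ‖x_t - y_t‖² and of ‖z_{t+1} - z_t‖² are
at most constants times the sum of the D_t (`MomentumSeq.sum_error_le`,
`MomentumSeq.sum_query_diff_le`).

For the second loss, `errPairing` sends the pair of estimated value and estimated Jacobian linearly
into a Hilbert space, scaled so that its error dominates the error of the direction. A recursive
update adds to the old error a batch deviation that is centered given the past, so there is no cross
term and mean squares add: the increment is at most (G_0 / τ) E‖z_{t+1} - z_t‖². Within epochs of
length τ each displacement is counted at most τ times, so the expected squared errors sum to at most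
G_0 ∑ E‖z_{t+1} - z_t‖² + T V, where V bounds the error after a refresh (`sum_epoch_error_le`).

The condition on β yields 24 β² G_0 ≤ 1 - 16 β L_F, which leaves D_t with a net coefficient of at
least 1/40 after both losses (`net_decrease_coefficient`). Hence ∑ E D_t is of order β Δ + β² T V,
with Δ the initial gap, and so is β² times the summed squared gradient mappings at the z_t, because
the proximal map is nonexpansive (`norm_gradMap_sq_le`, `sum_le_of_path_inequalities`). Averaging
over ζ gives the rates.

`Sampling` records all that is needed of the batches. It is verified for random subsets, where a
refresh is exact and V = 0, and for independent samples, where V = δ²/2. For the complexity, T is of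
order Δ / (β ε²), and one counts a large batch once per epoch and a batch of size τ in the other
iterations. -/

namespace MVRC

/-! ### The proximal map of a convex function -/

section Prox

variable {d : ℕ} {r : Vec d → ℝ}

lemma continuous_of_convexOn_univ (hr : ConvexOn ℝ Set.univ r) : Continuous r :=
  continuousOn_univ.mp (hr.continuousOn isOpen_univ)

/-- A convex function on `ℝ^d` decreases at most linearly. -/
lemma exists_linear_lower_bound (hr : ConvexOn ℝ Set.univ r) :
    ∃ K : ℝ, 0 ≤ K ∧ ∀ u, -K * (1 + ‖u‖) ≤ r u := by
  have hc := continuous_of_convexOn_univ hr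
  obtain ⟨M, hM⟩ := (isCompact_closedBall (0 : Vec d) 1).exists_bound_of_continuousOn hc.continuousOn
  have hM0 : 0 ≤ M := (norm_nonneg _).trans (hM 0 (by simp))
  refine ⟨2 * M, by positivity, fun u => ?_⟩
  by_cases hu : ‖u‖ ≤ 1
  · have h1 := hM u (by simpa using hu)
    rw [Real.norm_eq_abs] at h1
    nlinarith [neg_abs_le (r u), norm_nonneg u]
  · push Not at hu
    have hpos : 0 < ‖u‖ := by linarith
    -- The origin lies between u and the opposite unit vector w. Convexity on that segment bounds r
    -- u from below by values of r on the unit ball, where |r| ≤ M.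
    set w : Vec d := -(‖u‖⁻¹ • u) with hw
    have hwn : ‖w‖ ≤ 1 := by
      rw [hw, norm_neg, norm_smul, norm_inv, norm_norm, inv_mul_cancel₀ hpos.ne']
    have hrw := hM w (by simpa using hwn)
    have hr0 := hM 0 (by simp)
    rw [Real.norm_eq_abs] at hrw hr0
    have hconv := hr.2 (Set.mem_univ w) (Set.mem_univ u)
      (show 0 ≤ ‖u‖ / (1 + ‖u‖) by positivity) (show 0 ≤ 1 / (1 + ‖u‖) by positivity)
      (by field_simp; ring)
    have hzero : (‖u‖ / (1 + ‖u‖)) • w + (1 / (1 + ‖u‖)) • u = 0 := by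
      rw [hw, smul_neg, smul_smul, neg_add_eq_zero]
      congr 1
      field_simp
    rw [hzero] at hconv
    simp only [smul_eq_mul] at hconv
    have h2 : (1 + ‖u‖) * r 0 ≤ ‖u‖ * r w + r u := by
      have := mul_le_mul_of_nonneg_left hconv (show 0 ≤ 1 + ‖u‖ by positivity)
      have e : (1 + ‖u‖) * (‖u‖ / (1 + ‖u‖) * r w + 1 / (1 + ‖u‖) * r u) = ‖u‖ * r w + r u := by
        field_simp
      linarith
    have a1 := neg_abs_le (r 0)
    have a2 := le_abs_self (r w)
    have h3 : r u ≥ -(1 + 2 * ‖u‖) * M := by nlinarith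
    nlinarith

/-- The quadratic term beats the linear lower bound on r, so the continuous objective is coercive.
-/
lemma exists_isMinOn_prox (hr : ConvexOn ℝ Set.univ r) {lam : ℝ} (hl : 0 < lam) (x : Vec d) :
    ∃ y : Vec d, IsMinOn (fun u : Vec d => r u + 1 / (2 * lam) * ‖u - x‖ ^ 2) Set.univ y := by
  have hc := continuous_of_convexOn_univ hr
  obtain ⟨K, hK0, hK⟩ := exists_linear_lower_bound hr
  have hcont : Continuous fun u : Vec d => r u + 1 / (2 * lam) * ‖u - x‖ ^ 2 := by fun_prop
  have hlim : Filter.Tendsto (fun u : Vec d => r u + 1 / (2 * lam) * ‖u - x‖ ^ 2)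
      (Filter.cocompact (Vec d)) Filter.atTop := by
    have hnorm : Filter.Tendsto (fun u : Vec d => ‖u - x‖) (Filter.cocompact (Vec d))
        Filter.atTop := by
      refine Filter.tendsto_atTop_mono (fun u => ?_)
        (Filter.tendsto_atTop_add_const_right _ (-‖x‖) (tendsto_norm_cocompact_atTop (E := Vec d)))
      have := norm_sub_norm_le u x
      linarith
    have hpoly : Filter.Tendsto (fun s : ℝ => s * (1 / (2 * lam) * s + (-K)) + (-K * (1 + ‖x‖)))
        Filter.atTop Filter.atTop := by
      apply Filter.tendsto_atTop_add_const_right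
      apply Filter.Tendsto.atTop_mul_atTop₀ Filter.tendsto_id
      apply Filter.tendsto_atTop_add_const_right
      exact Filter.Tendsto.const_mul_atTop (by positivity) Filter.tendsto_id
    refine Filter.tendsto_atTop_mono (fun u => ?_) (hpoly.comp hnorm)
    have h1 := hK u
    have h2 : ‖u‖ ≤ ‖u - x‖ + ‖x‖ := by
      have := norm_add_le (u - x) x
      simpa using this
    simp only [Function.comp]
    nlinarith
  obtain ⟨y, hy⟩ := hcont.exists_forall_le hlim
  exact ⟨y, fun u _ => hy u⟩

lemma isMinOn_prox (hr : ConvexOn ℝ Set.univ r) {lam : ℝ} (hl : 0 < lam) (x : Vec d) :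
    IsMinOn (fun u : Vec d => r u + 1 / (2 * lam) * ‖u - x‖ ^ 2) Set.univ (prox r lam x) :=
  Classical.epsilon_spec (exists_isMinOn_prox hr hl x)

/-- The variational inequality that characterizes the proximal point. -/
lemma prox_variational (hr : ConvexOn ℝ Set.univ r) {lam : ℝ} (hl : 0 < lam) (x u : Vec d) :
    r (prox r lam x) + 1 / lam * inner ℝ (x - prox r lam x) (u - prox r lam x) ≤ r u := by
  set y := prox r lam x with hy
  -- Compare the minimizer y with y + s (u - y), divide by s, and let s tend to 0; the right-hand
  -- side is the second-order remainder.
  have hmin : ∀ s : ℝ, 0 < s → s ≤ 1 →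
      r y + 1 / lam * inner ℝ (x - y) (u - y) - r u ≤ s * (1 / (2 * lam) * ‖u - y‖ ^ 2) := by
    intro s hs0 hs1
    have h1 : r y + 1 / (2 * lam) * ‖y - x‖ ^ 2 ≤
        r (y + s • (u - y)) + 1 / (2 * lam) * ‖y + s • (u - y) - x‖ ^ 2 :=
      isMinOn_prox hr hl x (Set.mem_univ _)
    have h2 : r (y + s • (u - y)) ≤ (1 - s) * r y + s * r u := by
      have := hr.2 (Set.mem_univ y) (Set.mem_univ u) (sub_nonneg.mpr hs1) hs0.le
        (by ring)
      simp only [smul_eq_mul] at this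
      have e : (1 - s) • y + s • u = y + s • (u - y) := by module
      rwa [e] at this
    have h3 : ‖y + s • (u - y) - x‖ ^ 2 =
        ‖y - x‖ ^ 2 - 2 * s * inner ℝ (x - y) (u - y) + s ^ 2 * ‖u - y‖ ^ 2 := by
      have : y + s • (u - y) - x = s • (u - y) - (x - y) := by module
      rw [this, norm_sub_sq_real, norm_smul, inner_smul_left, Real.norm_eq_abs, mul_pow, sq_abs,
        real_inner_comm, norm_sub_rev y x]
      simp
      ring
    rw [h3] at h1
    have h4 : s * (r y + 1 / lam * inner ℝ (x - y) (u - y) - r u) ≤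
        s * (s * (1 / (2 * lam) * ‖u - y‖ ^ 2)) := by
      have e : 1 / lam = 2 * (1 / (2 * lam)) := by field_simp
      rw [e]
      linarith
    exact le_of_mul_le_mul_left h4 hs0
  have hlim : Filter.Tendsto (fun s : ℝ => s * (1 / (2 * lam) * ‖u - y‖ ^ 2))
      (nhdsWithin 0 (Set.Ioi 0)) (nhds 0) := by
    have : Filter.Tendsto (fun s : ℝ => s * (1 / (2 * lam) * ‖u - y‖ ^ 2)) (nhds 0)
        (nhds (0 * (1 / (2 * lam) * ‖u - y‖ ^ 2))) := by
      exact (continuous_id.mul continuous_const).tendsto 0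
    rw [zero_mul] at this
    exact this.mono_left nhdsWithin_le_nhds
  have := ge_of_tendsto hlim (b := r y + 1 / lam * inner ℝ (x - y) (u - y) - r u) (by
    filter_upwards [Ioc_mem_nhdsGT (zero_lt_one' ℝ)] with s hs using hmin s hs.1 hs.2)
  linarith

/-- Test the variational inequality of each proximal point with the other one and add: the values of
r cancel, leaving ‖a - b‖² ≤ ⟨x - y, a - b⟩. -/
lemma norm_prox_sub_prox_le (hr : ConvexOn ℝ Set.univ r) {lam : ℝ} (hl : 0 < lam) (x y : Vec d) :
    ‖prox r lam x - prox r lam y‖ ≤ ‖x - y‖ := by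
  have h1 := prox_variational hr hl x (prox r lam y)
  have h2 := prox_variational hr hl y (prox r lam x)
  set a := prox r lam x
  set b := prox r lam y
  have h3 : 1 / lam * (inner ℝ (x - a) (b - a) + inner ℝ (y - b) (a - b)) ≤ 0 := by linarith
  have h4 : inner ℝ (x - a) (b - a) + inner ℝ (y - b) (a - b) ≤ 0 := by
    by_contra h
    push Not at h
    have : 0 < 1 / lam * (inner ℝ (x - a) (b - a) + inner ℝ (y - b) (a - b)) := by positivity
    linarith
  have h5 : inner ℝ (x - a) (b - a) + inner ℝ (y - b) (a - b) =
      ‖a - b‖ ^ 2 - inner ℝ (x - y) (a - b) := by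
    have e1 : b - a = -(a - b) := by abel
    rw [e1, inner_neg_right, ← real_inner_self_eq_norm_sq]
    have e2 : inner ℝ (a - b) (a - b) = inner ℝ a (a - b) - inner ℝ b (a - b) := inner_sub_left _ _ _
    rw [e2, inner_sub_left, inner_sub_left, inner_sub_left]
    ring
  have h6 := real_inner_le_norm (x - y) (a - b)
  by_cases h7 : ‖a - b‖ = 0
  · rw [h7]; positivity
  · have : 0 < ‖a - b‖ := lt_of_le_of_ne (norm_nonneg _) (Ne.symm h7)
    nlinarith

lemma continuous_prox (hr : ConvexOn ℝ Set.univ r) {lam : ℝ} (hl : 0 < lam) :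
    Continuous (prox r lam) := by
  have : LipschitzWith 1 (prox r lam) := LipschitzWith.of_dist_le_mul fun x y => by
    simpa [dist_eq_norm] using norm_prox_sub_prox_le hr hl x y
  exact this.continuous

/-- The decrease of `r` in a proximal gradient step with direction `v`. -/
lemma prox_step_decrease (hr : ConvexOn ℝ Set.univ r) {lam : ℝ} (hl : 0 < lam) (x v : Vec d) :
    r (prox r lam (x - lam • v)) + inner ℝ v (prox r lam (x - lam • v) - x) +
      1 / lam * ‖prox r lam (x - lam • v) - x‖ ^ 2 ≤ r x := by
  have h := prox_variational hr hl (x - lam • v) x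
  set y := prox r lam (x - lam • v)
  have e : inner ℝ (x - lam • v - y) (x - y) = ‖y - x‖ ^ 2 + lam * inner ℝ v (y - x) := by
    have e1 : x - lam • v - y = -(y - x) - lam • v := by module
    have e2 : x - y = -(y - x) := by abel
    rw [e1, e2, inner_sub_left, inner_neg_neg, inner_neg_right, inner_smul_left,
      real_inner_self_eq_norm_sq]
    simp
  rw [e, mul_add, ← mul_assoc, one_div_mul_cancel hl.ne'] at h
  linarith

/-- The point x₀ is an arbitrary anchor: nonexpansiveness bounds the new iterate through the norms
of x and v alone, which keeps the iterates bounded uniformly in the samples. -/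
lemma norm_prox_sub_self_le (hr : ConvexOn ℝ Set.univ r) {lam : ℝ} (hl : 0 < lam)
    (x v x₀ : Vec d) :
    ‖prox r lam (x - lam • v)‖ ≤ ‖x‖ + lam * ‖v‖ + ‖x₀‖ + ‖prox r lam x₀‖ := by
  have h1 := norm_prox_sub_prox_le hr hl (x - lam • v) x₀
  have h2 : ‖prox r lam (x - lam • v)‖ ≤
      ‖prox r lam (x - lam • v) - prox r lam x₀‖ + ‖prox r lam x₀‖ := by
    simpa using norm_add_le (prox r lam (x - lam • v) - prox r lam x₀) (prox r lam x₀)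
  have h3 : ‖x - lam • v - x₀‖ ≤ ‖x‖ + lam * ‖v‖ + ‖x₀‖ := by
    have a1 := norm_sub_le (x - lam • v) x₀
    have a2 := norm_sub_le x (lam • v)
    rw [norm_smul, Real.norm_eq_abs, abs_of_pos hl] at a2
    linarith
  linarith

end Prox

/-! ### Smoothness of the composition and sensitivity of its gradient -/

section Smooth

variable {d p : ℕ}

lemma frob_nonneg (J : Vec d →L[ℝ] Vec p) : 0 ≤ frob J := Real.sqrt_nonneg _

lemma frob_sq (J : Vec d →L[ℝ] Vec p) :
    frob J ^ 2 = ∑ j : Fin d, ‖J (EuclideanSpace.single j 1)‖ ^ 2 :=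
  Real.sq_sqrt (Finset.sum_nonneg fun _ _ => by positivity)

lemma apply_eq_sum_single (J : Vec d →L[ℝ] Vec p) (x : Vec d) :
    J x = ∑ j : Fin d, x j • J (EuclideanSpace.single j 1) := by
  conv_lhs => rw [← (EuclideanSpace.basisFun (Fin d) ℝ).sum_repr x]
  simp [map_sum]

lemma norm_le_frob (J : Vec d →L[ℝ] Vec p) : ‖J‖ ≤ frob J := by
  refine ContinuousLinearMap.opNorm_le_bound _ (frob_nonneg J) fun x => ?_
  rw [apply_eq_sum_single J x]
  refine (norm_sum_le _ _).trans ?_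
  simp only [norm_smul]
  refine (Real.sum_mul_le_sqrt_mul_sqrt _ _ _).trans ?_
  rw [mul_comm, EuclideanSpace.norm_eq]
  rfl

lemma norm_gradient_le {f : Vec p → ℝ} {lf : ℝ≥0} (hf : LipschitzWith lf f) (x : Vec p) :
    ‖∇ f x‖ ≤ lf := by
  rw [gradient, LinearIsometryEquiv.norm_map]
  exact norm_fderiv_le_of_lipschitz ℝ hf

lemma hasGradientAt_smoothPart {f : Vec p → ℝ} {gbar : Vec d → Vec p}
    (hf : Differentiable ℝ f) (hg : Differentiable ℝ gbar) (x : Vec d) :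
    HasGradientAt (smoothPart f gbar)
      (ContinuousLinearMap.adjoint (fderiv ℝ gbar x) (∇ f (gbar x))) x := by
  rw [hasGradientAt_iff_hasFDerivAt]
  have h1 := (hf (gbar x)).hasGradientAt.hasFDerivAt.comp x (hg x).hasFDerivAt
  have e : InnerProductSpace.toDual ℝ (Vec d)
      (ContinuousLinearMap.adjoint (fderiv ℝ gbar x) (∇ f (gbar x))) =
      (InnerProductSpace.toDual ℝ (Vec p) (∇ f (gbar x))).comp (fderiv ℝ gbar x) := by
    ext u
    simp [InnerProductSpace.toDual_apply_apply, ContinuousLinearMap.adjoint_inner_left]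
  rw [e]
  exact h1

lemma gradient_smoothPart {f : Vec p → ℝ} {gbar : Vec d → Vec p}
    (hf : Differentiable ℝ f) (hg : Differentiable ℝ gbar) (x : Vec d) :
    ∇ (smoothPart f gbar) x =
      ContinuousLinearMap.adjoint (fderiv ℝ gbar x) (∇ f (gbar x)) :=
  (hasGradientAt_smoothPart hf hg x).gradient

/-- The splitting puts the Jacobian error against ∇f(G), bounded by `lf` everywhere, and the value
error against J'. Thus only the exact Jacobian J' has to be bounded, not the estimate J. -/
lemma norm_adjoint_sub_adjoint_le {f : Vec p → ℝ} {lf Lf lg : ℝ≥0} (hf : LipschitzWith lf f)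
    (hf' : LipschitzWith Lf (∇ f)) (J J' : Vec d →L[ℝ] Vec p) (G G' : Vec p) (hJ : ‖J'‖ ≤ lg) :
    ‖ContinuousLinearMap.adjoint J (∇ f G) - ContinuousLinearMap.adjoint J' (∇ f G')‖ ≤
      lf * ‖J - J'‖ + lg * Lf * ‖G - G'‖ := by
  have e : ContinuousLinearMap.adjoint J (∇ f G) - ContinuousLinearMap.adjoint J' (∇ f G') =
      ContinuousLinearMap.adjoint (J - J') (∇ f G) +
        ContinuousLinearMap.adjoint J' (∇ f G - ∇ f G') := by
    simp only [map_sub, sub_apply]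
    abel
  rw [e]
  refine (norm_add_le _ _).trans ?_
  have h1 := (ContinuousLinearMap.adjoint (J - J')).le_opNorm (∇ f G)
  have h2 := (ContinuousLinearMap.adjoint J').le_opNorm (∇ f G - ∇ f G')
  rw [LinearIsometryEquiv.norm_map] at h1 h2
  have h3 := norm_gradient_le hf G
  have h4 := hf'.norm_sub_le G G'
  have h5 : ‖J - J'‖ * ‖∇ f G‖ ≤ lf * ‖J - J'‖ := by
    rw [mul_comm]; gcongr
  have h6 : ‖J'‖ * ‖∇ f G - ∇ f G'‖ ≤ lg * (Lf * ‖G - G'‖) := by gcongr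
  linarith

lemma LF_nonneg (lf Lf lg Lg : ℝ≥0) : 0 ≤ LF lf Lf lg Lg := by unfold LF; positivity

lemma G0_nonneg (lf Lf lg Lg : ℝ≥0) : 0 ≤ G0 lf Lf lg Lg := by unfold G0; positivity

/-- Regularity of the averaged inner mapping. -/
structure InnerRegular (gbar : Vec d → Vec p) (lg Lg : ℝ≥0) : Prop where
  diff : Differentiable ℝ gbar
  lip : LipschitzWith lg gbar
  jac_lip : ∀ x y, ‖fderiv ℝ gbar x - fderiv ℝ gbar y‖ ≤ Lg * ‖x - y‖

lemma norm_gradient_smoothPart_sub_le {f : Vec p → ℝ} {gbar : Vec d → Vec p} {lf Lf lg Lg : ℝ≥0}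
    (hd : Differentiable ℝ f) (hf : LipschitzWith lf f) (hf' : LipschitzWith Lf (∇ f))
    (hg : InnerRegular gbar lg Lg) (x y : Vec d) :
    ‖∇ (smoothPart f gbar) x - ∇ (smoothPart f gbar) y‖ ≤ LF lf Lf lg Lg * ‖x - y‖ := by
  rw [gradient_smoothPart hd hg.diff, gradient_smoothPart hd hg.diff]
  refine (norm_adjoint_sub_adjoint_le (lg := lg) hf hf' _ _ _ _
    (norm_fderiv_le_of_lipschitz ℝ hg.lip)).trans ?_
  have h1 := hg.jac_lip x y
  have h2 := hg.lip.norm_sub_le x y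
  have h3 : (lf : ℝ) * ‖fderiv ℝ gbar x - fderiv ℝ gbar y‖ ≤ lf * (Lg * ‖x - y‖) := by gcongr
  have h4 : (lg : ℝ) * Lf * ‖gbar x - gbar y‖ ≤ lg * Lf * (lg * ‖x - y‖) := by gcongr
  unfold LF
  linarith

/-- The mean value inequality on the segment, where the derivative differs from the one at x by at
most L ‖y - x‖. This gives L instead of the sharp L/2, and the later constants allow for it. -/
lemma smoothPart_le_of_gradient_lipschitz {F : Vec d → ℝ} {L : ℝ} (hL : 0 ≤ L)
    (hF : Differentiable ℝ F) (hF' : ∀ x y, ‖∇ F x - ∇ F y‖ ≤ L * ‖x - y‖) (x y : Vec d) :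
    F y ≤ F x + inner ℝ (∇ F x) (y - x) + L * ‖y - x‖ ^ 2 := by
  have h := (convex_segment x y).norm_image_sub_le_of_norm_fderiv_le' (𝕜 := ℝ) (f := F)
    (C := L * ‖y - x‖) (φ := fderiv ℝ F x) (fun w _ => hF w) (fun w hw => ?_)
    (left_mem_segment ℝ x y) (right_mem_segment ℝ x y)
  · have e : fderiv ℝ F x (y - x) = inner ℝ (∇ F x) (y - x) := by
      rw [(hF x).hasGradientAt.hasFDerivAt.fderiv, InnerProductSpace.toDual_apply_apply]
    rw [e, Real.norm_eq_abs] at h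
    have := (abs_le.mp h).2
    nlinarith
  · have e : ‖fderiv ℝ F w - fderiv ℝ F x‖ = ‖∇ F w - ∇ F x‖ := by
      rw [gradient, gradient, ← map_sub, LinearIsometryEquiv.norm_map]
    rw [e]
    refine (hF' w x).trans ?_
    gcongr
    obtain ⟨a, b, ha, hb, hab, rfl⟩ := hw
    have e2 : a • x + b • y - x = b • (y - x) := by
      rw [← eq_sub_iff_add_eq] at hab
      subst hab
      module
    rw [e2, norm_smul, Real.norm_eq_abs, abs_of_nonneg hb]
    exact mul_le_of_le_one_left (norm_nonneg _) (by linarith)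

/-! ### The scaled pair of an inner value and a Jacobian as one vector -/

/-- The Hilbert space that holds a value and the columns of a Jacobian. -/
abbrev Pairs (d p : ℕ) : Type := PiLp 2 fun _ : Option (Fin d) => Vec p

/-- The value `G` scaled by `a` together with the columns of `J` scaled by `b`. -/
noncomputable def pairing (a b : ℝ) : (Vec p × (Vec d →L[ℝ] Vec p)) →L[ℝ] Pairs d p :=
  (PiLp.continuousLinearEquiv 2 ℝ fun _ : Option (Fin d) => Vec p).symm.toContinuousLinearMap ∘L
    ContinuousLinearMap.pi fun o : Option (Fin d) =>
      o.elim (a • ContinuousLinearMap.fst ℝ (Vec p) (Vec d →L[ℝ] Vec p)) fun j =>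
        b • (ContinuousLinearMap.apply ℝ (Vec p) (EuclideanSpace.single j 1) ∘L
          ContinuousLinearMap.snd ℝ (Vec p) (Vec d →L[ℝ] Vec p))

lemma pairing_none (a b : ℝ) (q : Vec p × (Vec d →L[ℝ] Vec p)) :
    pairing a b q none = a • q.1 := by
  simp [pairing]

lemma pairing_some (a b : ℝ) (q : Vec p × (Vec d →L[ℝ] Vec p)) (j : Fin d) :
    pairing a b q (some j) = b • q.2 (EuclideanSpace.single j 1) := by
  simp [pairing]

/-- This identity is the purpose of `Pairs`: the operator norm of a Jacobian does not come from an
inner product, but its columns with the Frobenius norm do, so orthogonality of errors can be used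
for values and Jacobians at once. -/
lemma norm_pairing_sq (a b : ℝ) (q : Vec p × (Vec d →L[ℝ] Vec p)) :
    ‖pairing a b q‖ ^ 2 = a ^ 2 * ‖q.1‖ ^ 2 + b ^ 2 * frob q.2 ^ 2 := by
  rw [PiLp.norm_sq_eq_of_L2, Fintype.sum_option, frob_sq, Finset.mul_sum]
  simp only [pairing_none, pairing_some, norm_smul, mul_pow, Real.norm_eq_abs, sq_abs]

/-- The pairing whose norm controls the error of the composite gradient. -/
noncomputable def errPairing (lf Lf lg : ℝ≥0) : (Vec p × (Vec d →L[ℝ] Vec p)) →L[ℝ] Pairs d p :=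
  pairing (√2 * (lg * Lf)) (√2 * lf)

lemma norm_errPairing_sq (lf Lf lg : ℝ≥0) (q : Vec p × (Vec d →L[ℝ] Vec p)) :
    ‖errPairing lf Lf lg q‖ ^ 2 =
      2 * ((lg : ℝ) ^ 2 * Lf ^ 2 * ‖q.1‖ ^ 2 + lf ^ 2 * frob q.2 ^ 2) := by
  have h := Real.sq_sqrt (show (0 : ℝ) ≤ 2 by norm_num)
  rw [errPairing, norm_pairing_sq]
  simp only [mul_pow, h]
  ring

/-- Squaring a sum of two terms costs the factor 2 that `errPairing` carries as √2; the same factor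
2 appears in `G0` and `sigma0Sq`. -/
lemma norm_adjoint_sub_adjoint_sq_le {f : Vec p → ℝ} {lf Lf lg : ℝ≥0} (hf : LipschitzWith lf f)
    (hf' : LipschitzWith Lf (∇ f)) (q q' : Vec p × (Vec d →L[ℝ] Vec p)) (hJ : ‖q'.2‖ ≤ lg) :
    ‖ContinuousLinearMap.adjoint q.2 (∇ f q.1) - ContinuousLinearMap.adjoint q'.2 (∇ f q'.1)‖ ^ 2 ≤
      ‖errPairing lf Lf lg q - errPairing lf Lf lg q'‖ ^ 2 := by
  rw [← map_sub, norm_errPairing_sq]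
  have h := norm_adjoint_sub_adjoint_le hf hf' q.2 q'.2 q.1 q'.1 hJ
  have h1 : (lf : ℝ) * ‖q.2 - q'.2‖ ≤ lf * frob (q.2 - q'.2) := by
    gcongr; exact norm_le_frob _
  have h2 := pow_le_pow_left₀ (norm_nonneg _) (h.trans (add_le_add_left h1 _)) 2
  refine h2.trans ?_
  simp only [Prod.fst_sub, Prod.snd_sub]
  nlinarith [sq_nonneg ((lf : ℝ) * frob (q.2 - q'.2) - lg * Lf * ‖q.1 - q'.1‖)]

lemma norm_errPairing_sub_sq_le {g : Vec d → Vec p} {lf Lf lg Lg : ℝ≥0} (hg : LipschitzWith lg g)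
    (hg' : ∀ x y, frob (fderiv ℝ g x - fderiv ℝ g y) ≤ Lg * ‖x - y‖) (x y : Vec d) :
    ‖errPairing lf Lf lg (g x, fderiv ℝ g x) - errPairing lf Lf lg (g y, fderiv ℝ g y)‖ ^ 2 ≤
      G0 lf Lf lg Lg * ‖x - y‖ ^ 2 := by
  rw [← map_sub, norm_errPairing_sq]
  simp only [Prod.mk_sub_mk]
  have h1 := pow_le_pow_left₀ (norm_nonneg _) (hg.norm_sub_le x y) 2
  have h2 := pow_le_pow_left₀ (frob_nonneg _) (hg' x y) 2
  have h3 : (lg : ℝ) ^ 2 * Lf ^ 2 * ‖g x - g y‖ ^ 2 ≤ lg ^ 2 * Lf ^ 2 * (lg * ‖x - y‖) ^ 2 := by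
    gcongr
  have h4 : (lf : ℝ) ^ 2 * frob (fderiv ℝ g x - fderiv ℝ g y) ^ 2 ≤
      lf ^ 2 * (Lg * ‖x - y‖) ^ 2 := by gcongr
  unfold G0
  nlinarith

end Smooth

/-! ### Momentum sequences and the deterministic descent estimates -/

section Momentum

variable {E : Type*} [NormedAddCommGroup E] [InnerProductSpace ℝ E]

lemma dimMomentum_succ (t : ℕ) : dimMomentum (t + 1) = 2 / ((t : ℝ) + 2) := by
  unfold dimMomentum; push_cast; ring

lemma dimMomentum_succ_pos (t : ℕ) : 0 < dimMomentum (t + 1) := by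
  rw [dimMomentum_succ]; positivity

lemma dimMomentum_succ_le_one (t : ℕ) : dimMomentum (t + 1) ≤ 1 := by
  rw [dimMomentum_succ, div_le_one (by positivity)]
  have : (0 : ℝ) ≤ t := t.cast_nonneg
  linarith

/-- Convexity of the squared norm, with the missing weight a - c placed at the origin. -/
lemma norm_sq_combination_le (u v : E) {a c : ℝ} (ha1 : a ≤ 1) (hc : 0 ≤ c)
    (hca : c ≤ a) : ‖(1 - a) • u + c • v‖ ^ 2 ≤ (1 - a) * ‖u‖ ^ 2 + c * ‖v‖ ^ 2 := by
  have h : ‖(1 - a) • u + c • v‖ ≤ (1 - a) * ‖u‖ + c * ‖v‖ := by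
    refine (norm_add_le _ _).trans ?_
    rw [norm_smul, norm_smul, Real.norm_eq_abs, Real.norm_eq_abs, abs_of_nonneg hc,
      abs_of_nonneg (sub_nonneg.mpr ha1)]
  refine (pow_le_pow_left₀ (norm_nonneg _) h 2).trans ?_
  have h1 : 0 ≤ (1 - a) * c * (‖u‖ - ‖v‖) ^ 2 := by
    have := sub_nonneg.mpr ha1
    positivity
  have h2 : 0 ≤ (1 - a) * (a - c) * ‖u‖ ^ 2 := by
    have h3 := sub_nonneg.mpr ha1
    have h4 := sub_nonneg.mpr hca
    positivity
  have h5 : 0 ≤ c * (a - c) * ‖v‖ ^ 2 := by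
    have h4 := sub_nonneg.mpr hca
    positivity
  nlinarith

/-- The three sequences of an accelerated method with momentum `α_t = 2 / (t + 1)`, run for `T`
iterations; `1 - γ_t` is the ratio of the step of `y` to the step of `x`. -/
structure MomentumSeq (T : ℕ) (x y z : ℕ → E) (γ : ℕ → ℝ) : Prop where
  nonneg : ∀ t < T, 0 ≤ γ t
  le : ∀ t < T, γ t ≤ dimMomentum (t + 1)
  weight : ∀ t < T, ((t : ℝ) + 2) * γ t ≤ 4 * (1 - γ t)
  init : x 0 = y 0
  query : ∀ t, z t = (1 - dimMomentum (t + 1)) • y t + dimMomentum (t + 1) • x t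
  step : ∀ t < T, y (t + 1) = z t + (1 - γ t) • (x (t + 1) - x t)

namespace MomentumSeq

variable {T : ℕ} {x y z : ℕ → E} {γ : ℕ → ℝ}

/-- Before the step of y, the gap x - z is (1 - α) times x - y. Then x moves by the full step and y
by its fraction 1 - γ, so the gap gains γ times the step. -/
lemma error_step (h : MomentumSeq T x y z γ) {t : ℕ} (ht : t < T) :
    ‖x (t + 1) - y (t + 1)‖ ^ 2 ≤
      (1 - dimMomentum (t + 1)) * ‖x t - y t‖ ^ 2 + γ t * ‖x (t + 1) - x t‖ ^ 2 := by
  have e : x (t + 1) - y (t + 1) =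
      (1 - dimMomentum (t + 1)) • (x t - y t) + γ t • (x (t + 1) - x t) := by
    rw [h.step t ht, h.query t]; module
  rw [e]
  exact norm_sq_combination_le _ _ (dimMomentum_succ_le_one t) (h.nonneg t ht) (h.le t ht)

/-- Multiply `error_step` by t + 2. Since (t + 2)(1 - 2/(t + 2)) = t, the quantity t ‖x_t - y_t‖² is
a potential, and each step leaves over one further copy of ‖x_{t+1} - y_{t+1}‖², which is the
summand collected here. -/
lemma sum_error_succ_add_le (h : MomentumSeq T x y z γ) {n : ℕ} (hn : n ≤ T) :
    ∑ t ∈ Finset.range n, ‖x (t + 1) - y (t + 1)‖ ^ 2 + n * ‖x n - y n‖ ^ 2 ≤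
      4 * ∑ t ∈ Finset.range n, (1 - γ t) * ‖x (t + 1) - x t‖ ^ 2 := by
  induction n with
  | zero => simp
  | succ n ih =>
    have h1 := ih (by omega)
    have h2 := h.error_step (t := n) (by omega)
    rw [dimMomentum_succ] at h2
    have h3 := mul_le_mul_of_nonneg_left h2 (show (0 : ℝ) ≤ n + 2 by positivity)
    have e : ((n : ℝ) + 2) * ((1 - 2 / ((n : ℝ) + 2)) * ‖x n - y n‖ ^ 2 +
        γ n * ‖x (n + 1) - x n‖ ^ 2) =
        n * ‖x n - y n‖ ^ 2 + (n + 2) * (γ n * ‖x (n + 1) - x n‖ ^ 2) := by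
      field_simp; ring
    rw [e] at h3
    have h4 := mul_le_mul_of_nonneg_right (h.weight n (by omega)) (sq_nonneg ‖x (n + 1) - x n‖)
    rw [Finset.sum_range_succ, Finset.sum_range_succ]
    push_cast
    linarith

lemma sum_error_le (h : MomentumSeq T x y z γ) :
    ∑ t ∈ Finset.range T, ‖x t - y t‖ ^ 2 ≤
      4 * ∑ t ∈ Finset.range T, (1 - γ t) * ‖x (t + 1) - x t‖ ^ 2 := by
  have h1 := h.sum_error_succ_add_le le_rfl
  have h2 : ∑ t ∈ Finset.range T, ‖x t - y t‖ ^ 2 ≤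
      ∑ t ∈ Finset.range T, ‖x (t + 1) - y (t + 1)‖ ^ 2 := by
    have e := Finset.sum_range_succ' (fun t => ‖x t - y t‖ ^ 2) T
    rw [Finset.sum_range_succ, h.init, sub_self, norm_zero] at e
    nlinarith [sq_nonneg ‖x T - y T‖]
  have h3 : 0 ≤ (T : ℝ) * ‖x T - y T‖ ^ 2 := by positivity
  linarith

lemma sum_query_diff_le (h : MomentumSeq T x y z γ) :
    ∑ t ∈ Finset.range T, ‖z (t + 1) - z t‖ ^ 2 ≤
      ∑ t ∈ Finset.range T,
        (2 * (1 - γ t) ^ 2 + 32 / 9 * (1 - γ t)) * ‖x (t + 1) - x t‖ ^ 2 := by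
  have h1 : ∀ t ∈ Finset.range T, ‖z (t + 1) - z t‖ ^ 2 ≤
      2 * (1 - γ t) ^ 2 * ‖x (t + 1) - x t‖ ^ 2 + 8 / 9 * ‖x (t + 1) - y (t + 1)‖ ^ 2 := by
    intro t ht
    rw [Finset.mem_range] at ht
    set u := (1 - γ t) • (x (t + 1) - x t)
    set v := dimMomentum (t + 1 + 1) • (x (t + 1) - y (t + 1))
    -- The query point moves first to y_{t+1}, then by the fraction α_{t+2} ≤ 2/3 towards x_{t+1}.
    -- This gives 2 · 4/9 = 8/9, and multiplied by the 4 of `sum_error_succ_add_le` the constant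
    -- 32/9.
    have e : z (t + 1) - z t = u + v := by
      have hu : u = y (t + 1) - z t := by rw [h.step t ht]; abel
      rw [h.query (t + 1), hu]; module
    have hu : ‖u‖ ^ 2 = (1 - γ t) ^ 2 * ‖x (t + 1) - x t‖ ^ 2 := by
      rw [norm_smul, mul_pow, Real.norm_eq_abs, sq_abs]
    have hv : ‖v‖ ^ 2 ≤ 4 / 9 * ‖x (t + 1) - y (t + 1)‖ ^ 2 := by
      rw [norm_smul, mul_pow, Real.norm_eq_abs, sq_abs]
      gcongr
      have hα : dimMomentum (t + 1 + 1) ≤ 2 / 3 := by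
        rw [dimMomentum_succ]
        gcongr
        push_cast
        have : (0 : ℝ) ≤ t := t.cast_nonneg
        linarith
      have := dimMomentum_succ_pos (t + 1)
      nlinarith
    have h2 : ‖u + v‖ ^ 2 ≤ 2 * ‖u‖ ^ 2 + 2 * ‖v‖ ^ 2 := by
      have := parallelogram_law_with_norm ℝ u v
      nlinarith [sq_nonneg ‖u - v‖]
    rw [e]
    linarith
  refine (Finset.sum_le_sum h1).trans ?_
  have h2 := h.sum_error_succ_add_le le_rfl
  have h3 : 0 ≤ (T : ℝ) * ‖x T - y T‖ ^ 2 := by positivity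
  simp only [add_mul, Finset.sum_add_distrib, mul_assoc, ← Finset.mul_sum]
  linarith

lemma norm_query_sub_le (h : MomentumSeq T x y z γ) (t : ℕ) : ‖z t - x t‖ ≤ ‖x t - y t‖ := by
  have e : z t - x t = -((1 - dimMomentum (t + 1)) • (x t - y t)) := by
    rw [h.query t]; module
  have h1 := dimMomentum_succ_pos t
  have h2 := dimMomentum_succ_le_one t
  rw [e, norm_neg, norm_smul, Real.norm_eq_abs, abs_of_nonneg (by linarith)]
  exact mul_le_of_le_one_left (norm_nonneg _) (by linarith)

end MomentumSeq

/-- Write the condition as 2 β s ≤ 1 - 8 β L and square it: the term 64 β² L² appears on both sides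
and cancels. -/
lemma AdmissibleBeta.bounds {lf Lf lg Lg : ℝ≥0} {β : ℝ} (h : AdmissibleBeta lf Lf lg Lg β) :
    0 ≤ β * LF lf Lf lg Lg ∧ 0 ≤ β ^ 2 * G0 lf Lf lg Lg ∧
      24 * (β ^ 2 * G0 lf Lf lg Lg) ≤ 1 - 16 * (β * LF lf Lf lg Lg) := by
  obtain ⟨hβ, h1⟩ := h
  have hL := LF_nonneg lf Lf lg Lg
  have hG := G0_nonneg lf Lf lg Lg
  set L := LF lf Lf lg Lg
  set G := G0 lf Lf lg Lg
  refine ⟨by positivity, by positivity, ?_⟩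
  set s := √(16 * L ^ 2 + 6 * G)
  have hs : s ^ 2 = 16 * L ^ 2 + 6 * G := Real.sq_sqrt (by positivity)
  have hs0 : 0 ≤ s := Real.sqrt_nonneg _
  have h2 : 2 * (β * s) ≤ 1 - 8 * (β * L) := by linarith
  have h3 := pow_le_pow_left₀ (by positivity) h2 2
  have h4 : (2 * (β * s)) ^ 2 = 4 * (β ^ 2 * (16 * L ^ 2 + 6 * G)) := by rw [← hs]; ring
  nlinarith

/-- The net decrease per iteration, in units of `‖x_{t+1} - x_t‖² / β`. -/
lemma net_decrease_coefficient {a b q : ℝ} (ha : 0 ≤ a) (hb : 0 ≤ b) (hab : 24 * b ≤ 1 - 16 * a)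
    (hq : 1 / 3 ≤ q) (hq1 : q ≤ 1) :
    1 / 40 ≤ q - 1 / 6 - a * (3 / 2 + 2 * q) - 3 / 2 * (b * (2 * q ^ 2 + 32 / 9 * q)) := by
  -- Replacing 24 b by its largest value leaves an expression affine in a, smallest at q = 1/3, a =
  -- 1/16, b = 0, with value 1/32.
  have h1 : 24 * b * (2 * q ^ 2 + 32 / 9 * q) ≤ (1 - 16 * a) * (2 * q ^ 2 + 32 / 9 * q) :=
    mul_le_mul_of_nonneg_right hab (by positivity)
  have h2 : a ≤ 1 / 16 := by linarith
  have h3 : 0 ≤ (q - 1 / 3) * (1 - q) := mul_nonneg (by linarith) (by linarith)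
  have h4 : 0 ≤ (1 - 16 * a) * ((q - 1 / 3) * (1 - q)) := mul_nonneg (by linarith) h3
  have h5 : 0 ≤ (1 - 16 * a) * (q - 1 / 3) := mul_nonneg (by linarith) (by linarith)
  have h6 : 0 ≤ a * (q - 1 / 3) := mul_nonneg ha (by linarith)
  nlinarith

/-! ### Descent of the objective and the size of the gradient mapping -/

section Descent

variable {d : ℕ} {F r : Vec d → ℝ} {T : ℕ} {x y z v : ℕ → Vec d} {lam : ℕ → ℝ} {β L : ℝ}

/-- The loss 3L/2 is L from the smoothness bound and L/2 from Young's inequality for the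
displacement term. Young's inequality for the direction error has weight 1/(6β), which leaves part
of 1/λ even when λ = 3β. -/
lemma objective_step_le (hr : ConvexOn ℝ Set.univ r) (hβ : 0 < β) (hL : 0 ≤ L)
    (hF : Differentiable ℝ F) (hF' : ∀ x y, ‖∇ F x - ∇ F y‖ ≤ L * ‖x - y‖)
    {lam e : ℝ} (hlam : 0 < lam) (x z v : Vec d) (hz : ‖z - x‖ ≤ e) :
    F (prox r lam (x - lam • v)) + r (prox r lam (x - lam • v)) +
      (1 / lam - 3 / 2 * L - 1 / (6 * β)) * ‖prox r lam (x - lam • v) - x‖ ^ 2 ≤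
      F x + r x + L / 2 * e ^ 2 + 3 * β / 2 * ‖v - ∇ F z‖ ^ 2 := by
  have h1 := prox_step_decrease hr hlam x v
  set x' := prox r lam (x - lam • v)
  have h2 := smoothPart_le_of_gradient_lipschitz hL hF hF' x x'
  have h3 : inner ℝ (∇ F x) (x' - x) - inner ℝ v (x' - x) ≤
      (L * e + ‖v - ∇ F z‖) * ‖x' - x‖ := by
    rw [← inner_sub_left]
    refine (real_inner_le_norm _ _).trans ?_
    gcongr
    have h4 : ∇ F x - v = (∇ F x - ∇ F z) - (v - ∇ F z) := by abel
    rw [h4]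
    refine (norm_sub_le _ _).trans ?_
    have h5 := hF' x z
    rw [norm_sub_rev x z] at h5
    have h6 := mul_le_mul_of_nonneg_left hz hL
    linarith
  set D := ‖x' - x‖
  set δ := ‖v - ∇ F z‖
  have h4 : L * e * D ≤ L / 2 * D ^ 2 + L / 2 * e ^ 2 := by
    nlinarith [mul_nonneg hL (sq_nonneg (e - D))]
  have h5 : δ * D ≤ 1 / (6 * β) * D ^ 2 + 3 * β / 2 * δ ^ 2 := by
    have : 1 / (6 * β) * D ^ 2 + 3 * β / 2 * δ ^ 2 - δ * D = 1 / (6 * β) * (D - 3 * β * δ) ^ 2 := by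
      field_simp; ring
    have h6 : 0 ≤ 1 / (6 * β) * (D - 3 * β * δ) ^ 2 := by positivity
    linarith
  linarith

/-- The true proximal point at z and the computed x' are images of nearby points under one
nonexpansive map, so z minus the former is controlled by the step, the displacement (twice) and λ
times the direction error. Dividing by λ ≥ β and squaring three terms gives the factor 3. -/
lemma norm_gradMap_sq_le (hr : ConvexOn ℝ Set.univ r) (hβ : 0 < β) {lam e : ℝ} (hlam : β ≤ lam)
    (x z v : Vec d) (hz : ‖z - x‖ ≤ e) :
    ‖gradMap F r lam z‖ ^ 2 ≤ 3 * (1 / β ^ 2 * ‖prox r lam (x - lam • v) - x‖ ^ 2 +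
      4 / β ^ 2 * e ^ 2 + ‖v - ∇ F z‖ ^ 2) := by
  have hl : 0 < lam := hβ.trans_le hlam
  set x' := prox r lam (x - lam • v)
  have h1 := norm_prox_sub_prox_le hr hl (x - lam • v) (z - lam • ∇ F z)
  set w := prox r lam (z - lam • ∇ F z)
  have e0 : 0 ≤ e := (norm_nonneg _).trans hz
  have h2 : ‖(x - lam • v) - (z - lam • ∇ F z)‖ ≤ e + lam * ‖v - ∇ F z‖ := by
    have e1 : (x - lam • v) - (z - lam • ∇ F z) = -(z - x) - lam • (v - ∇ F z) := by module
    rw [e1]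
    refine (norm_sub_le _ _).trans ?_
    rw [norm_neg, norm_smul, Real.norm_eq_abs, abs_of_pos hl]
    gcongr
  have h3 : ‖z - w‖ ≤ ‖x' - x‖ + 2 * e + lam * ‖v - ∇ F z‖ := by
    have e1 : z - w = (z - x) - (x' - x) + (x' - w) := by abel
    rw [e1]
    have h4 := norm_add_le ((z - x) - (x' - x)) (x' - w)
    have h5 := norm_sub_le (z - x) (x' - x)
    linarith
  have h4 : ‖gradMap F r lam z‖ ≤ 1 / β * ‖x' - x‖ + 2 / β * e + ‖v - ∇ F z‖ := by
    rw [gradMap, norm_smul, Real.norm_eq_abs, abs_of_pos (by positivity)]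
    calc 1 / lam * ‖z - w‖ ≤ 1 / lam * (‖x' - x‖ + 2 * e + lam * ‖v - ∇ F z‖) := by gcongr
      _ = 1 / lam * (‖x' - x‖ + 2 * e) + ‖v - ∇ F z‖ := by field_simp
      _ ≤ 1 / β * (‖x' - x‖ + 2 * e) + ‖v - ∇ F z‖ := by gcongr
      _ = _ := by ring
  refine (pow_le_pow_left₀ (norm_nonneg _) h4 2).trans ?_
  set A := 1 / β * ‖x' - x‖ with hA
  set B := 2 / β * e with hB
  have e1 : 1 / β ^ 2 * ‖x' - x‖ ^ 2 = A ^ 2 := by rw [hA]; ring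
  have e2 : 4 / β ^ 2 * e ^ 2 = B ^ 2 := by rw [hB]; ring
  rw [e1, e2]
  nlinarith [sq_nonneg (A - B), sq_nonneg (A - ‖v - ∇ F z‖), sq_nonneg (B - ‖v - ∇ F z‖)]

/-- Everything is multiplied by β so that the step sizes enter only through β / λ_t. The values of Φ
telescope, and the displacements are absorbed by `MomentumSeq.sum_error_le`, which adds 2 β L (β /
λ_t) to the loss. -/
lemma sum_net_decrease_le (hr : ConvexOn ℝ Set.univ r) (hβ : 0 < β) (hlam : ∀ t < T, β ≤ lam t)
    (hm : MomentumSeq T x y z fun t => 1 - β / lam t)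
    (hx : ∀ t < T, x (t + 1) = prox r (lam t) (x t - lam t • v t))
    (hL : 0 ≤ L) (hF : Differentiable ℝ F)
    (hF' : ∀ x y, ‖∇ F x - ∇ F y‖ ≤ L * ‖x - y‖) :
    ∑ t ∈ Finset.range T,
        (β / lam t - 1 / 6 - β * L * (3 / 2 + 2 * (β / lam t))) * ‖x (t + 1) - x t‖ ^ 2 ≤
      β * (F (x 0) + r (x 0) - (F (x T) + r (x T))) +
        3 / 2 * β ^ 2 * ∑ t ∈ Finset.range T, ‖v t - ∇ F (z t)‖ ^ 2 := by
  have h1 : ∀ t ∈ Finset.range T,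
      (β / lam t - 1 / 6 - β * L * (3 / 2)) * ‖x (t + 1) - x t‖ ^ 2 ≤
      β * ((F (x t) + r (x t)) - (F (x (t + 1)) + r (x (t + 1)))) +
        β * L / 2 * ‖x t - y t‖ ^ 2 + 3 / 2 * β ^ 2 * ‖v t - ∇ F (z t)‖ ^ 2 := by
    intro t ht
    rw [Finset.mem_range] at ht
    have h := objective_step_le hr hβ hL hF hF' (hβ.trans_le (hlam t ht)) (x t) (z t) (v t)
      (hm.norm_query_sub_le t)
    rw [← hx t ht] at h
    have h2 := mul_le_mul_of_nonneg_left h hβ.le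
    have e : β * (F (x (t + 1)) + r (x (t + 1)) +
        (1 / lam t - 3 / 2 * L - 1 / (6 * β)) * ‖x (t + 1) - x t‖ ^ 2) =
        β * (F (x (t + 1)) + r (x (t + 1))) +
        (β / lam t - 1 / 6 - β * L * (3 / 2)) * ‖x (t + 1) - x t‖ ^ 2 := by
      have : β * (1 / (6 * β)) = 1 / 6 := by field_simp
      linear_combination -‖x (t + 1) - x t‖ ^ 2 * this
    rw [e] at h2
    linarith
  have h2 := Finset.sum_le_sum h1
  have h3 := hm.sum_error_le
  have h4 := Finset.sum_range_sub' (fun t => F (x t) + r (x t)) T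
  rw [Finset.sum_add_distrib, Finset.sum_add_distrib, ← Finset.mul_sum, ← Finset.mul_sum,
    ← Finset.mul_sum, h4] at h2
  have h5 := mul_le_mul_of_nonneg_left h3 (show 0 ≤ β * L / 2 by positivity)
  have e : ∑ t ∈ Finset.range T,
        (β / lam t - 1 / 6 - β * L * (3 / 2 + 2 * (β / lam t))) * ‖x (t + 1) - x t‖ ^ 2 =
      ∑ t ∈ Finset.range T, (β / lam t - 1 / 6 - β * L * (3 / 2)) * ‖x (t + 1) - x t‖ ^ 2 -
      β * L / 2 *
        (4 * ∑ t ∈ Finset.range T, (1 - (1 - β / lam t)) * ‖x (t + 1) - x t‖ ^ 2) := by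
    rw [← mul_assoc, Finset.mul_sum, ← Finset.sum_sub_distrib]
    exact Finset.sum_congr rfl fun t _ => by ring
  rw [e]
  linarith

lemma sum_gradMap_sq_le (hr : ConvexOn ℝ Set.univ r) (hβ : 0 < β) (hlam : ∀ t < T, β ≤ lam t)
    (hm : MomentumSeq T x y z fun t => 1 - β / lam t)
    (hx : ∀ t < T, x (t + 1) = prox r (lam t) (x t - lam t • v t)) :
    ∑ t ∈ Finset.range T, ‖gradMap F r (lam t) (z t)‖ ^ 2 ≤
      51 / β ^ 2 * ∑ t ∈ Finset.range T, ‖x (t + 1) - x t‖ ^ 2 +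
        3 * ∑ t ∈ Finset.range T, ‖v t - ∇ F (z t)‖ ^ 2 := by
  have h1 : ∀ t ∈ Finset.range T, ‖gradMap F r (lam t) (z t)‖ ^ 2 ≤
      3 / β ^ 2 * ‖x (t + 1) - x t‖ ^ 2 + 12 / β ^ 2 * ‖x t - y t‖ ^ 2 +
        3 * ‖v t - ∇ F (z t)‖ ^ 2 := by
    intro t ht
    rw [Finset.mem_range] at ht
    have h := norm_gradMap_sq_le (F := F) hr hβ (hlam t ht) (x t) (z t) (v t)
      (hm.norm_query_sub_le t)
    rw [← hx t ht] at h
    refine h.trans (le_of_eq ?_)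
    ring
  refine (Finset.sum_le_sum h1).trans ?_
  rw [Finset.sum_add_distrib, Finset.sum_add_distrib, ← Finset.mul_sum, ← Finset.mul_sum,
    ← Finset.mul_sum]
  have h3 := hm.sum_error_le
  have h4 : ∑ t ∈ Finset.range T, (1 - (1 - β / lam t)) * ‖x (t + 1) - x t‖ ^ 2 ≤
      ∑ t ∈ Finset.range T, ‖x (t + 1) - x t‖ ^ 2 := by
    refine Finset.sum_le_sum fun t ht => mul_le_of_le_one_left (sq_nonneg _) ?_
    rw [Finset.mem_range] at ht
    have := hm.nonneg t ht
    linarith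
  have h5 := mul_le_mul_of_nonneg_left (h3.trans (mul_le_mul_of_nonneg_left h4 zero_le_four))
    (show 0 ≤ 12 / β ^ 2 by positivity)
  -- 51 = 3 + 12 · 4: the step itself, and the displacements converted into steps.
  have e : 51 / β ^ 2 * ∑ t ∈ Finset.range T, ‖x (t + 1) - x t‖ ^ 2 =
      3 / β ^ 2 * ∑ t ∈ Finset.range T, ‖x (t + 1) - x t‖ ^ 2 +
      12 / β ^ 2 * (4 * ∑ t ∈ Finset.range T, ‖x (t + 1) - x t‖ ^ 2) := by ring
  rw [e]
  linarith

end Descent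

end Momentum
-- Averages over minibatches
section BatchMean

variable {Ξ V W : Type*} [NormedAddCommGroup V] [NormedSpace ℝ V] [NormedAddCommGroup W]
  [NormedSpace ℝ W]

lemma batchMean_sub (A : Multiset Ξ) (h h' : Ξ → V) :
    (batchMean A fun k => h k - h' k) = batchMean A h - batchMean A h' := by
  rw [batchMean, Multiset.sum_map_sub, smul_sub]; rfl

lemma map_batchMean (L : V →L[ℝ] W) (A : Multiset Ξ) (h : Ξ → V) :
    L (batchMean A h) = batchMean A fun k => L (h k) := by
  rw [batchMean, map_smul, map_multiset_sum, Multiset.map_map]; rfl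

lemma batchMean_prodMk (A : Multiset Ξ) (h : Ξ → V) (h' : Ξ → W) :
    (batchMean A h, batchMean A h') = batchMean A fun k => (h k, h' k) := by
  have h1 := map_batchMean (ContinuousLinearMap.fst ℝ V W) A fun k => (h k, h' k)
  have h2 := map_batchMean (ContinuousLinearMap.snd ℝ V W) A fun k => (h k, h' k)
  exact Prod.ext h1.symm h2.symm

lemma norm_batchMean_le {A : Multiset Ξ} {h : Ξ → V} {M : ℝ} (hM : 0 ≤ M) (hh : ∀ k, ‖h k‖ ≤ M) :
    ‖batchMean A h‖ ≤ M := by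
  have h1 : ‖(A.map h).sum‖ ≤ Multiset.card A * M := by
    induction A using Multiset.induction with
    | empty => simp
    | cons a A ih =>
      rw [Multiset.map_cons, Multiset.sum_cons, Multiset.card_cons]
      have := norm_add_le (h a) (A.map h).sum
      have := hh a
      push_cast
      linarith
  rw [batchMean, norm_smul, Real.norm_eq_abs, abs_of_nonneg (by positivity)]
  by_cases hc : (Multiset.card A : ℝ) = 0
  -- An empty batch has mean 0, because 1 / 0 = 0.
  · rw [hc]; simpa using hM
  · have hpos : 0 < (Multiset.card A : ℝ) := lt_of_le_of_ne (Nat.cast_nonneg _) (Ne.symm hc)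
    calc 1 / (Multiset.card A : ℝ) * ‖(A.map h).sum‖ ≤
        1 / (Multiset.card A : ℝ) * (Multiset.card A * M) := by gcongr
      _ = M := by field_simp

end BatchMean

/-! ### The path inequalities for a run with fixed minibatches -/

section Path

variable {d p : ℕ} {Ξ : Type*} {f : Vec p → ℝ} {g : Ξ → Vec d → Vec p} {gbar : Vec d → Vec p}
  {r : Vec d → ℝ} {lf Lf lg Lg : ℝ≥0} {T τ : ℕ} {β : ℝ} {lam : ℕ → ℝ} {x₀ : Vec d}

/-- The error, after scaling, of the estimates that are used in iteration `t`. -/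
noncomputable def estErr (lf Lf lg : ℝ≥0) (f : Vec p → ℝ) (g : Ξ → Vec d → Vec p)
    (gbar : Vec d → Vec p) (r : Vec d → ℝ) (par : Params) (x₀ : Vec d) (A : ℕ → Multiset Ξ)
    (t : ℕ) : Pairs d p :=
  errPairing lf Lf lg ((run f g r par x₀ A (t + 1)).gEst, (run f g r par x₀ A (t + 1)).jEst) -
    errPairing lf Lf lg
      (gbar (zIter f g r par x₀ A t), fderiv ℝ gbar (zIter f g r par x₀ A t))

/-- Here 1 + α_t = (t + 3) / (t + 1). The loosest case is t = 0, where α_0 = 2 permits λ_0 = 3β. -/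
lemma AdmissibleLam.ratio_bounds (h : AdmissibleLam T β lam) (hβ : 0 < β) {t : ℕ} (ht : t < T) :
    0 < lam t ∧ β ≤ lam t ∧ ((t : ℝ) + 1) / (t + 3) ≤ β / lam t ∧ β / lam t ≤ 1 := by
  obtain ⟨h1, h2⟩ := h t ht
  have hl : 0 < lam t := hβ.trans_le h1
  refine ⟨hl, h1, ?_, (div_le_one hl).mpr h1⟩
  rw [div_le_div_iff₀ (by positivity) hl]
  have h3 : ((t : ℝ) + 1) * lam t ≤ (t + 1) * ((1 + dimMomentum t) * β) := by gcongr
  have h4 : ((t : ℝ) + 1) * ((1 + dimMomentum t) * β) = β * (t + 3) := by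
    unfold dimMomentum; field_simp; ring
  linarith

lemma AdmissibleLam.one_third_le (h : AdmissibleLam T β lam) (hβ : 0 < β) {t : ℕ} (ht : t < T) :
    1 / 3 ≤ β / lam t := by
  refine le_trans ?_ (h.ratio_bounds hβ ht).2.2.1
  rw [div_le_div_iff₀ (by norm_num) (by positivity)]
  have : (0 : ℝ) ≤ t := t.cast_nonneg
  linarith

lemma momentumSeq_run (h : AdmissibleLam T β lam) (hβ : 0 < β) (A : ℕ → Multiset Ξ) :
    MomentumSeq T (fun t => (run f g r (dimParams τ β lam) x₀ A t).x)
      (fun t => (run f g r (dimParams τ β lam) x₀ A t).y)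
      (zIter f g r (dimParams τ β lam) x₀ A) fun t => 1 - β / lam t where
  nonneg t ht := sub_nonneg.mpr (h.ratio_bounds hβ ht).2.2.2
  le t ht := by
    have h1 := (h.ratio_bounds hβ ht).2.2.1
    have h2 : 1 - ((t : ℝ) + 1) / (t + 3) ≤ dimMomentum (t + 1) := by
      rw [dimMomentum_succ, one_sub_div (by positivity)]
      rw [div_le_div_iff₀ (by positivity) (by positivity)]
      linarith
    linarith
  weight t ht := by
    have h1 := (h.ratio_bounds hβ ht).2.2.1
    rw [div_le_iff₀ (by positivity)] at h1
    have h2 := h.one_third_le hβ ht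
    have : (0 : ℝ) ≤ t := t.cast_nonneg
    -- At t = 0 and β / λ = 1/3 the inequality is an equality, which fixes the constant 4 in
    -- `MomentumSeq.weight`.
    rcases Nat.eq_zero_or_pos t with rfl | h3
    · push_cast; linarith
    · have h4 : (1 : ℝ) ≤ t := by exact_mod_cast h3
      nlinarith
  init := rfl
  query t := rfl
  step t ht := by
    rw [sub_sub_cancel]
    rfl

lemma run_x_succ (par : Params) (A : ℕ → Multiset Ξ) (t : ℕ) :
    (run f g r par x₀ A (t + 1)).x = prox r (par.lam t) ((run f g r par x₀ A t).x - par.lam t •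
      ContinuousLinearMap.adjoint (run f g r par x₀ A (t + 1)).jEst
        (∇ f (run f g r par x₀ A (t + 1)).gEst)) := rfl

lemma norm_direction_sub_le (hreg : Regular f g gbar r lf Lf lg Lg)
    (hin : InnerRegular gbar lg Lg) (par : Params) (A : ℕ → Multiset Ξ) (t : ℕ) :
    ‖ContinuousLinearMap.adjoint (run f g r par x₀ A (t + 1)).jEst
        (∇ f (run f g r par x₀ A (t + 1)).gEst) -
      ∇ (smoothPart f gbar) (zIter f g r par x₀ A t)‖ ≤
      ‖estErr lf Lf lg f g gbar r par x₀ A t‖ := by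
  rw [← sq_le_sq₀ (norm_nonneg _) (norm_nonneg _), gradient_smoothPart hreg.f_diff hin.diff]
  exact norm_adjoint_sub_adjoint_sq_le hreg.f_lip hreg.f_grad_lip
    ((run f g r par x₀ A (t + 1)).gEst, (run f g r par x₀ A (t + 1)).jEst)
    (gbar (zIter f g r par x₀ A t), fderiv ℝ gbar (zIter f g r par x₀ A t))
    (norm_fderiv_le_of_lipschitz ℝ hin.lip)

lemma gap_nonneg (hreg : Regular f g gbar r lf Lf lg Lg) (x₀ : Vec d) : 0 ≤ gap f gbar r x₀ :=
  sub_nonneg.mpr (ciInf_le hreg.bdd_below x₀)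

lemma differentiable_smoothPart (hreg : Regular f g gbar r lf Lf lg Lg)
    (hin : InnerRegular gbar lg Lg) : Differentiable ℝ (smoothPart f gbar) :=
  hreg.f_diff.comp hin.diff

lemma run_sum_net_decrease_le (hreg : Regular f g gbar r lf Lf lg Lg)
    (hin : InnerRegular gbar lg Lg) (hβ : 0 < β) (h : AdmissibleLam T β lam)
    (A : ℕ → Multiset Ξ) :
    ∑ t ∈ Finset.range T,
        (β / lam t - 1 / 6 - β * LF lf Lf lg Lg * (3 / 2 + 2 * (β / lam t))) *
          ‖(run f g r (dimParams τ β lam) x₀ A (t + 1)).x -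
            (run f g r (dimParams τ β lam) x₀ A t).x‖ ^ 2 ≤
      β * gap f gbar r x₀ + 3 / 2 * β ^ 2 * ∑ t ∈ Finset.range T,
        ‖estErr lf Lf lg f g gbar r (dimParams τ β lam) x₀ A t‖ ^ 2 := by
  refine (sum_net_decrease_le hreg.r_convex hβ (fun t ht => (h.ratio_bounds hβ ht).2.1)
    (momentumSeq_run h hβ A) (fun t _ => run_x_succ (dimParams τ β lam) A t)
    (LF_nonneg lf Lf lg Lg) (differentiable_smoothPart hreg hin)
    (norm_gradient_smoothPart_sub_le hreg.f_diff hreg.f_lip hreg.f_grad_lip hin)).trans ?_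
  gcongr
  · have h1 : (⨅ x, objective f gbar r x) ≤
        objective f gbar r (run f g r (dimParams τ β lam) x₀ A T).x := ciInf_le hreg.bdd_below _
    unfold objective at h1
    unfold gap objective
    have h2 : (run f g r (dimParams τ β lam) x₀ A 0).x = x₀ := rfl
    rw [h2]
    linarith
  · exact norm_direction_sub_le hreg hin _ A _

lemma run_sum_query_diff_le (hβ : 0 < β) (h : AdmissibleLam T β lam) (A : ℕ → Multiset Ξ) :
    ∑ t ∈ Finset.range T, ‖zIter f g r (dimParams τ β lam) x₀ A (t + 1) -
        zIter f g r (dimParams τ β lam) x₀ A t‖ ^ 2 ≤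
      ∑ t ∈ Finset.range T, (2 * (β / lam t) ^ 2 + 32 / 9 * (β / lam t)) *
        ‖(run f g r (dimParams τ β lam) x₀ A (t + 1)).x -
          (run f g r (dimParams τ β lam) x₀ A t).x‖ ^ 2 := by
  simpa only [sub_sub_cancel] using
    (momentumSeq_run (f := f) (g := g) (r := r) (τ := τ) (x₀ := x₀) h hβ A).sum_query_diff_le

lemma run_sum_accuracy_sq_le (hreg : Regular f g gbar r lf Lf lg Lg)
    (hin : InnerRegular gbar lg Lg) (hβ : 0 < β) (h : AdmissibleLam T β lam)
    (A : ℕ → Multiset Ξ) :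
    ∑ t ∈ Finset.range T, accuracy f g gbar r (dimParams τ β lam) x₀ A t ^ 2 ≤
      51 / β ^ 2 * ∑ t ∈ Finset.range T, ‖(run f g r (dimParams τ β lam) x₀ A (t + 1)).x -
        (run f g r (dimParams τ β lam) x₀ A t).x‖ ^ 2 +
      3 * ∑ t ∈ Finset.range T, ‖estErr lf Lf lg f g gbar r (dimParams τ β lam) x₀ A t‖ ^ 2 := by
  refine (sum_gradMap_sq_le hreg.r_convex hβ (fun t ht => (h.ratio_bounds hβ ht).2.1)
    (momentumSeq_run h hβ A) (fun t _ => run_x_succ (dimParams τ β lam) A t)).trans ?_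
  gcongr
  exact norm_direction_sub_le hreg hin _ A _

lemma norm_queryPoint_le (τ : ℕ) (β : ℝ) (lam : ℕ → ℝ) (t : ℕ) (s : State d p) :
    ‖queryPoint (dimParams τ β lam) t s‖ ≤ ‖s.y‖ + ‖s.x‖ := by
  have h1 := dimMomentum_succ_pos t
  have h2 := dimMomentum_succ_le_one t
  have e : queryPoint (dimParams τ β lam) t s =
    (1 - dimMomentum (t + 1)) • s.y + dimMomentum (t + 1) • s.x := rfl
  rw [e]
  refine (norm_add_le _ _).trans ?_
  rw [norm_smul, norm_smul, Real.norm_eq_abs, Real.norm_eq_abs, abs_of_pos h1,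
    abs_of_nonneg (by linarith)]
  gcongr
  · exact mul_le_of_le_one_left (norm_nonneg _) (by linarith)
  · exact mul_le_of_le_one_left (norm_nonneg _) (by linarith)

/-- The iterates are bounded independently of the samples. -/
lemma exists_run_bound (hreg : Regular f g gbar r lf Lf lg Lg) (hβ : 0 < β)
    (h : AdmissibleLam T β lam) {t : ℕ} (ht : t ≤ T) :
    ∃ M : ℝ, ∀ A : ℕ → Multiset Ξ, ‖(run f g r (dimParams τ β lam) x₀ A t).x‖ ≤ M ∧
      ‖(run f g r (dimParams τ β lam) x₀ A t).y‖ ≤ M ∧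
      ‖(run f g r (dimParams τ β lam) x₀ A t).jEst‖ ≤ M := by
  induction t with
  | zero => exact ⟨‖x₀‖, fun A => ⟨le_rfl, le_rfl, by simp [run]⟩⟩
  | succ t ih =>
    obtain ⟨M, hM⟩ := ih (by omega)
    obtain ⟨hl, h1, -, h2⟩ := h.ratio_bounds hβ (t := t) (by omega)
    have hJ : ∀ k x, ‖fderiv ℝ (g k) x‖ ≤ lg := fun k x =>
      norm_fderiv_le_of_lipschitz ℝ (hreg.g_lip k)
    have hlg : (0 : ℝ) ≤ lg := lg.coe_nonneg
    -- B bounds the new Jacobian estimate in both branches. No bound on the estimated inner value is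
    -- needed, as ∇f is bounded everywhere; over all samples that value may be unbounded.
    set B := M + 2 * (lg : ℝ) with hB
    set X := M + lam t * (B * lf) + ‖(0 : Vec d)‖ + ‖prox r (lam t) 0‖ with hX
    refine ⟨B + X + (M + M + (X + M)), fun A => ?_⟩
    obtain ⟨hx, hy, hj⟩ := hM A
    set s := run f g r (dimParams τ β lam) x₀ A t with hs
    have hM0 : 0 ≤ M := (norm_nonneg _).trans hx
    have hB0 : 0 ≤ B := by positivity
    have hX0 : 0 ≤ X := by positivity
    have hj' : ‖(run f g r (dimParams τ β lam) x₀ A (t + 1)).jEst‖ ≤ B := by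
      change ‖newJ g (dimParams τ β lam) (A t) t s‖ ≤ B
      unfold newJ
      split_ifs
      · have := norm_batchMean_le (A := A t) hlg fun k =>
          hJ k (queryPoint (dimParams τ β lam) t s)
        linarith
      · refine (norm_add_le _ _).trans ?_
        have := norm_batchMean_le (A := A t) (M := 2 * (lg : ℝ))
          (h := fun k => fderiv ℝ (g k) (queryPoint (dimParams τ β lam) t s) -
            fderiv ℝ (g k) s.zLast) (by positivity) fun k => by
            have h3 := norm_sub_le (fderiv ℝ (g k) (queryPoint (dimParams τ β lam) t s))
              (fderiv ℝ (g k) s.zLast)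
            have h4 := hJ k (queryPoint (dimParams τ β lam) t s)
            have h5 := hJ k s.zLast
            linarith
        linarith
    have hx' : ‖(run f g r (dimParams τ β lam) x₀ A (t + 1)).x‖ ≤ X := by
      rw [run_x_succ]
      refine (norm_prox_sub_self_le hreg.r_convex hl _ _ 0).trans ?_
      rw [hX]
      have hv := (ContinuousLinearMap.adjoint
        (run f g r (dimParams τ β lam) x₀ A (t + 1)).jEst).le_opNorm
        (∇ f (run f g r (dimParams τ β lam) x₀ A (t + 1)).gEst)
      rw [LinearIsometryEquiv.norm_map] at hv
      have hv' := hv.trans (mul_le_mul hj' (norm_gradient_le hreg.f_lip _) (norm_nonneg _) hB0)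
      have := mul_le_mul_of_nonneg_left hv' hl.le
      change ‖s.x‖ + lam t * _ + _ + _ ≤ _
      linarith
    have hy' : ‖(run f g r (dimParams τ β lam) x₀ A (t + 1)).y‖ ≤ M + M + (X + M) := by
      have e : (run f g r (dimParams τ β lam) x₀ A (t + 1)).y =
        queryPoint (dimParams τ β lam) t s +
          (β / lam t) • ((run f g r (dimParams τ β lam) x₀ A (t + 1)).x - s.x) := rfl
      rw [e]
      refine (norm_add_le _ _).trans ?_
      have hq := norm_queryPoint_le τ β lam t s
      rw [norm_smul, Real.norm_eq_abs, abs_of_pos (by positivity)]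
      have h4 := norm_sub_le (run f g r (dimParams τ β lam) x₀ A (t + 1)).x s.x
      have h5 := mul_le_of_le_one_left (norm_nonneg
        ((run f g r (dimParams τ β lam) x₀ A (t + 1)).x - s.x)) h2
      linarith
    refine ⟨?_, ?_, ?_⟩ <;> linarith

end Path

/-! ### Accumulation of errors over epochs -/

section Epochs

/-- Summation over epochs of length `τ` of errors that are reset to `V` at the start of each epoch
and grow by `c / τ * W` per iteration inside an epoch. -/
lemma sum_epoch_error_le {T τ : ℕ} (hτ : 0 < τ) {U W : ℕ → ℝ} {V c : ℝ} (hc : 0 ≤ c)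
    (hW : ∀ t, 0 ≤ W t) (h0 : ∀ t < T, t % τ = 0 → U t ≤ V)
    (h1 : ∀ t, t + 1 < T → (t + 1) % τ ≠ 0 → U (t + 1) ≤ U t + c / τ * W t) :
    ∑ t ∈ Finset.range T, U t ≤ c * ∑ t ∈ Finset.range T, W t + T * V := by
  -- Unroll the recursion back to the last refresh, which happened at τ (t / τ).
  have hU : ∀ t < T, U t ≤ V + c / τ * ∑ s ∈ Finset.Ico (τ * (t / τ)) t, W s := by
    intro t
    induction t with
    | zero =>
      intro ht
      simpa using h0 0 ht (Nat.zero_mod τ)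
    | succ t ih =>
      intro ht
      by_cases hm : (t + 1) % τ = 0
      · refine (h0 _ ht hm).trans (le_add_of_nonneg_right ?_)
        have := Finset.sum_nonneg (s := Finset.Ico (τ * ((t + 1) / τ)) (t + 1)) fun s _ => hW s
        positivity
      · have hq := Nat.div_add_mod (t + 1) τ
        have hlt := Nat.mod_lt (t + 1) hτ
        have hdiv : t / τ = (t + 1) / τ := by
          refine Nat.div_eq_of_lt_le ?_ ?_
          · rw [mul_comm]; omega
          · rw [add_mul, mul_comm]; omega
        have h2 := ih (by omega)
        rw [hdiv] at h2
        rw [Finset.sum_Ico_succ_top (by omega), mul_add]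
        have := h1 t ht hm
        linarith
  have hswap : ∑ t ∈ Finset.range T, ∑ s ∈ Finset.Ico (τ * (t / τ)) t, W s ≤
      τ * ∑ s ∈ Finset.range T, W s := by
    have e : ∑ t ∈ Finset.range T, ∑ s ∈ Finset.Ico (τ * (t / τ)) t, W s =
        ∑ s ∈ Finset.range T,
          ∑ t ∈ (Finset.range T).filter fun t => τ * (t / τ) ≤ s ∧ s < t, W s := by
      refine Finset.sum_comm' fun t s => ?_
      simp only [Finset.mem_range, Finset.mem_Ico, Finset.mem_filter]
      constructor
      · rintro ⟨h1, h2, h3⟩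
        exact ⟨⟨h1, h2, h3⟩, h3.trans h1⟩
      · rintro ⟨⟨h1, h2, h3⟩, h4⟩
        exact ⟨h1, h2, h3⟩
    rw [e, Finset.mul_sum]
    refine Finset.sum_le_sum fun s _ => ?_
    rw [Finset.sum_const, nsmul_eq_mul]
    refine mul_le_mul_of_nonneg_right ?_ (hW s)
    -- A displacement at s affects only later iterations of the same epoch, hence at most τ of them;
    -- this τ cancels the one in c / τ.
    have hsub : ((Finset.range T).filter fun t => τ * (t / τ) ≤ s ∧ s < t) ⊆
        Finset.Ioc s (s + τ) := by
      intro t ht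
      simp only [Finset.mem_filter, Finset.mem_Ioc] at ht ⊢
      have hq := Nat.div_add_mod t τ
      have hlt := Nat.mod_lt t hτ
      omega
    have := Finset.card_le_card hsub
    rw [Nat.card_Ioc] at this
    exact_mod_cast this.trans (by omega)
  have hsum := Finset.sum_le_sum fun t ht => hU t (Finset.mem_range.mp ht)
  rw [Finset.sum_add_distrib, ← Finset.mul_sum, Finset.sum_const, Finset.card_range,
    nsmul_eq_mul] at hsum
  have hcτ : 0 ≤ c / (τ : ℝ) := by positivity
  have h3 := mul_le_mul_of_nonneg_left hswap hcτ
  have e : c / (τ : ℝ) * (τ * ∑ s ∈ Finset.range T, W s) = c * ∑ s ∈ Finset.range T, W s := by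
    have : (τ : ℝ) ≠ 0 := by exact_mod_cast hτ.ne'
    field_simp
  linarith

end Epochs

/-! ### Integration with the past frozen -/

section Freezing

variable {Ω S Y : Type*}

lemma lintegral_of_indepFun {mΩ : MeasurableSpace Ω} {μ : Measure Ω} [IsProbabilityMeasure μ]
    {mS : MeasurableSpace S} {mY : MeasurableSpace Y} {s : Ω → S} {y : Ω → Y}
    (h : IndepFun s y μ) (hs : Measurable s) (hy : Measurable y) {φ : S × Y → ENNReal}
    (hφ : Measurable φ) :
    ∫⁻ ω, φ (s ω, y ω) ∂μ = ∫⁻ ω, ∫⁻ ω', φ (s ω, y ω') ∂μ ∂μ := by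
  have h1 := (indepFun_iff_map_prod_eq_prod_map_map hs.aemeasurable hy.aemeasurable).mp h
  have h2 : ∫⁻ ω, φ (s ω, y ω) ∂μ = ∫⁻ q, φ q ∂(μ.map fun ω => (s ω, y ω)) :=
    (lintegral_map hφ (hs.prodMk hy)).symm
  have := Measure.isProbabilityMeasure_map (μ := μ) hy.aemeasurable
  rw [h2, h1, lintegral_prod _ hφ.aemeasurable, lintegral_map hφ.lintegral_prod_right' hs]
  exact lintegral_congr fun ω => lintegral_map (hφ.comp measurable_prodMk_left) hy

/-- An expectation may be computed with the part that is measurable with respect to the past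
`ℱ` frozen, if the rest is measurable with respect to an independent `𝒢`. -/
lemma lintegral_le_of_indep {mS : MeasurableSpace S} {ℱ 𝒢 mΩ : MeasurableSpace Ω}
    {μ : Measure Ω} [IsProbabilityMeasure μ]
    (hℱ : ℱ ≤ mΩ) (h𝒢 : 𝒢 ≤ mΩ) (h : Indep ℱ 𝒢 μ)
    {s : Ω → S} (hs : Measurable[ℱ] s) {φ : S × Ω → ENNReal}
    (hφ : Measurable[MeasurableSpace.prod mS 𝒢] φ) {ψ : S → ENNReal}
    (hψ : ∀ a, ∫⁻ ω, φ (a, ω) ∂μ ≤ ψ a) :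
    ∫⁻ ω, φ (s ω, ω) ∂μ ≤ ∫⁻ ω, ψ (s ω) ∂μ := by
  -- The identity into Ω with the σ-algebra 𝒢 serves as second variable. It generates 𝒢, so it is
  -- independent of s, and the freezing formula for two independent variables applies.
  have hid : @IndepFun Ω S Ω mΩ mS 𝒢 s id μ := by
    refine indep_of_indep_of_le_left (indep_of_indep_of_le_right h ?_) hs.comap_le
    rw [MeasurableSpace.comap_id]
  have := @lintegral_of_indepFun Ω S Ω mΩ μ _ mS 𝒢 s id hid (hs.mono hℱ le_rfl)
    (measurable_id'' h𝒢) φ hφ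
  simp only [id] at this
  rw [this]
  exact lintegral_mono fun ω => hψ _

end Freezing

/-! ### Second moments as extended nonnegative integrals -/

section SecondMoment

variable {Ω H : Type*} [MeasurableSpace Ω] {μ : Measure Ω} [NormedAddCommGroup H]

lemma ofReal_norm_sq (v : H) : ENNReal.ofReal (‖v‖ ^ 2) = ‖v‖ₑ ^ 2 := by
  rw [ENNReal.ofReal_pow (norm_nonneg _), ofReal_norm]

lemma lintegral_enorm_sq_eq {h : Ω → H} (hi : Integrable (fun ω => ‖h ω‖ ^ 2) μ) :
    ∫⁻ ω, ‖h ω‖ₑ ^ 2 ∂μ = ENNReal.ofReal (∫ ω, ‖h ω‖ ^ 2 ∂μ) := by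
  rw [ofReal_integral_eq_lintegral_ofReal hi (Filter.Eventually.of_forall fun ω => by positivity)]
  simp only [ofReal_norm_sq]

/-- Error bounds are first proved in extended form, which presupposes no integrability; this turns
them into integrability and a real bound. -/
lemma integrable_norm_sq_of_lintegral_le [MeasurableSpace H] [BorelSpace H]
    {h : Ω → H} (hm : Measurable h) {c : ℝ} (hc : 0 ≤ c)
    (hl : ∫⁻ ω, ‖h ω‖ₑ ^ 2 ∂μ ≤ ENNReal.ofReal c) :
    Integrable (fun ω => ‖h ω‖ ^ 2) μ ∧ ∫ ω, ‖h ω‖ ^ 2 ∂μ ≤ c := by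
  have hi : Integrable (fun ω => ‖h ω‖ ^ 2) μ := by
    refine ⟨(hm.norm.pow_const 2).aestronglyMeasurable, ?_⟩
    rw [hasFiniteIntegral_iff_ofReal (Filter.Eventually.of_forall fun ω => by positivity)]
    simp only [ofReal_norm_sq]
    exact hl.trans_lt ENNReal.ofReal_lt_top
  refine ⟨hi, ?_⟩
  rw [lintegral_enorm_sq_eq hi] at hl
  exact (ENNReal.ofReal_le_ofReal_iff hc).mp hl

end SecondMoment

/-! ### Measurability of the ingredients of an iteration -/

section Measurability

lemma measurable_comp_of_le {Z Y Q : Type*} {mZ : MeasurableSpace Z}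
    {mQ : MeasurableSpace Q} {𝒢 ℱ : MeasurableSpace Y} (hle : 𝒢 ≤ ℱ)
    {m : Z × Y → Q} (hm : Measurable[MeasurableSpace.prod mZ 𝒢] m) {z : Y → Z}
    (hz : Measurable[ℱ] z) : Measurable[ℱ] fun ω => m (z ω, ω) :=
  hm.comp (hz.prodMk (measurable_id'' hle))

variable {Z Y Q H : Type*} {mZ : MeasurableSpace Z} {mY : MeasurableSpace Y}
  [NormedAddCommGroup Q] [NormedSpace ℝ Q] [MeasurableSpace Q] [BorelSpace Q]
  [NormedAddCommGroup H] [NormedSpace ℝ H] [MeasurableSpace H]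
  [BorelSpace H] [SecondCountableTopology H]

lemma measurable_enorm_map_sub_sq (L : Q →L[ℝ] H) {m : Z × Y → Q} (hm : Measurable m) {w : Z → Q}
    (hw : Measurable w) : Measurable fun q : Z × Y => ‖L (m q) - L (w q.1)‖ₑ ^ 2 :=
  ((L.continuous.measurable.comp hm).sub
    (L.continuous.measurable.comp (hw.comp measurable_fst))).enorm.pow_const 2

lemma measurable_enorm_add_map_sub_sq [SecondCountableTopology Q] (L : Q →L[ℝ] H)
    {m : Z × Y → Q} (hm : Measurable m) {w : Z → Q} (hw : Measurable w) :
    Measurable fun q : (H × Z × Z) × Y =>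
      ‖q.1.1 + (L (m (q.1.2.1, q.2) - m (q.1.2.2, q.2)) - L (w q.1.2.1 - w q.1.2.2))‖ₑ ^ 2 := by
  have h1 : Measurable fun q : (H × Z × Z) × Y => m (q.1.2.1, q.2) := by fun_prop
  have h2 : Measurable fun q : (H × Z × Z) × Y => m (q.1.2.2, q.2) := by fun_prop
  have h3 : Measurable fun q : (H × Z × Z) × Y => w q.1.2.1 := by fun_prop
  have h4 : Measurable fun q : (H × Z × Z) × Y => w q.1.2.2 := by fun_prop
  have h5 : Measurable fun q : (H × Z × Z) × Y => q.1.1 := by fun_prop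
  exact (h5.add ((L.continuous.measurable.comp (h1.sub h2)).sub
    (L.continuous.measurable.comp (h3.sub h4)))).enorm.pow_const 2

lemma measurable_queryPoint {d p : ℕ} (par : Params) (t : ℕ) {s : Y → State d p}
    (hx : Measurable fun ω => (s ω).x) (hy : Measurable fun ω => (s ω).y) :
    Measurable fun ω => queryPoint par t (s ω) := by
  unfold queryPoint
  fun_prop

lemma measurable_adjoint_gradient {d p : ℕ} {f : Vec p → ℝ} (hf : Continuous (∇ f))
    {q : Y → Vec p × (Vec d →L[ℝ] Vec p)} (hq : Measurable q) :
    Measurable fun ω => ContinuousLinearMap.adjoint (q ω).2 (∇ f (q ω).1) := by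
  have h1 : Continuous fun q : Vec p × (Vec d →L[ℝ] Vec p) =>
      ContinuousLinearMap.adjoint (𝕜 := ℝ) (E := Vec d) (F := Vec p) q.2 :=
    (ContinuousLinearMap.adjoint (𝕜 := ℝ) (E := Vec d) (F := Vec p)).continuous.comp
      continuous_snd
  exact (h1.clm_apply (hf.comp continuous_fst)).measurable.comp hq

lemma measurable_prox_step {d : ℕ} {r : Vec d → ℝ} (hr : ConvexOn ℝ Set.univ r) {lam : ℝ}
    (hl : 0 < lam) {x v : Y → Vec d} (hx : Measurable x) (hv : Measurable v) :
    Measurable fun ω => prox r lam (x ω - lam • v ω) :=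
  (continuous_prox hr hl).measurable.comp (hx.sub (hv.const_smul lam))

end Measurability

/-! ### Abstract minibatches and the conditional error recursion -/

section Master

variable {Ω Ξ : Type*} {mΩ : MeasurableSpace Ω} {d p : ℕ}

/-- The value of `h` at `z` together with its Jacobian. -/
noncomputable def jet (h : Vec d → Vec p) (z : Vec d) : Vec p × (Vec d →L[ℝ] Vec p) :=
  (h z, fderiv ℝ h z)

/-- The current estimates of the inner mapping and of its Jacobian. -/
def State.est (s : State d p) : Vec p × (Vec d →L[ℝ] Vec p) := (s.gEst, s.jEst)

/-- The random minibatches `B t`, `t < T`: the batch of iteration `t` is `𝒢 t`-measurable and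
independent of the past `ℱ t`; a refreshed estimate has (scaled) mean square error at most `V`, and
a recursive update adds mean square error at most `G_0 / τ * ‖z - z'‖²`. -/
structure Sampling (μ : Measure Ω) (T τ : ℕ) (g : Ξ → Vec d → Vec p) (gbar : Vec d → Vec p)
    (lf Lf lg Lg : ℝ≥0) (V : ℝ) (B : ℕ → Ω → Multiset Ξ) (ℱ 𝒢 : ℕ → MeasurableSpace Ω) :
    Prop where
  past_le : ∀ t ≤ T, ℱ t ≤ mΩ
  past_mono : ∀ t < T, ℱ t ≤ ℱ (t + 1)
  batch_le : ∀ t < T, 𝒢 t ≤ ℱ (t + 1)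
  indep : ∀ t < T, Indep (ℱ t) (𝒢 t) μ
  meas : ∀ t < T, Measurable[MeasurableSpace.prod inferInstance (𝒢 t)] fun q : Vec d × Ω =>
    batchMean (B t q.2) fun k => jet (g k) q.1
  refresh : ∀ t < T, t % τ = 0 → ∀ z : Vec d,
    ∫⁻ ω, ‖errPairing lf Lf lg (batchMean (B t ω) fun k => jet (g k) z) -
      errPairing lf Lf lg (jet gbar z)‖ₑ ^ 2 ∂μ ≤ ENNReal.ofReal V
  update : ∀ t < T, t % τ ≠ 0 → ∀ (u : Pairs d p) (z z' : Vec d),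
    ∫⁻ ω, ‖u + (errPairing lf Lf lg ((batchMean (B t ω) fun k => jet (g k) z) -
        batchMean (B t ω) fun k => jet (g k) z') -
      errPairing lf Lf lg (jet gbar z - jet gbar z'))‖ₑ ^ 2 ∂μ ≤
    ‖u‖ₑ ^ 2 + ENNReal.ofReal (G0 lf Lf lg Lg / τ * ‖z - z'‖ ^ 2)

lemma InnerRegular.continuous_jet {gbar : Vec d → Vec p} {lg Lg : ℝ≥0}
    (h : InnerRegular gbar lg Lg) : Continuous (jet gbar) := by
  refine h.diff.continuous.prodMk ?_
  have : LipschitzWith Lg (fderiv ℝ gbar) := LipschitzWith.of_dist_le_mul fun x y => by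
    rw [dist_eq_norm, dist_eq_norm]; exact h.jac_lip x y
  exact this.continuous

variable {f : Vec p → ℝ} {g : Ξ → Vec d → Vec p} {gbar : Vec d → Vec p}
  {r : Vec d → ℝ} {lf Lf lg Lg : ℝ≥0} {T τ : ℕ} {β V : ℝ} {lam : ℕ → ℝ} {x₀ : Vec d}
  {B : ℕ → Ω → Multiset Ξ} {ℱ 𝒢 : ℕ → MeasurableSpace Ω} {μ : Measure Ω}

lemma run_est_succ (τ : ℕ) (β : ℝ) (lam : ℕ → ℝ) (x₀ : Vec d) (A : ℕ → Multiset Ξ) (t : ℕ) :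
    (run f g r (dimParams τ β lam) x₀ A (t + 1)).est =
      if t % τ = 0 then
        batchMean (A t) fun k => jet (g k) (zIter f g r (dimParams τ β lam) x₀ A t)
      else (run f g r (dimParams τ β lam) x₀ A t).est +
        ((batchMean (A t) fun k => jet (g k) (zIter f g r (dimParams τ β lam) x₀ A t)) -
          batchMean (A t) fun k => jet (g k) (run f g r (dimParams τ β lam) x₀ A t).zLast) := by
  have e : (run f g r (dimParams τ β lam) x₀ A (t + 1)).est =
    (newG g (dimParams τ β lam) (A t) t (run f g r (dimParams τ β lam) x₀ A t),
      newJ g (dimParams τ β lam) (A t) t (run f g r (dimParams τ β lam) x₀ A t)) := rfl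
  have hp : (dimParams τ β lam).τ = τ := rfl
  rw [e]
  unfold newG newJ jet
  rw [hp]
  split_ifs
  · rw [batchMean_prodMk]; rfl
  · rw [batchMean_sub, batchMean_sub, ← batchMean_prodMk, ← batchMean_prodMk]; rfl

lemma estErr_eq (par : Params) (A : ℕ → Multiset Ξ) (t : ℕ) :
    estErr lf Lf lg f g gbar r par x₀ A t =
      errPairing lf Lf lg (run f g r par x₀ A (t + 1)).est -
        errPairing lf Lf lg (jet gbar (zIter f g r par x₀ A t)) := rfl

namespace Sampling

lemma measurable_batchMean_comp (hs : Sampling μ T τ g gbar lf Lf lg Lg V B ℱ 𝒢) {t : ℕ}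
    (ht : t < T) {z : Ω → Vec d} (hz : Measurable[ℱ (t + 1)] z) :
    Measurable[ℱ (t + 1)] fun ω => batchMean (B t ω) fun k => jet (g k) (z ω) :=
  measurable_comp_of_le (hs.batch_le t ht) (hs.meas t ht) hz

/-- The state of the run depends measurably on the past minibatches. -/
lemma measurable_run (hs : Sampling μ T τ g gbar lf Lf lg Lg V B ℱ 𝒢)
    (hreg : Regular f g gbar r lf Lf lg Lg) (hβ : 0 < β) (h : AdmissibleLam T β lam) {t : ℕ}
    (ht : t ≤ T) :
    Measurable[ℱ t] (fun ω => (run f g r (dimParams τ β lam) x₀ (B · ω) t).x) ∧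
    Measurable[ℱ t] (fun ω => (run f g r (dimParams τ β lam) x₀ (B · ω) t).y) ∧
    Measurable[ℱ t] (fun ω => (run f g r (dimParams τ β lam) x₀ (B · ω) t).zLast) ∧
    Measurable[ℱ t] (fun ω => (run f g r (dimParams τ β lam) x₀ (B · ω) t).est) := by
  induction t with
  | zero => exact ⟨measurable_const, measurable_const, measurable_const,
      measurable_const (a := ((0, 0) : Vec p × (Vec d →L[ℝ] Vec p)))⟩
  | succ t ih =>
    have ht' : t < T := by omega
    obtain ⟨hx, hy, hz, he⟩ := ih (by omega)
    have hm := hs.past_mono t ht'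
    replace hx := hx.mono hm le_rfl
    replace hy := hy.mono hm le_rfl
    replace hz := hz.mono hm le_rfl
    replace he := he.mono hm le_rfl
    have hq : Measurable[ℱ (t + 1)] fun ω => zIter f g r (dimParams τ β lam) x₀ (B · ω) t :=
      measurable_queryPoint _ _ hx hy
    have he' : Measurable[ℱ (t + 1)] fun ω =>
        (run f g r (dimParams τ β lam) x₀ (B · ω) (t + 1)).est := by
      simp only [run_est_succ]
      by_cases h0 : t % τ = 0
      · simp only [h0, if_true]
        exact hs.measurable_batchMean_comp ht' hq
      · simp only [h0, if_false]
        exact he.add ((hs.measurable_batchMean_comp ht' hq).sub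
          (hs.measurable_batchMean_comp ht' hz))
    have hv := measurable_adjoint_gradient hreg.f_grad_lip.continuous he'
    dsimp only [State.est] at hv
    have hx' : Measurable[ℱ (t + 1)] fun ω =>
        (run f g r (dimParams τ β lam) x₀ (B · ω) (t + 1)).x := by
      exact measurable_prox_step hreg.r_convex (h.ratio_bounds hβ ht').1 hx hv
    have hy' : Measurable[ℱ (t + 1)] fun ω =>
        zIter f g r (dimParams τ β lam) x₀ (B · ω) t + (β / lam t) •
          ((run f g r (dimParams τ β lam) x₀ (B · ω) (t + 1)).x -
            (run f g r (dimParams τ β lam) x₀ (B · ω) t).x) :=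
      hq.add ((hx'.sub hx).const_smul (β / lam t))
    exact ⟨hx', hy', hq, he'⟩

lemma measurable_zIter (hs : Sampling μ T τ g gbar lf Lf lg Lg V B ℱ 𝒢)
    (hreg : Regular f g gbar r lf Lf lg Lg) (hβ : 0 < β) (h : AdmissibleLam T β lam) {t : ℕ}
    (ht : t ≤ T) :
    Measurable[ℱ t] fun ω => zIter f g r (dimParams τ β lam) x₀ (B · ω) t := by
  obtain ⟨hx, hy, -, -⟩ := hs.measurable_run (x₀ := x₀) hreg hβ h ht
  exact measurable_queryPoint _ _ hx hy

lemma measurable_estErr (hs : Sampling μ T τ g gbar lf Lf lg Lg V B ℱ 𝒢)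
    (hreg : Regular f g gbar r lf Lf lg Lg) (hin : InnerRegular gbar lg Lg) (hβ : 0 < β)
    (h : AdmissibleLam T β lam) {t : ℕ} (ht : t < T) :
    Measurable[ℱ (t + 1)] fun ω =>
      estErr lf Lf lg f g gbar r (dimParams τ β lam) x₀ (B · ω) t := by
  obtain ⟨-, -, hz, he⟩ := hs.measurable_run (x₀ := x₀) hreg hβ h (Nat.succ_le_of_lt ht)
  exact ((errPairing lf Lf lg).continuous.measurable.comp he).sub
    (((errPairing lf Lf lg).continuous.comp hin.continuous_jet).measurable.comp hz)

lemma measurable_accuracy (hs : Sampling μ T τ g gbar lf Lf lg Lg V B ℱ 𝒢)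
    (hreg : Regular f g gbar r lf Lf lg Lg) (hin : InnerRegular gbar lg Lg) (hβ : 0 < β)
    (h : AdmissibleLam T β lam) {t : ℕ} (ht : t < T) :
    Measurable[ℱ t] fun ω => accuracy f g gbar r (dimParams τ β lam) x₀ (B · ω) t := by
  have hz := hs.measurable_zIter (x₀ := x₀) hreg hβ h ht.le
  have hF : Continuous (∇ (smoothPart f gbar)) := by
    have : LipschitzWith ⟨_, LF_nonneg lf Lf lg Lg⟩ (∇ (smoothPart f gbar)) :=
      LipschitzWith.of_dist_le_mul fun x y => by
        rw [dist_eq_norm, dist_eq_norm]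
        exact norm_gradient_smoothPart_sub_le hreg.f_diff hreg.f_lip hreg.f_grad_lip hin x y
    exact this.continuous
  have hc : Continuous fun z => ‖gradMap (smoothPart f gbar) r (lam t) z‖ := by
    have hp := continuous_prox hreg.r_convex (h.ratio_bounds hβ ht).1
    unfold gradMap
    fun_prop
  exact hc.measurable.comp hz

lemma lintegral_estErr_refresh (hs : Sampling μ T τ g gbar lf Lf lg Lg V B ℱ 𝒢)
    [IsProbabilityMeasure μ]
    (hreg : Regular f g gbar r lf Lf lg Lg) (hin : InnerRegular gbar lg Lg) (hβ : 0 < β)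
    (h : AdmissibleLam T β lam) {t : ℕ} (ht : t < T) (hτ : t % τ = 0) :
    ∫⁻ ω, ‖estErr lf Lf lg f g gbar r (dimParams τ β lam) x₀ (B · ω) t‖ₑ ^ 2 ∂μ ≤
      ENNReal.ofReal V := by
  have hz := hs.measurable_zIter (x₀ := x₀) hreg hβ h ht.le
  have hφ := measurable_enorm_map_sub_sq (errPairing lf Lf lg) (hs.meas t ht)
    hin.continuous_jet.measurable
  have h1 := lintegral_le_of_indep (hs.past_le t ht.le)
    ((hs.batch_le t ht).trans (hs.past_le (t + 1) ht)) (hs.indep t ht) hz hφ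
    (ψ := fun _ => ENNReal.ofReal V) (hs.refresh t ht hτ)
  simp only [lintegral_const, measure_univ, mul_one] at h1
  simpa only [estErr_eq, run_est_succ, if_pos hτ] using h1

/-- The new error is the old one plus the deviation of the batch increment from its mean. The old
error and both query points are determined by the past, so they may be frozen before
`Sampling.update` is applied. -/
lemma lintegral_estErr_update (hs : Sampling μ T τ g gbar lf Lf lg Lg V B ℱ 𝒢)
    [IsProbabilityMeasure μ]
    (hreg : Regular f g gbar r lf Lf lg Lg) (hin : InnerRegular gbar lg Lg) (hβ : 0 < β)
    (h : AdmissibleLam T β lam) {t : ℕ} (ht : t + 1 < T) (hτ : (t + 1) % τ ≠ 0) :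
    ∫⁻ ω, ‖estErr lf Lf lg f g gbar r (dimParams τ β lam) x₀ (B · ω) (t + 1)‖ₑ ^ 2 ∂μ ≤
      ∫⁻ ω, (‖estErr lf Lf lg f g gbar r (dimParams τ β lam) x₀ (B · ω) t‖ₑ ^ 2 +
        ENNReal.ofReal (G0 lf Lf lg Lg / τ *
          ‖zIter f g r (dimParams τ β lam) x₀ (B · ω) (t + 1) -
            zIter f g r (dimParams τ β lam) x₀ (B · ω) t‖ ^ 2)) ∂μ := by
  have hz := hs.measurable_zIter (x₀ := x₀) hreg hβ h ht.le
  have hz' := (hs.measurable_zIter (x₀ := x₀) hreg hβ h (show t ≤ T by omega)).mono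
    (hs.past_mono t (by omega)) le_rfl
  have hu := hs.measurable_estErr (x₀ := x₀) hreg hin hβ h (show t < T by omega)
  have hφ := measurable_enorm_add_map_sub_sq (errPairing lf Lf lg) (hs.meas (t + 1) ht)
    hin.continuous_jet.measurable
  have h1 := lintegral_le_of_indep (hs.past_le (t + 1) ht.le)
    ((hs.batch_le (t + 1) ht).trans (hs.past_le (t + 2) ht)) (hs.indep (t + 1) ht)
    (hu.prodMk (hz.prodMk hz')) hφ
    (ψ := fun q => ‖q.1‖ₑ ^ 2 + ENNReal.ofReal (G0 lf Lf lg Lg / τ * ‖q.2.1 - q.2.2‖ ^ 2))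
    fun q => hs.update (t + 1) ht hτ q.1 q.2.1 q.2.2
  refine le_trans (le_of_eq (lintegral_congr fun ω => ?_)) h1
  have hl : (run f g r (dimParams τ β lam) x₀ (B · ω) (t + 1)).zLast =
    zIter f g r (dimParams τ β lam) x₀ (B · ω) t := rfl
  simp only [estErr_eq, run_est_succ _ _ _ _ _ (t + 1), if_neg hτ, hl, map_add,
    map_sub _ (jet gbar _)]
  congr 2
  abel

end Sampling

end Master

/-! ### Elimination of errors and displacements -/

section Combination

/-- Elimination of the estimation errors `u` and of the query displacements `w` from the expected
path inequalities; `e` are the expected squared step lengths and `q` the ratios `β / λ`. -/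
lemma sum_le_of_path_inequalities {T : ℕ} {q e w u : ℕ → ℝ} {lf Lf lg Lg : ℝ≥0} {β Δ V : ℝ}
    (hβ : AdmissibleBeta lf Lf lg Lg β) (hV : 0 ≤ V)
    (hΔ0 : 0 ≤ Δ) (he : ∀ t, 0 ≤ e t) (hq : ∀ t < T, 1 / 3 ≤ q t) (hq1 : ∀ t < T, q t ≤ 1)
    (h1 : ∑ t ∈ Finset.range T,
      (q t - 1 / 6 - β * LF lf Lf lg Lg * (3 / 2 + 2 * q t)) * e t ≤
        β * Δ + 3 / 2 * β ^ 2 * ∑ t ∈ Finset.range T, u t)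
    (h2 : ∑ t ∈ Finset.range T, w t ≤
      ∑ t ∈ Finset.range T, (2 * q t ^ 2 + 32 / 9 * q t) * e t)
    (h3 : ∑ t ∈ Finset.range T, u t ≤ G0 lf Lf lg Lg * ∑ t ∈ Finset.range T, w t + T * V) :
    51 / β ^ 2 * ∑ t ∈ Finset.range T, e t + 3 * ∑ t ∈ Finset.range T, u t ≤
      4000 * (Δ / β + T * V) := by
  obtain ⟨hL, hG, hLG⟩ := hβ.bounds
  have hβ0 := hβ.1
  set L := LF lf Lf lg Lg
  set G := G0 lf Lf lg Lg
  have hG0 : 0 ≤ G := G0_nonneg lf Lf lg Lg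
  have hTV : 0 ≤ (T : ℝ) * V := by positivity
  set E := ∑ t ∈ Finset.range T, e t with hE
  set K := ∑ t ∈ Finset.range T, (2 * q t ^ 2 + 32 / 9 * q t) * e t with hK
  set U := ∑ t ∈ Finset.range T, u t
  have hE0 : 0 ≤ E := Finset.sum_nonneg fun t _ => he t
  have h4 : U ≤ G * K + T * V := h3.trans (by gcongr)
  -- The part of the estimation error caused by query displacements is charged to the steps here,
  -- where the bound on β is used.
  have h5 : 1 / 40 * E ≤ ∑ t ∈ Finset.range T,
      (q t - 1 / 6 - β * L * (3 / 2 + 2 * q t)) * e t - 3 / 2 * (β ^ 2 * G) * K := by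
    rw [hE, hK, Finset.mul_sum, Finset.mul_sum, ← Finset.sum_sub_distrib]
    refine Finset.sum_le_sum fun t ht => ?_
    rw [Finset.mem_range] at ht
    have := mul_le_mul_of_nonneg_right
      (net_decrease_coefficient hL hG hLG (hq t ht) (hq1 t ht)) (he t)
    linarith
  have h6 : 3 / 2 * β ^ 2 * U ≤ 3 / 2 * (β ^ 2 * G) * K + 3 / 2 * β ^ 2 * (T * V) := by
    have := mul_le_mul_of_nonneg_left h4 (show 0 ≤ 3 / 2 * β ^ 2 by positivity)
    linarith
  have h7 : E ≤ 40 * (β * Δ + 3 / 2 * β ^ 2 * (T * V)) := by linarith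
  have h8 : K ≤ 50 / 9 * E := by
    rw [hE, hK, Finset.mul_sum]
    refine Finset.sum_le_sum fun t ht => mul_le_mul_of_nonneg_right ?_ (he t)
    rw [Finset.mem_range] at ht
    have := hq t ht
    have := hq1 t ht
    nlinarith
  have h9 : β ^ 2 * U ≤ 1 / 24 * (50 / 9 * E) + β ^ 2 * (T * V) := by
    have h10 := mul_le_mul_of_nonneg_left h4 (sq_nonneg β)
    have h11 : β ^ 2 * G * K ≤ β ^ 2 * G * (50 / 9 * E) := by gcongr
    have h12 : β ^ 2 * G * (50 / 9 * E) ≤ 1 / 24 * (50 / 9 * E) := by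
      gcongr; linarith
    linarith
  have hΔ : β ^ 2 * (Δ / β) = β * Δ := by field_simp
  have h10 : 0 ≤ β * Δ := by positivity
  have h11 : 0 ≤ β ^ 2 * (T * V) := by positivity
  -- Substituting the bounds on E and U gives coefficients of about 2068 for β Δ and 3105 for β² T
  -- V.
  have hfin : β ^ 2 * (51 / β ^ 2 * E + 3 * U) ≤ β ^ 2 * (4000 * (Δ / β + T * V)) := by
    have e1 : β ^ 2 * (51 / β ^ 2 * E + 3 * U) = 51 * E + 3 * (β ^ 2 * U) := by field_simp
    have e2 : β ^ 2 * (4000 * (Δ / β + T * V)) = 4000 * (β * Δ) + 4000 * (β ^ 2 * (T * V)) := by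
      rw [← hΔ]; ring
    rw [e1, e2]
    linarith
  exact le_of_mul_le_mul_left hfin (by positivity)

end Combination

/-! ### Integrability and the expected path inequalities -/

section Master

variable {Ω Ξ : Type*} {mΩ : MeasurableSpace Ω} {d p : ℕ}
  {f : Vec p → ℝ} {g : Ξ → Vec d → Vec p} {gbar : Vec d → Vec p}
  {r : Vec d → ℝ} {lf Lf lg Lg : ℝ≥0} {T τ : ℕ} {β V : ℝ} {lam : ℕ → ℝ} {x₀ : Vec d}
  {B : ℕ → Ω → Multiset Ξ} {ℱ 𝒢 : ℕ → MeasurableSpace Ω} {μ : Measure Ω}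

lemma integrable_norm_sub_sq_of_bound [IsFiniteMeasure μ] {a b : Ω → Vec d} (ha : Measurable a)
    (hb : Measurable b) {M N : ℝ} (haM : ∀ ω, ‖a ω‖ ≤ M) (hbN : ∀ ω, ‖b ω‖ ≤ N) :
    Integrable (fun ω => ‖a ω - b ω‖ ^ 2) μ := by
  refine Integrable.of_bound ((ha.sub hb).norm.pow_const 2).aestronglyMeasurable ((M + N) ^ 2)
    (Filter.Eventually.of_forall fun ω => ?_)
  rw [Real.norm_eq_abs, abs_of_nonneg (by positivity)]
  have := norm_sub_le (a ω) (b ω)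
  have := haM ω
  have := hbN ω
  gcongr
  linarith

namespace Sampling

lemma integrable_step_sq [IsProbabilityMeasure μ]
    (hs : Sampling μ T τ g gbar lf Lf lg Lg V B ℱ 𝒢) (hreg : Regular f g gbar r lf Lf lg Lg)
    (hβ : 0 < β) (h : AdmissibleLam T β lam) {t : ℕ} (ht : t < T) :
    Integrable (fun ω => ‖(run f g r (dimParams τ β lam) x₀ (B · ω) (t + 1)).x -
      (run f g r (dimParams τ β lam) x₀ (B · ω) t).x‖ ^ 2) μ := by
  obtain ⟨M, hM⟩ := exists_run_bound (τ := τ) (x₀ := x₀) hreg hβ h (t := t + 1) ht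
  obtain ⟨N, hN⟩ := exists_run_bound (τ := τ) (x₀ := x₀) hreg hβ h (t := t) ht.le
  have h1 := (hs.measurable_run (x₀ := x₀) hreg hβ h (t := t + 1) ht).1.mono
    (hs.past_le _ ht) le_rfl
  have h2 := (hs.measurable_run (x₀ := x₀) hreg hβ h (t := t) ht.le).1.mono
    (hs.past_le _ ht.le) le_rfl
  exact integrable_norm_sub_sq_of_bound h1 h2 (fun ω => (hM _).1) fun ω => (hN _).1

lemma integrable_query_sq [IsProbabilityMeasure μ]
    (hs : Sampling μ T τ g gbar lf Lf lg Lg V B ℱ 𝒢) (hreg : Regular f g gbar r lf Lf lg Lg)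
    (hβ : 0 < β) (h : AdmissibleLam T β lam) {t : ℕ} (ht : t < T) :
    Integrable (fun ω => ‖zIter f g r (dimParams τ β lam) x₀ (B · ω) (t + 1) -
      zIter f g r (dimParams τ β lam) x₀ (B · ω) t‖ ^ 2) μ := by
  obtain ⟨M, hM⟩ := exists_run_bound (τ := τ) (x₀ := x₀) hreg hβ h (t := t + 1) ht
  obtain ⟨N, hN⟩ := exists_run_bound (τ := τ) (x₀ := x₀) hreg hβ h (t := t) ht.le
  have h1 := (hs.measurable_zIter (x₀ := x₀) hreg hβ h (t := t + 1) ht).mono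
    (hs.past_le _ ht) le_rfl
  have h2 := (hs.measurable_zIter (x₀ := x₀) hreg hβ h (t := t) ht.le).mono
    (hs.past_le _ ht.le) le_rfl
  exact integrable_norm_sub_sq_of_bound h1 h2
    (fun ω => (norm_queryPoint_le τ β lam _ _).trans (add_le_add (hM _).2.1 (hM _).1))
    fun ω => (norm_queryPoint_le τ β lam _ _).trans (add_le_add (hN _).2.1 (hN _).1)

lemma integral_estErr_refresh [IsProbabilityMeasure μ]
    (hs : Sampling μ T τ g gbar lf Lf lg Lg V B ℱ 𝒢) (hreg : Regular f g gbar r lf Lf lg Lg)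
    (hin : InnerRegular gbar lg Lg) (hβ : 0 < β) (hV : 0 ≤ V) (h : AdmissibleLam T β lam) {t : ℕ}
    (ht : t < T) (hτ : t % τ = 0) :
    Integrable (fun ω => ‖estErr lf Lf lg f g gbar r (dimParams τ β lam) x₀ (B · ω) t‖ ^ 2) μ ∧
      ∫ ω, ‖estErr lf Lf lg f g gbar r (dimParams τ β lam) x₀ (B · ω) t‖ ^ 2 ∂μ ≤ V :=
  integrable_norm_sq_of_lintegral_le
    ((hs.measurable_estErr hreg hin hβ h ht).mono (hs.past_le _ ht) le_rfl) hV
    (hs.lintegral_estErr_refresh hreg hin hβ h ht hτ)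

lemma integral_estErr_update [IsProbabilityMeasure μ]
    (hs : Sampling μ T τ g gbar lf Lf lg Lg V B ℱ 𝒢) (hreg : Regular f g gbar r lf Lf lg Lg)
    (hin : InnerRegular gbar lg Lg) (hβ : 0 < β) (h : AdmissibleLam T β lam) {t : ℕ}
    (ht : t + 1 < T) (hτ : (t + 1) % τ ≠ 0)
    (hi : Integrable
      (fun ω => ‖estErr lf Lf lg f g gbar r (dimParams τ β lam) x₀ (B · ω) t‖ ^ 2) μ) :
    Integrable
      (fun ω => ‖estErr lf Lf lg f g gbar r (dimParams τ β lam) x₀ (B · ω) (t + 1)‖ ^ 2) μ ∧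
      ∫ ω, ‖estErr lf Lf lg f g gbar r (dimParams τ β lam) x₀ (B · ω) (t + 1)‖ ^ 2 ∂μ ≤
        ∫ ω, ‖estErr lf Lf lg f g gbar r (dimParams τ β lam) x₀ (B · ω) t‖ ^ 2 ∂μ +
        G0 lf Lf lg Lg / τ * ∫ ω, ‖zIter f g r (dimParams τ β lam) x₀ (B · ω) (t + 1) -
          zIter f g r (dimParams τ β lam) x₀ (B · ω) t‖ ^ 2 ∂μ := by
  have hG := G0_nonneg lf Lf lg Lg
  have hm := (hs.measurable_estErr (x₀ := x₀) hreg hin hβ h (show t < T by omega)).mono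
    (hs.past_le _ (show t + 1 ≤ T by omega)) le_rfl
  have hm' := (hs.measurable_estErr (x₀ := x₀) hreg hin hβ h ht).mono
    (hs.past_le _ (show t + 1 + 1 ≤ T by omega)) le_rfl
  have hw := hs.integrable_query_sq (x₀ := x₀) hreg hβ h (show t < T by omega)
  have hl := hs.lintegral_estErr_update (x₀ := x₀) hreg hin hβ h ht hτ
  have hw0 : 0 ≤ ∫ ω, ‖zIter f g r (dimParams τ β lam) x₀ (B · ω) (t + 1) -
      zIter f g r (dimParams τ β lam) x₀ (B · ω) t‖ ^ 2 ∂μ :=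
    integral_nonneg fun ω => by positivity
  have hu0 : 0 ≤ ∫ ω, ‖estErr lf Lf lg f g gbar r (dimParams τ β lam) x₀ (B · ω) t‖ ^ 2 ∂μ :=
    integral_nonneg fun ω => by positivity
  refine integrable_norm_sq_of_lintegral_le hm' (by positivity) (hl.trans (le_of_eq ?_))
  rw [lintegral_add_left (hm.enorm.pow_const 2), lintegral_enorm_sq_eq hi,
    ENNReal.ofReal_add hu0 (by positivity), ← integral_const_mul,
    ofReal_integral_eq_lintegral_ofReal (hw.const_mul _)
      (Filter.Eventually.of_forall fun ω => by positivity)]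

lemma integrable_estErr_sq [IsProbabilityMeasure μ]
    (hs : Sampling μ T τ g gbar lf Lf lg Lg V B ℱ 𝒢) (hreg : Regular f g gbar r lf Lf lg Lg)
    (hin : InnerRegular gbar lg Lg) (hβ : 0 < β) (hV : 0 ≤ V) (h : AdmissibleLam T β lam) {t : ℕ}
    (ht : t < T) :
    Integrable
      (fun ω => ‖estErr lf Lf lg f g gbar r (dimParams τ β lam) x₀ (B · ω) t‖ ^ 2) μ := by
  induction t with
  | zero => exact (hs.integral_estErr_refresh hreg hin hβ hV h ht (Nat.zero_mod τ)).1
  | succ t ih =>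
    by_cases hm : (t + 1) % τ = 0
    · exact (hs.integral_estErr_refresh hreg hin hβ hV h ht hm).1
    · exact (hs.integral_estErr_update hreg hin hβ h ht hm (ih (by omega))).1

/-- The expected accuracy of the query points. -/
theorem sum_integral_accuracy_sq_le [IsProbabilityMeasure μ]
    (hs : Sampling μ T τ g gbar lf Lf lg Lg V B ℱ 𝒢) (hreg : Regular f g gbar r lf Lf lg Lg)
    (hin : InnerRegular gbar lg Lg) (hβ : AdmissibleBeta lf Lf lg Lg β) (hV : 0 ≤ V)
    (hτ : 0 < τ) (h : AdmissibleLam T β lam) :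
    (∀ t < T, Integrable
      (fun ω => accuracy f g gbar r (dimParams τ β lam) x₀ (B · ω) t ^ 2) μ) ∧
    ∑ t ∈ Finset.range T, ∫ ω, accuracy f g gbar r (dimParams τ β lam) x₀ (B · ω) t ^ 2 ∂μ ≤
      4000 * (gap f gbar r x₀ / β + T * V) := by
  have hβ0 := hβ.1
  have hie := fun t (ht : t ∈ Finset.range T) =>
    hs.integrable_step_sq (x₀ := x₀) hreg hβ0 h (Finset.mem_range.mp ht)
  have hiw := fun t (ht : t ∈ Finset.range T) =>
    hs.integrable_query_sq (x₀ := x₀) hreg hβ0 h (Finset.mem_range.mp ht)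
  have hiu := fun t (ht : t ∈ Finset.range T) =>
    hs.integrable_estErr_sq (x₀ := x₀) hreg hin hβ0 hV h (Finset.mem_range.mp ht)
  have hia' : Integrable (fun ω =>
      51 / β ^ 2 * ∑ t ∈ Finset.range T, ‖(run f g r (dimParams τ β lam) x₀ (B · ω) (t + 1)).x -
        (run f g r (dimParams τ β lam) x₀ (B · ω) t).x‖ ^ 2 +
      3 * ∑ t ∈ Finset.range T,
        ‖estErr lf Lf lg f g gbar r (dimParams τ β lam) x₀ (B · ω) t‖ ^ 2) μ :=
    ((integrable_finsetSum _ hie).const_mul _).add ((integrable_finsetSum _ hiu).const_mul _)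
  have hia : ∀ t < T, Integrable
      (fun ω => accuracy f g gbar r (dimParams τ β lam) x₀ (B · ω) t ^ 2) μ := by
    intro t ht
    have hm := (hs.measurable_accuracy (x₀ := x₀) hreg hin hβ0 h ht).mono
      (hs.past_le _ ht.le) le_rfl
    refine hia'.mono' (hm.pow_const 2).aestronglyMeasurable
      (Filter.Eventually.of_forall fun ω => ?_)
    rw [Real.norm_eq_abs, abs_of_nonneg (sq_nonneg _)]
    -- A single squared accuracy is dominated by the integrable right-hand side of the path
    -- inequality for the whole sum.
    refine le_trans ?_ (run_sum_accuracy_sq_le hreg hin hβ0 h fun s => B s ω)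
    exact Finset.single_le_sum
      (f := fun t => accuracy f g gbar r (dimParams τ β lam) x₀ (B · ω) t ^ 2)
      (fun s _ => sq_nonneg _) (Finset.mem_range.mpr ht)
  refine ⟨hia, ?_⟩
  have h1 := integral_mono
    (integrable_finsetSum _ fun t ht => (hie t ht).const_mul
      (β / lam t - 1 / 6 - β * LF lf Lf lg Lg * (3 / 2 + 2 * (β / lam t))))
    ((integrable_const _).add ((integrable_finsetSum _ hiu).const_mul _))
    fun ω => run_sum_net_decrease_le hreg hin hβ0 h fun s => B s ω
  have h2 := integral_mono (integrable_finsetSum _ hiw)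
    (integrable_finsetSum _ fun t ht => (hie t ht).const_mul _)
    fun ω => run_sum_query_diff_le hβ0 h fun s => B s ω
  have h3 := integral_mono
    (integrable_finsetSum _ fun t ht => hia t (Finset.mem_range.mp ht)) hia'
    fun ω => run_sum_accuracy_sq_le hreg hin hβ0 h fun s => B s ω
  have h4 := sum_epoch_error_le hτ (G0_nonneg lf Lf lg Lg)
    (U := fun t => ∫ ω, ‖estErr lf Lf lg f g gbar r (dimParams τ β lam) x₀ (B · ω) t‖ ^ 2 ∂μ)
    (W := fun t => ∫ ω, ‖zIter f g r (dimParams τ β lam) x₀ (B · ω) (t + 1) -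
          zIter f g r (dimParams τ β lam) x₀ (B · ω) t‖ ^ 2 ∂μ)
    (fun t => integral_nonneg fun ω => by positivity)
    (fun t ht hm => (hs.integral_estErr_refresh hreg hin hβ0 hV h ht hm).2)
    (fun t ht hm => (hs.integral_estErr_update hreg hin hβ0 h ht hm
      (hs.integrable_estErr_sq hreg hin hβ0 hV h (by omega))).2)
  rw [integral_finsetSum _ fun t ht => hia t (Finset.mem_range.mp ht),
    integral_add ((integrable_finsetSum _ hie).const_mul _)
      ((integrable_finsetSum _ hiu).const_mul _), integral_const_mul, integral_const_mul,
    integral_finsetSum _ hie, integral_finsetSum _ hiu] at h3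
  rw [integral_finsetSum _ hiw,
    integral_finsetSum _ fun t ht => (hie t ht).const_mul _] at h2
  rw [integral_finsetSum _ fun t ht => (hie t ht).const_mul _,
    integral_add' (integrable_const _) ((integrable_finsetSum _ hiu).const_mul _),
    integral_const, integral_const_mul, integral_finsetSum _ hiu] at h1
  simp only [integral_const_mul, probReal_univ, one_smul] at h1 h2
  exact h3.trans (sum_le_of_path_inequalities hβ hV (gap_nonneg hreg x₀)
    (fun t => integral_nonneg fun ω => by positivity) (fun t ht => h.one_third_le hβ0 ht)
    (fun t ht => (h.ratio_bounds hβ0 ht).2.2.2) h1 h2 h4)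

end Sampling

end Master

/-! ### Centered random vectors in a Hilbert space -/

section Centered

variable {Ω H : Type*} {mΩ : MeasurableSpace Ω} {μ : Measure Ω} [NormedAddCommGroup H]

lemma integrable_of_integrable_norm_sq [IsFiniteMeasure μ] {Y : Ω → H}
    (hm : AEStronglyMeasurable Y μ) (hi : Integrable (fun ω => ‖Y ω‖ ^ 2) μ) : Integrable Y μ :=
  ((memLp_two_iff_integrable_sq_norm hm).mpr hi).integrable one_le_two

variable [InnerProductSpace ℝ H] [CompleteSpace H]

/-- The cross term is the inner product of u with the mean of Y, which is zero. -/
lemma integral_norm_add_sq_of_centered [IsProbabilityMeasure μ] {Y : Ω → H}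
    (hm : AEStronglyMeasurable Y μ) (hi : Integrable (fun ω => ‖Y ω‖ ^ 2) μ)
    (h0 : ∫ ω, Y ω ∂μ = 0) (u : H) :
    Integrable (fun ω => ‖u + Y ω‖ ^ 2) μ ∧
      ∫ ω, ‖u + Y ω‖ ^ 2 ∂μ = ‖u‖ ^ 2 + ∫ ω, ‖Y ω‖ ^ 2 ∂μ := by
  have hY := integrable_of_integrable_norm_sq hm hi
  have hin : Integrable (fun ω => (inner ℝ u (Y ω) : ℝ)) μ := hY.const_inner u
  have e : (fun ω => ‖u + Y ω‖ ^ 2) =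
      fun ω => ‖u‖ ^ 2 + 2 * inner ℝ u (Y ω) + ‖Y ω‖ ^ 2 := by
    funext ω; exact norm_add_sq_real u (Y ω)
  rw [e]
  have h1 : Integrable (fun ω => ‖u‖ ^ 2 + 2 * inner ℝ u (Y ω)) μ :=
    (integrable_const _).add (hin.const_mul 2)
  refine ⟨h1.add hi, ?_⟩
  rw [integral_add h1 hi, integral_add (integrable_const _) (hin.const_mul 2),
    integral_const_mul, integral_inner hY, h0, inner_zero_right]
  simp

lemma lintegral_enorm_add_sq_le [IsProbabilityMeasure μ] {Y : Ω → H}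
    (hm : AEStronglyMeasurable Y μ) (hi : Integrable (fun ω => ‖Y ω‖ ^ 2) μ)
    (h0 : ∫ ω, Y ω ∂μ = 0) {v : ℝ} (hv : ∫ ω, ‖Y ω‖ ^ 2 ∂μ ≤ v) (u : H) :
    ∫⁻ ω, ‖u + Y ω‖ₑ ^ 2 ∂μ ≤ ‖u‖ₑ ^ 2 + ENNReal.ofReal v := by
  obtain ⟨h1, h2⟩ := integral_norm_add_sq_of_centered hm hi h0 u
  have h3 : 0 ≤ ∫ ω, ‖Y ω‖ ^ 2 ∂μ := integral_nonneg fun ω => by positivity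
  rw [lintegral_enorm_sq_eq h1, h2, ENNReal.ofReal_add (by positivity) h3, ofReal_norm_sq]
  gcongr

/-- Centering at the mean does not increase the second moment. -/
lemma integral_norm_sub_mean_sq_le [IsProbabilityMeasure μ] {Y : Ω → H}
    (hm : AEStronglyMeasurable Y μ) (hi : Integrable (fun ω => ‖Y ω‖ ^ 2) μ) {m : H}
    (h0 : ∫ ω, Y ω ∂μ = m) :
    Integrable (fun ω => ‖Y ω - m‖ ^ 2) μ ∧
      ∫ ω, ‖Y ω - m‖ ^ 2 ∂μ ≤ ∫ ω, ‖Y ω‖ ^ 2 ∂μ := by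
  have hY := integrable_of_integrable_norm_sq hm hi
  have hin : Integrable (fun ω => (inner ℝ (Y ω) m : ℝ)) μ := hY.inner_const m
  have e : (fun ω => ‖Y ω - m‖ ^ 2) =
      fun ω => ‖Y ω‖ ^ 2 - 2 * inner ℝ (Y ω) m + ‖m‖ ^ 2 := by
    funext ω; exact norm_sub_sq_real (Y ω) m
  have e2 : ∫ ω, (inner ℝ (Y ω) m : ℝ) ∂μ = ‖m‖ ^ 2 := by
    simp_rw [real_inner_comm m]
    rw [integral_inner hY, h0, real_inner_self_eq_norm_sq]
  rw [e]
  have h1 : Integrable (fun ω => ‖Y ω‖ ^ 2 - 2 * inner ℝ (Y ω) m) μ := hi.sub (hin.const_mul 2)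
  refine ⟨h1.add (integrable_const _), ?_⟩
  rw [integral_add h1 (integrable_const _), integral_sub hi (hin.const_mul 2),
    integral_const_mul, e2]
  simp
  nlinarith [sq_nonneg ‖m‖]

/-- The second moment of a sum of centered, pairwise independent vectors. -/
lemma integral_norm_sum_sq_le [IsProbabilityMeasure μ] [MeasurableSpace H] [BorelSpace H]
    {b : ℕ} {Y : Fin b → Ω → H} (hm : ∀ i, AEStronglyMeasurable (Y i) μ)
    (hi : ∀ i, Integrable (fun ω => ‖Y i ω‖ ^ 2) μ) (h0 : ∀ i, ∫ ω, Y i ω ∂μ = 0)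
    (hind : ∀ i j, i ≠ j → IndepFun (Y i) (Y j) μ) {v : ℝ} (hv : ∀ i, ∫ ω, ‖Y i ω‖ ^ 2 ∂μ ≤ v) :
    Integrable (fun ω => ‖∑ i, Y i ω‖ ^ 2) μ ∧ ∫ ω, ‖∑ i, Y i ω‖ ^ 2 ∂μ ≤ b * v := by
  have hY := fun i => (memLp_two_iff_integrable_sq_norm (hm i)).mpr (hi i)
  have hint : ∀ i j, Integrable (fun ω => (inner ℝ (Y i ω) (Y j ω) : ℝ)) μ := fun i j =>
    ((hi i).add (hi j)).mono' ((hm i).inner (hm j)) (Filter.Eventually.of_forall fun ω => by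
      have h1 := norm_inner_le_norm (𝕜 := ℝ) (Y i ω) (Y j ω)
      simp only [Pi.add_apply]
      nlinarith [sq_nonneg (‖Y i ω‖ - ‖Y j ω‖), sq_nonneg (‖Y i ω‖ + ‖Y j ω‖)])
  have e : (fun ω => ‖∑ i, Y i ω‖ ^ 2) = fun ω => ∑ i, ∑ j, (inner ℝ (Y i ω) (Y j ω) : ℝ) := by
    funext ω
    rw [← real_inner_self_eq_norm_sq, sum_inner]
    simp_rw [inner_sum]
  rw [e]
  refine ⟨integrable_finsetSum _ fun i _ => integrable_finsetSum _ fun j _ => hint i j, ?_⟩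
  rw [integral_finsetSum _ fun i _ => integrable_finsetSum _ fun j _ => hint i j]
  -- In row i only the diagonal term survives: for j ≠ i independence turns the expected inner
  -- product into that of the means.
  have h1 : ∀ i ∈ Finset.univ, ∫ ω, ∑ j, (inner ℝ (Y i ω) (Y j ω) : ℝ) ∂μ ≤ v := by
    intro i _
    rw [integral_finsetSum _ fun j _ => hint i j, Finset.sum_eq_single i]
    · simp_rw [real_inner_self_eq_norm_sq]
      exact hv i
    · intro j _ hj
      have := (hind i j (Ne.symm hj)).integral_bilin ((hY i).integrable one_le_two)
        ((hY j).integrable one_le_two) (innerSL ℝ)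
      rw [h0 i, map_zero, zero_apply] at this
      exact this
    · simp
  refine (Finset.sum_le_sum h1).trans (le_of_eq ?_)
  simp

end Centered

/-! ### Counting for sampling without replacement -/

section Subsets

variable {n b : ℕ}

lemma sum_powersetCard_ite {M : Type*} [AddCommMonoid M] (s : Finset (Fin n)) (m : M)
    (hs : s.card ≤ b) :
    ∑ A ∈ (Finset.univ : Finset (Fin n)).powersetCard b, (if s ⊆ A then m else 0) =
      (n - s.card).choose (b - s.card) • m := by
  rw [← Finset.sum_filter, Finset.sum_const,
    Finset.card_filter_powersetCard_subset _ _ _ (Finset.subset_univ s) hs]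
  simp

lemma sum_powersetCard_sum {M : Type*} [AddCommMonoid M] (hb : 1 ≤ b) (c : Fin n → M) :
    ∑ A ∈ (Finset.univ : Finset (Fin n)).powersetCard b, ∑ i ∈ A, c i =
      (n - 1).choose (b - 1) • ∑ i, c i := by
  have e : ∀ A : Finset (Fin n), ∑ i ∈ A, c i = ∑ i, if {i} ⊆ A then c i else 0 := fun A => by
    simp [Finset.sum_ite_mem]
  rw [Finset.sum_congr rfl fun A _ => e A, Finset.sum_comm, Finset.smul_sum]
  exact Finset.sum_congr rfl fun i _ => sum_powersetCard_ite {i} _ (by simpa using hb)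

/-- Sampling without replacement: the second moment of the sum over a random subset. -/
lemma sum_powersetCard_norm_sum_sq_le {H : Type*} [NormedAddCommGroup H]
    [InnerProductSpace ℝ H] (hb : 1 ≤ b) (c : Fin n → H) (hc : ∑ i, c i = 0) :
    ∑ A ∈ (Finset.univ : Finset (Fin n)).powersetCard b, ‖∑ i ∈ A, c i‖ ^ 2 ≤
      ((n - 1).choose (b - 1) : ℝ) * ∑ i, ‖c i‖ ^ 2 := by
  have e : ∀ A : Finset (Fin n), ‖∑ i ∈ A, c i‖ ^ 2 =
      ∑ i, ∑ j, if {i, j} ⊆ A then (inner ℝ (c i) (c j) : ℝ) else 0 := fun A => by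
    rw [← real_inner_self_eq_norm_sq, sum_inner]
    simp_rw [inner_sum]
    rw [← Finset.sum_subset (Finset.subset_univ A) fun i _ hi => Finset.sum_eq_zero fun j _ =>
      if_neg fun hsub => hi (hsub (Finset.mem_insert_self i _))]
    refine Finset.sum_congr rfl fun i hi => ?_
    rw [← Finset.sum_subset (Finset.subset_univ A) fun j _ hj =>
      if_neg fun hsub => hj (hsub (by simp))]
    refine Finset.sum_congr rfl fun j hj => (if_pos ?_).symm
    simp [Finset.insert_subset_iff, hi, hj]
  -- M counts the b-subsets that contain two given points. For b = 1 there are none; truncated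
  -- subtraction would give the binomial coefficient 1, so this case is separate.
  obtain ⟨M, hM0, hM⟩ : ∃ M : ℝ, 0 ≤ M ∧ ∀ i j, i ≠ j →
      ∑ A ∈ (Finset.univ : Finset (Fin n)).powersetCard b,
        (if {i, j} ⊆ A then (inner ℝ (c i) (c j) : ℝ) else 0) = M * inner ℝ (c i) (c j) := by
    by_cases hb2 : 2 ≤ b
    · refine ⟨((n - 2).choose (b - 2) : ℝ), Nat.cast_nonneg _, fun i j hij => ?_⟩
      have hcard : ({i, j} : Finset (Fin n)).card = 2 := Finset.card_pair hij
      rw [sum_powersetCard_ite _ _ (by omega), hcard, nsmul_eq_mul]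
    · refine ⟨0, le_rfl, fun i j hij => ?_⟩
      rw [zero_mul]
      refine Finset.sum_eq_zero fun A hA => if_neg fun hsub => ?_
      have h1 := Finset.card_le_card hsub
      rw [Finset.card_pair hij, (Finset.mem_powersetCard.mp hA).2] at h1
      omega
  simp_rw [e]
  rw [Finset.sum_comm]
  -- As the c j sum to zero, the off-diagonal terms of row i add up to -M ‖c i‖². They only help:
  -- drawing without replacement is no worse than independent drawing.
  have h1 : ∀ i ∈ (Finset.univ : Finset (Fin n)),
      ∑ A ∈ (Finset.univ : Finset (Fin n)).powersetCard b,
        ∑ j, (if {i, j} ⊆ A then (inner ℝ (c i) (c j) : ℝ) else 0) =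
      ((n - 1).choose (b - 1) : ℝ) * ‖c i‖ ^ 2 - M * ‖c i‖ ^ 2 := by
    intro i _
    rw [Finset.sum_comm, ← Finset.add_sum_erase _ _ (Finset.mem_univ i)]
    have h2 : ∑ j ∈ Finset.univ.erase i,
        ∑ A ∈ (Finset.univ : Finset (Fin n)).powersetCard b,
          (if {i, j} ⊆ A then (inner ℝ (c i) (c j) : ℝ) else 0) =
        M * inner ℝ (c i) (∑ j ∈ Finset.univ.erase i, c j) := by
      rw [inner_sum, Finset.mul_sum]
      exact Finset.sum_congr rfl fun j hj => hM i j (Finset.ne_of_mem_erase hj).symm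
    have h3 : ∑ j ∈ Finset.univ.erase i, c j = -c i := by
      rw [eq_neg_iff_add_eq_zero, add_comm, Finset.add_sum_erase _ _ (Finset.mem_univ i), hc]
    have h4 := sum_powersetCard_ite (b := b) ({i} : Finset (Fin n)) (inner ℝ (c i) (c i) : ℝ)
      (by simpa using hb)
    rw [Finset.card_singleton, nsmul_eq_mul] at h4
    rw [h2, h3, Finset.pair_eq_singleton, h4, inner_neg_right, real_inner_self_eq_norm_sq]
    ring
  rw [Finset.sum_congr rfl h1, Finset.sum_sub_distrib, ← Finset.mul_sum, ← Finset.mul_sum]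
  have h2 : 0 ≤ M * ∑ i, ‖c i‖ ^ 2 :=
    mul_nonneg hM0 (Finset.sum_nonneg fun _ _ => by positivity)
  linarith

end Subsets

/-! ### Past and present σ-algebras of independent sources -/

section LevelAlgebras

variable {Ω ι : Type*} {mΩ : MeasurableSpace Ω} {μ : Measure Ω} {m : ι → MeasurableSpace Ω}

/-- The information of all sources of level below `t`. -/
@[reducible]
def pastAlgebra (m : ι → MeasurableSpace Ω) (ℓ : ι → ℕ) (t : ℕ) : MeasurableSpace Ω :=
  ⨆ i ∈ {i | ℓ i < t}, m i

/-- The information of all sources of level `t`. -/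
@[reducible]
def levelAlgebra (m : ι → MeasurableSpace Ω) (ℓ : ι → ℕ) (t : ℕ) : MeasurableSpace Ω :=
  ⨆ i ∈ {i | ℓ i = t}, m i

lemma pastAlgebra_le (hm : ∀ i, m i ≤ mΩ) (ℓ : ι → ℕ) (t : ℕ) : pastAlgebra m ℓ t ≤ mΩ :=
  iSup₂_le fun i _ => hm i

lemma pastAlgebra_mono (ℓ : ι → ℕ) (t : ℕ) : pastAlgebra m ℓ t ≤ pastAlgebra m ℓ (t + 1) :=
  biSup_mono fun _ hi => Nat.lt_succ_of_lt hi

lemma levelAlgebra_le (ℓ : ι → ℕ) (t : ℕ) : levelAlgebra m ℓ t ≤ pastAlgebra m ℓ (t + 1) :=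
  biSup_mono fun _ hi => Nat.lt_succ_of_le (le_of_eq hi)

lemma le_levelAlgebra (ℓ : ι → ℕ) (i : ι) : m i ≤ levelAlgebra m ℓ (ℓ i) :=
  le_iSup₂_of_le i rfl le_rfl

lemma indep_pastAlgebra (hm : ∀ i, m i ≤ mΩ) (h : iIndep m μ) (ℓ : ι → ℕ) (t : ℕ) :
    Indep (pastAlgebra m ℓ t) (levelAlgebra m ℓ t) μ := by
  refine indep_iSup_of_disjoint hm h ?_
  rw [Set.disjoint_left]
  intro i hi hi'
  simp only [Set.mem_ofPred_eq] at hi hi'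
  omega

end LevelAlgebras

/-! ### The averaged mapping of the finite-sum problem -/

section FiniteSum

variable {d p n : ℕ}

lemma Regular.innerRegular {Ξ : Type*} {f : Vec p → ℝ} {g : Ξ → Vec d → Vec p}
    {gbar : Vec d → Vec p} {r : Vec d → ℝ} {lf Lf lg Lg : ℝ≥0}
    (h : Regular f g gbar r lf Lf lg Lg) (k : Ξ) : InnerRegular (g k) lg Lg where
  diff := h.g_diff k
  lip := h.g_lip k
  jac_lip x y := (norm_le_frob _).trans (h.g_jac_lip k x y)

lemma batchMean_univ {V : Type*} [AddCommGroup V] [Module ℝ V] (h : Fin n → V) :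
    batchMean (Finset.univ : Finset (Fin n)).val h = (1 / (n : ℝ)) • ∑ i, h i := by
  simp [batchMean, Finset.sum]

lemma finiteMean_eq (g : Fin n → Vec d → Vec p) (z : Vec d) :
    finiteMean g z = batchMean (Finset.univ : Finset (Fin n)).val fun k => g k z :=
  (batchMean_univ _).symm

lemma hasFDerivAt_finiteMean {g : Fin n → Vec d → Vec p} (hg : ∀ k, Differentiable ℝ (g k))
    (z : Vec d) :
    HasFDerivAt (finiteMean g)
      (batchMean (Finset.univ : Finset (Fin n)).val fun k => fderiv ℝ (g k) z) z := by
  rw [batchMean_univ]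
  exact (HasFDerivAt.fun_sum fun i _ => (hg i z).hasFDerivAt).const_smul (1 / (n : ℝ))

lemma jet_finiteMean {g : Fin n → Vec d → Vec p} (hg : ∀ k, Differentiable ℝ (g k))
    (z : Vec d) :
    jet (finiteMean g) z = batchMean (Finset.univ : Finset (Fin n)).val fun k => jet (g k) z := by
  unfold jet
  rw [(hasFDerivAt_finiteMean hg z).fderiv, ← batchMean_prodMk, finiteMean_eq]

variable {f : Vec p → ℝ} {g : Fin n → Vec d → Vec p} {r : Vec d → ℝ} {lf Lf lg Lg : ℝ≥0}

lemma innerRegular_finiteMean (h : Regular f g (finiteMean g) r lf Lf lg Lg) :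
    InnerRegular (finiteMean g) lg Lg where
  diff z := (hasFDerivAt_finiteMean h.g_diff z).differentiableAt
  lip := LipschitzWith.of_dist_le_mul fun x y => by
    rw [dist_eq_norm, dist_eq_norm, finiteMean_eq, finiteMean_eq, ← batchMean_sub]
    exact norm_batchMean_le (by positivity) fun k => (h.g_lip k).norm_sub_le x y
  jac_lip x y := by
    rw [(hasFDerivAt_finiteMean h.g_diff x).fderiv, (hasFDerivAt_finiteMean h.g_diff y).fderiv,
      ← batchMean_sub]
    exact norm_batchMean_le (by positivity) fun k => (h.innerRegular k).jac_lip x y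

end FiniteSum

/-! ### Moments of uniformly random subsets -/

section UniformSubsets

variable {Ω : Type*} {mΩ : MeasurableSpace Ω} {μ : Measure Ω} {n b : ℕ}
  {A : Ω → Finset (Fin n)}

lemma uniformOn_real_singleton {α : Type*} [MeasurableSpace α] [MeasurableSingletonClass α]
    [DecidableEq α] (S : Finset α) (a : α) :
    (uniformOn (S : Set α)).real {a} = if a ∈ S then (S.card : ℝ)⁻¹ else 0 := by
  rw [Measure.real, ← Finset.coe_singleton, uniformOn_apply_finset]
  split_ifs with h
  · rw [Finset.inter_singleton_of_mem h]; simp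
  · rw [Finset.inter_singleton_of_notMem h]; simp

lemma setOf_card_eq : {s : Finset (Fin n) | s.card = b} =
    ((Finset.univ : Finset (Fin n)).powersetCard b : Finset (Finset (Fin n))) := by
  ext s
  simp [Finset.mem_powersetCard]

lemma ae_card_eq (hA : Measurable A) (hlaw : μ.map A = uniformOn {s : Finset (Fin n) | s.card = b}) :
    ∀ᵐ ω ∂μ, (A ω).card = b := by
  have h1 : ∀ᵐ s ∂(μ.map A), s.card = b := by
    rw [hlaw, ae_iff]
    have := (uniformOn_eq_zero_iff (Ω := Finset (Fin n)) (t := {s | ¬ s.card = b})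
      (Set.toFinite {s : Finset (Fin n) | s.card = b})).mpr
    refine this ?_
    ext s
    simp
  exact ae_of_ae_map hA.aemeasurable h1

variable [IsProbabilityMeasure μ]

lemma integrable_comp_finset {E : Type*} [NormedAddCommGroup E] (hA : Measurable A)
    (φ : Finset (Fin n) → E) : Integrable (fun ω => φ (A ω)) μ := by
  have := Measure.isProbabilityMeasure_map (μ := μ) hA.aemeasurable
  exact (Integrable.of_finite (μ := μ.map A) (f := φ)).comp_measurable hA

lemma integral_comp_finset {E : Type*} [NormedAddCommGroup E] [NormedSpace ℝ E] [CompleteSpace E]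
    (hA : Measurable A)
    (hlaw : μ.map A = uniformOn {s : Finset (Fin n) | s.card = b}) (φ : Finset (Fin n) → E) :
    ∫ ω, φ (A ω) ∂μ = (n.choose b : ℝ)⁻¹ •
      ∑ s ∈ (Finset.univ : Finset (Fin n)).powersetCard b, φ s := by
  classical
  have := Measure.isProbabilityMeasure_map (μ := μ) hA.aemeasurable
  rw [← integral_map (f := φ) hA.aemeasurable Integrable.of_finite.aestronglyMeasurable,
    integral_fintype Integrable.of_finite, hlaw, setOf_card_eq]
  simp_rw [uniformOn_real_singleton, ite_smul, zero_smul]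
  rw [Finset.sum_ite_mem, Finset.univ_inter, Finset.card_powersetCard, Finset.card_univ,
    Fintype.card_fin, Finset.smul_sum]

/-- The minibatch mean of centered vectors over a uniformly random subset of size `b`. -/
lemma batchMean_uniform_moments {H : Type*} [NormedAddCommGroup H] [InnerProductSpace ℝ H]
    [CompleteSpace H] (hA : Measurable A)
    (hlaw : μ.map A = uniformOn {s : Finset (Fin n) | s.card = b}) (hb : 1 ≤ b) (hbn : b ≤ n)
    (c : Fin n → H) (hc : ∑ i, c i = 0) :
    ∫ ω, batchMean (A ω).val c ∂μ = 0 ∧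
      ∫ ω, ‖batchMean (A ω).val c‖ ^ 2 ∂μ ≤ 1 / (b : ℝ) * (1 / n * ∑ i, ‖c i‖ ^ 2) := by
  have e : ∀ s ∈ (Finset.univ : Finset (Fin n)).powersetCard b,
      batchMean s.val c = (1 / (b : ℝ)) • ∑ i ∈ s, c i := fun s hs => by
    rw [batchMean, Finset.card_val, (Finset.mem_powersetCard.mp hs).2]; rfl
  have hn : 0 < n := by omega
  have hb0 : (0 : ℝ) < b := by exact_mod_cast hb
  have hn0 : (0 : ℝ) < n := by exact_mod_cast hn
  constructor
  · rw [integral_comp_finset hA hlaw fun s => batchMean s.val c, Finset.sum_congr rfl e,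
      ← Finset.smul_sum, sum_powersetCard_sum hb, hc, smul_zero, smul_zero, smul_zero]
  · rw [integral_comp_finset hA hlaw fun s => ‖batchMean s.val c‖ ^ 2,
      Finset.sum_congr rfl fun s hs => by rw [e s hs, norm_smul, mul_pow], ← Finset.mul_sum,
      smul_eq_mul]
    have h1 := sum_powersetCard_norm_sum_sq_le hb c hc
    have hN : (0 : ℝ) < n.choose b := by exact_mod_cast Nat.choose_pos hbn
    -- Counts pairs of a b-subset and one of its elements in two ways.
    have hch : (n : ℝ) * (n - 1).choose (b - 1) = n.choose b * b := by
      have := Nat.add_one_mul_choose_eq (n - 1) (b - 1)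
      rw [Nat.sub_add_cancel hn, Nat.sub_add_cancel hb] at this
      exact_mod_cast this
    have h2 : ((n.choose b : ℝ))⁻¹ * (‖1 / (b : ℝ)‖ ^ 2 *
        ∑ s ∈ (Finset.univ : Finset (Fin n)).powersetCard b, ‖∑ i ∈ s, c i‖ ^ 2) ≤
        ((n.choose b : ℝ))⁻¹ * (‖1 / (b : ℝ)‖ ^ 2 *
        (((n - 1).choose (b - 1) : ℝ) * ∑ i, ‖c i‖ ^ 2)) := by gcongr
    refine h2.trans (le_of_eq ?_)
    have hch' : ((n - 1).choose (b - 1) : ℝ) = n.choose b * b / n := by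
      field_simp; linarith
    rw [hch', Real.norm_eq_abs, sq_abs]
    field_simp

end UniformSubsets

/-! ### The finite-sum minibatches satisfy the abstract hypotheses -/

section FiniteSampling

variable {Ω : Type*} {mΩ : MeasurableSpace Ω} {μ : Measure Ω} [IsProbabilityMeasure μ]
  {d p n T : ℕ} {f : Vec p → ℝ} {g : Fin n → Vec d → Vec p} {r : Vec d → ℝ} {lf Lf lg Lg : ℝ≥0}
  {A : ℕ → Ω → Finset (Fin n)} {ζ : Ω → ℕ}

/-- The information of each minibatch of the finite-sum problem. -/
@[reducible]
def finiteSource (T : ℕ) (A : ℕ → Ω → Finset (Fin n)) (t : Fin T) : MeasurableSpace Ω :=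
  MeasurableSpace.comap (A t) inferInstance

lemma finiteBatch_bounds (hn : 0 < n) (t : ℕ) : 1 ≤ finiteBatch n t ∧ finiteBatch n t ≤ n := by
  unfold finiteBatch
  split_ifs
  · exact ⟨hn, le_rfl⟩
  · exact ⟨Nat.sqrt_pos.mpr hn, Nat.sqrt_le_self n⟩

lemma continuous_batchMean {Z Ξ V : Type*} [TopologicalSpace Z] [NormedAddCommGroup V]
    [NormedSpace ℝ V] (S : Multiset Ξ) {h : Ξ → Z → V} (hh : ∀ k, Continuous (h k)) :
    Continuous fun z => batchMean S fun k => h k z := by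
  have h1 : Continuous fun z => (S.map fun k => h k z).sum := by
    induction S using Multiset.induction with
    | empty => simpa using continuous_const
    | cons a S ih =>
      simp only [Multiset.map_cons, Multiset.sum_cons]
      exact (hh a).add ih
  exact h1.const_smul (1 / (Multiset.card S : ℝ))

lemma measurable_comp_snd {Z S Q Y : Type*} {mZ : MeasurableSpace Z} {mS : MeasurableSpace S}
    {mQ : MeasurableSpace Q} {mY : MeasurableSpace Y} {m : Z × S → Q} (hm : Measurable m)
    {s : Y → S} (hs : Measurable s) : Measurable fun q : Z × Y => m (q.1, s q.2) := by
  fun_prop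

lemma measurable_batchMean_jet {𝒢 : MeasurableSpace Ω} {S : Ω → Finset (Fin n)}
    (hS : Measurable[𝒢] S) (hg : ∀ k, InnerRegular (g k) lg Lg) :
    Measurable[MeasurableSpace.prod inferInstance 𝒢] fun q : Vec d × Ω =>
      batchMean (S q.2).val fun k => jet (g k) q.1 := by
  exact measurable_comp_snd (m := fun q : Vec d × Finset (Fin n) =>
    batchMean q.2.val fun k => jet (g k) q.1) (measurable_from_prod_countable_left fun s =>
    (continuous_batchMean s.val fun k => (hg k).continuous_jet).measurable) hS

/-- A refresh uses the full index set and is exact, hence V = 0. Other batches have size ⌊√n⌋, which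
is also the epoch length, so the variance factor of an update is the required 1/τ. -/
lemma FiniteSampling.sampling (hs : FiniteSampling μ T (finiteBatch n) A ζ) (hn : 0 < n)
    (h : Regular f g (finiteMean g) r lf Lf lg Lg) :
    Sampling μ T (Nat.sqrt n) g (finiteMean g) lf Lf lg Lg 0 (fun t ω => (A t ω).val)
      (pastAlgebra (finiteSource T A) Fin.val) (levelAlgebra (finiteSource T A) Fin.val) where
  past_le t _ := pastAlgebra_le (fun i : Fin T => (hs.meas i i.2).comap_le) _ _
  past_mono t _ := pastAlgebra_mono _ _
  batch_le t _ := levelAlgebra_le _ _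
  indep t _ := indep_pastAlgebra (fun i : Fin T => (hs.meas i i.2).comap_le) hs.indep.iIndep _ _
  meas t ht := by
    have h1 : Measurable[finiteSource T A ⟨t, ht⟩] (A t) := comap_measurable _
    exact measurable_batchMean_jet
      (h1.mono (le_levelAlgebra (m := finiteSource T A) Fin.val ⟨t, ht⟩) le_rfl) h.innerRegular
  refresh t ht hτ z := by
    have hcard := ae_card_eq (hs.meas t ht) (hs.law t ht)
    rw [ENNReal.ofReal_zero, nonpos_iff_eq_zero]
    refine (lintegral_congr_ae ?_).trans lintegral_zero
    filter_upwards [hcard] with ω hω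
    have : A t ω = Finset.univ := by
      rw [← Finset.card_eq_iff_eq_univ, hω, Fintype.card_fin, finiteBatch, if_pos hτ]
    rw [this, jet_finiteMean h.g_diff]
    simp
  update t ht hτ u z z' := by
    obtain ⟨hb1, hbn⟩ := finiteBatch_bounds hn t
    have hn0 : (0 : ℝ) < n := by exact_mod_cast hn
    set w : Fin n → Pairs d p := fun k =>
      errPairing lf Lf lg (jet (g k) z) - errPairing lf Lf lg (jet (g k) z') with hw
    set m : Pairs d p := errPairing lf Lf lg (jet (finiteMean g) z - jet (finiteMean g) z') with hm
    have hmean : (1 / (n : ℝ)) • ∑ i, w i = m := by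
      rw [hm, jet_finiteMean h.g_diff, jet_finiteMean h.g_diff, map_sub, map_batchMean,
        map_batchMean, ← batchMean_sub, batchMean_univ]
    have hsum : ∑ i, w i = (n : ℝ) • m := by
      rw [← hmean, smul_smul, mul_one_div_cancel hn0.ne', one_smul]
    have hc : ∑ i, (w i - m) = 0 := by
      rw [Finset.sum_sub_distrib, hsum, Nat.cast_smul_eq_nsmul]; simp
    have hwn : ∀ i, ‖w i‖ ^ 2 ≤ G0 lf Lf lg Lg * ‖z - z'‖ ^ 2 := fun i =>
      norm_errPairing_sub_sq_le (h.g_lip i) (h.g_jac_lip i) z z'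
    have hcn : ∑ i, ‖w i - m‖ ^ 2 ≤ n * (G0 lf Lf lg Lg * ‖z - z'‖ ^ 2) := by
      -- Centering at the mean only lowers the sum of squares.
      have e : ∑ i, ‖w i - m‖ ^ 2 = ∑ i, ‖w i‖ ^ 2 - n * ‖m‖ ^ 2 := by
        simp_rw [norm_sub_sq_real]
        rw [Finset.sum_add_distrib, Finset.sum_sub_distrib, ← Finset.mul_sum, ← sum_inner, hsum,
          inner_smul_left, real_inner_self_eq_norm_sq]
        simp
        ring
      have h1 : ∑ i, ‖w i‖ ^ 2 ≤ ∑ _i : Fin n, G0 lf Lf lg Lg * ‖z - z'‖ ^ 2 :=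
        Finset.sum_le_sum fun i _ => hwn i
      rw [Finset.sum_const, Finset.card_univ, Fintype.card_fin, nsmul_eq_mul] at h1
      have : 0 ≤ (n : ℝ) * ‖m‖ ^ 2 := by positivity
      linarith
    obtain ⟨hY0, hY2⟩ := batchMean_uniform_moments (hs.meas t ht) (hs.law t ht) hb1 hbn _ hc
    have hb : finiteBatch n t = Nat.sqrt n := if_neg hτ
    have hY2' : ∫ ω, ‖batchMean (A t ω).val fun i => w i - m‖ ^ 2 ∂μ ≤
        G0 lf Lf lg Lg / (Nat.sqrt n : ℕ) * ‖z - z'‖ ^ 2 := by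
      refine hY2.trans ?_
      rw [hb]
      have h1 : 1 / ((Nat.sqrt n : ℕ) : ℝ) * (1 / (n : ℝ) * ∑ i, ‖w i - m‖ ^ 2) ≤
          1 / ((Nat.sqrt n : ℕ) : ℝ) *
            (1 / (n : ℝ) * (n * (G0 lf Lf lg Lg * ‖z - z'‖ ^ 2))) := by gcongr
      refine h1.trans (le_of_eq ?_)
      field_simp
    have hm1 := integrable_comp_finset (μ := μ) (hs.meas t ht)
      fun s => batchMean s.val fun i => w i - m
    have hm2 := integrable_comp_finset (μ := μ) (hs.meas t ht)
      fun s => ‖batchMean s.val fun i => w i - m‖ ^ 2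
    refine le_trans (le_of_eq (lintegral_congr_ae ?_))
      (lintegral_enorm_add_sq_le hm1.aestronglyMeasurable hm2 hY0 hY2' u)
    filter_upwards [ae_card_eq (hs.meas t ht) (hs.law t ht)] with ω hω
    have hb0 : ((A t ω).card : ℝ) ≠ 0 := by
      rw [hω]; exact_mod_cast (Nat.one_le_iff_ne_zero.mp hb1)
    have hconst : batchMean (A t ω).val (fun _ => m) = m := by
      simp [batchMean, ← Nat.cast_smul_eq_nsmul ℝ, smul_smul, inv_mul_cancel₀ hb0]
    rw [batchMean_sub, hconst, map_sub, map_batchMean, map_batchMean, ← batchMean_sub]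

end FiniteSampling

/-! ### The averaged mapping of the online problem -/

section OnlineMean

variable {d p : ℕ} {Ξ : Type*} [MeasurableSpace Ξ] {P : Measure Ξ}
  {f : Vec p → ℝ} {g : Ξ → Vec d → Vec p} {r : Vec d → ℝ} {lf Lf lg Lg sg sg' : ℝ≥0}

lemma integral_errPairing_variance_le (hv : BoundedVariance P g sg sg') (x : Vec d) :
    Integrable (fun k => ‖errPairing lf Lf lg (jet (g k) x) -
      errPairing lf Lf lg (jet (onlineMean P g) x)‖ ^ 2) P ∧
    ∫ k, ‖errPairing lf Lf lg (jet (g k) x) -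
      errPairing lf Lf lg (jet (onlineMean P g) x)‖ ^ 2 ∂P ≤ sigma0Sq lf Lf lg sg sg' := by
  have e : ∀ k, ‖errPairing lf Lf lg (jet (g k) x) -
      errPairing lf Lf lg (jet (onlineMean P g) x)‖ ^ 2 =
      2 * ((lg : ℝ) ^ 2 * Lf ^ 2 * ‖g k x - onlineMean P g x‖ ^ 2 +
        lf ^ 2 * frob (fderiv ℝ (g k) x - fderiv ℝ (onlineMean P g) x) ^ 2) := fun k => by
    rw [← map_sub, norm_errPairing_sq]; rfl
  simp_rw [e]
  have h1 := (hv.g_int x).const_mul ((lg : ℝ) ^ 2 * Lf ^ 2)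
  have h2 := (hv.jac_int x).const_mul ((lf : ℝ) ^ 2)
  refine ⟨(h1.add h2).const_mul 2, ?_⟩
  rw [integral_const_mul, integral_add h1 h2, integral_const_mul, integral_const_mul, sigma0Sq]
  have h3 := hv.g_var x
  have h4 := hv.jac_var x
  gcongr

variable [IsProbabilityMeasure P]

/-- If g_ξ(x) were not integrable, its Bochner integral would be 0 by default. The variance
hypothesis would then say that ‖g_ξ(x)‖² is integrable, which for a probability measure implies
integrability of g_ξ(x). -/
lemma BoundedVariance.integrable (hv : BoundedVariance P g sg sg') (x : Vec d) :
    Integrable (fun k => g k x) P := by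
  by_contra h
  have h0 : onlineMean P g x = 0 := integral_undef h
  have h1 := hv.g_int x
  simp only [h0, sub_zero] at h1
  exact h (integrable_of_integrable_norm_sq (hv.meas x).aestronglyMeasurable h1)

lemma measurable_clm_of_apply_single {K : Ξ → Vec d →L[ℝ] Vec p}
    (hK : ∀ j, Measurable fun k => K k (EuclideanSpace.single j 1)) : Measurable K := by
  have e : K = fun k => ∑ j : Fin d,
      ContinuousLinearMap.smulRightL ℝ (Vec d) (Vec p) (EuclideanSpace.proj j)
        (K k (EuclideanSpace.single j 1)) := by
    funext k
    ext1 x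
    rw [apply_eq_sum_single (K k) x, sum_apply]
    rfl
  rw [e]
  exact Finset.measurable_sum _ fun j _ =>
    (ContinuousLinearMap.smulRightL ℝ (Vec d) (Vec p)
      (EuclideanSpace.proj j)).continuous.measurable.comp (hK j)

/-- Each directional derivative is a limit of difference quotients with steps 1/n, each measurable
in the parameter; finitely many columns determine the Jacobian. -/
lemma measurable_fderiv_param (hm : ∀ x, Measurable fun k => g k x)
    (hd : ∀ k, Differentiable ℝ (g k)) (x : Vec d) :
    Measurable fun k => fderiv ℝ (g k) x := by
  refine measurable_clm_of_apply_single fun j => ?_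
  have hc : Filter.Tendsto (fun n : ℕ => ‖(n : ℝ)‖) Filter.atTop Filter.atTop := by
    simpa using tendsto_natCast_atTop_atTop (R := ℝ)
  refine measurable_of_tendsto_metrizable (f := fun (n : ℕ) k =>
    (n : ℝ) • (g k (x + (n : ℝ)⁻¹ • EuclideanSpace.single j (1 : ℝ)) - g k x))
    (fun n => ((hm _).sub (hm x)).const_smul (n : ℝ)) ?_
  rw [tendsto_pi_nhds]
  exact fun k => (hd k x).hasFDerivAt.lim _ hc

lemma measurable_jet (hm : ∀ x, Measurable fun k => g k x)
    (hd : ∀ k, Differentiable ℝ (g k)) (x : Vec d) : Measurable fun k => jet (g k) x :=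
  (hm x).prodMk (measurable_fderiv_param hm hd x)

lemma integrable_fderiv_param (h : Regular f g (onlineMean P g) r lf Lf lg Lg)
    (hv : BoundedVariance P g sg sg') (x : Vec d) : Integrable (fun k => fderiv ℝ (g k) x) P :=
  Integrable.of_bound (measurable_fderiv_param hv.meas h.g_diff x).aestronglyMeasurable lg
    (Filter.Eventually.of_forall fun k => norm_fderiv_le_of_lipschitz ℝ (h.g_lip k))

/-- Differentiation under the integral, dominated by the common Lipschitz constant. It shows that
sampled Jacobians are unbiased for the Jacobian of the mean. -/
lemma hasFDerivAt_onlineMean (h : Regular f g (onlineMean P g) r lf Lf lg Lg)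
    (hv : BoundedVariance P g sg sg') (x : Vec d) :
    HasFDerivAt (onlineMean P g) (∫ k, fderiv ℝ (g k) x ∂P) x := by
  refine (hasFDerivAt_integral_of_dominated_loc_of_lip (F := fun z k => g k z)
    (bound := fun _ => (lg : ℝ)) Filter.univ_mem
    (Filter.Eventually.of_forall fun z => (hv.meas z).aestronglyMeasurable) (hv.integrable x)
    (measurable_fderiv_param hv.meas h.g_diff x).aestronglyMeasurable
    (Filter.Eventually.of_forall fun k => ?_) (integrable_const _)
    (Filter.Eventually.of_forall fun k => (h.g_diff k x).hasFDerivAt)).2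
  have e : Real.nnabs (lg : ℝ) = lg := by simp
  rw [e]
  exact (h.g_lip k).lipschitzOnWith

lemma integrable_jet (h : Regular f g (onlineMean P g) r lf Lf lg Lg)
    (hv : BoundedVariance P g sg sg') (x : Vec d) : Integrable (fun k => jet (g k) x) P :=
  (hv.integrable x).prodMk (integrable_fderiv_param h hv x)

lemma integral_jet (h : Regular f g (onlineMean P g) r lf Lf lg Lg)
    (hv : BoundedVariance P g sg sg') (x : Vec d) :
    ∫ k, jet (g k) x ∂P = jet (onlineMean P g) x := by
  unfold jet
  rw [integral_pair (hv.integrable x) (integrable_fderiv_param h hv x),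
    (hasFDerivAt_onlineMean h hv x).fderiv]
  rfl

lemma innerRegular_onlineMean (h : Regular f g (onlineMean P g) r lf Lf lg Lg)
    (hv : BoundedVariance P g sg sg') : InnerRegular (onlineMean P g) lg Lg where
  diff z := (hasFDerivAt_onlineMean h hv z).differentiableAt
  lip := LipschitzWith.of_dist_le_mul fun x y => by
    rw [dist_eq_norm, dist_eq_norm]
    have e : onlineMean P g x - onlineMean P g y = ∫ k, (g k x - g k y) ∂P :=
      (integral_sub (hv.integrable x) (hv.integrable y)).symm
    rw [e]
    simpa using norm_integral_le_of_norm_le_const (μ := P)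
      (Filter.Eventually.of_forall fun k => (h.g_lip k).norm_sub_le x y)
  jac_lip x y := by
    rw [(hasFDerivAt_onlineMean h hv x).fderiv, (hasFDerivAt_onlineMean h hv y).fderiv,
      ← integral_sub (integrable_fderiv_param h hv x) (integrable_fderiv_param h hv y)]
    simpa using norm_integral_le_of_norm_le_const (μ := P)
      (Filter.Eventually.of_forall fun k => (h.innerRegular k).jac_lip x y)

end OnlineMean

/-! ### Means of independent samples -/

section IndependentBatch

variable {Ω Ξ H : Type*} {mΩ : MeasurableSpace Ω} {μ : Measure Ω} [IsProbabilityMeasure μ]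
  [NormedAddCommGroup H] [InnerProductSpace ℝ H]

lemma batchMean_onlineBatches {V : Type*} [AddCommGroup V] [Module ℝ V] (b : ℕ → ℕ)
    (ξ : ℕ → ℕ → Ω → Ξ) (ω : Ω) (t : ℕ) (h : Ξ → V) :
    batchMean (onlineBatches b ξ ω t) h = (1 / (b t : ℝ)) • ∑ i : Fin (b t), h (ξ t i ω) := by
  have e : ∑ i : Fin (b t), h (ξ t i ω) = ((Multiset.range (b t)).map fun i => h (ξ t i ω)).sum :=
    Fin.sum_univ_eq_sum_range (fun i => h (ξ t i ω)) (b t)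
  rw [e]
  simp [batchMean, onlineBatches]

variable [MeasurableSpace Ξ] {P : Measure Ξ} [IsProbabilityMeasure P]
  [CompleteSpace H] [MeasurableSpace H] [BorelSpace H] [SecondCountableTopology H]

/-- The deviation of the minibatch mean of `b` independent samples from the mean `m`. -/
lemma independent_batch_moments {b : ℕ} (hb : 1 ≤ b) {X : Fin b → Ω → Ξ}
    (hX : ∀ i, Measurable (X i)) (hlaw : ∀ i, μ.map (X i) = P)
    (hind : ∀ i j, i ≠ j → IndepFun (X i) (X j) μ) {h : Ξ → H} (hh : Measurable h)
    {m : H} (hint : Integrable h P) (hm : ∫ k, h k ∂P = m)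
    (hi : Integrable (fun k => ‖h k - m‖ ^ 2) P) {v : ℝ} (hv : ∫ k, ‖h k - m‖ ^ 2 ∂P ≤ v) :
    AEStronglyMeasurable (fun ω => (1 / (b : ℝ)) • ∑ i, h (X i ω) - m) μ ∧
    Integrable (fun ω => ‖(1 / (b : ℝ)) • ∑ i, h (X i ω) - m‖ ^ 2) μ ∧
    ∫ ω, ((1 / (b : ℝ)) • ∑ i, h (X i ω) - m) ∂μ = 0 ∧
    ∫ ω, ‖(1 / (b : ℝ)) • ∑ i, h (X i ω) - m‖ ^ 2 ∂μ ≤ 1 / (b : ℝ) * v := by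
  have hb0 : (b : ℝ) ≠ 0 := by exact_mod_cast Nat.one_le_iff_ne_zero.mp hb
  have e : ∀ ω, (1 / (b : ℝ)) • ∑ i, h (X i ω) - m = (1 / (b : ℝ)) • ∑ i, (h (X i ω) - m) := by
    intro ω
    rw [Finset.sum_sub_distrib, smul_sub, Finset.sum_const, Finset.card_univ, Fintype.card_fin,
      ← Nat.cast_smul_eq_nsmul ℝ, smul_smul, one_div_mul_cancel hb0, one_smul]
  simp_rw [e]
  have hc : Measurable fun k => h k - m := hh.sub_const m
  have hY : ∀ i, AEStronglyMeasurable (fun ω => h (X i ω) - m) μ := fun i =>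
    (hc.comp (hX i)).aestronglyMeasurable
  have hYi : ∀ i, Integrable (fun ω => ‖h (X i ω) - m‖ ^ 2) μ := fun i => by
    rw [← hlaw i] at hi
    exact hi.comp_measurable (hX i)
  have hmean : ∀ i, ∫ ω, (h (X i ω) - m) ∂μ = 0 := fun i => by
    rw [← integral_map (f := fun k => h k - m) (hX i).aemeasurable hc.aestronglyMeasurable,
      hlaw i, integral_sub hint (integrable_const _), hm]
    simp
  have hvar : ∀ i, ∫ ω, ‖h (X i ω) - m‖ ^ 2 ∂μ ≤ v := fun i => by
    rw [← integral_map (f := fun k => ‖h k - m‖ ^ 2) (hX i).aemeasurable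
      (hc.norm.pow_const 2).aestronglyMeasurable, hlaw i]
    exact hv
  have hindY : ∀ i j, i ≠ j →
      IndepFun (fun ω => h (X i ω) - m) (fun ω => h (X j ω) - m) μ := fun i j hij =>
    (hind i j hij).comp hc hc
  obtain ⟨h1, h2⟩ := integral_norm_sum_sq_le hY hYi hmean hindY hvar
  have hsum : AEStronglyMeasurable (fun ω => ∑ i, (h (X i ω) - m)) μ :=
    Finset.aestronglyMeasurable_fun_sum _ fun i _ => hY i
  refine ⟨hsum.const_smul _, ?_, ?_, ?_⟩
  · simp_rw [norm_smul, mul_pow]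
    exact h1.const_mul _
  · rw [integral_smul, integral_finsetSum _ fun i _ =>
      integrable_of_integrable_norm_sq (hY i) (hYi i)]
    simp [hmean]
  · simp_rw [norm_smul, mul_pow]
    rw [integral_const_mul, Real.norm_eq_abs, sq_abs]
    calc (1 / (b : ℝ)) ^ 2 * ∫ ω, ‖∑ i, (h (X i ω) - m)‖ ^ 2 ∂μ
        ≤ (1 / (b : ℝ)) ^ 2 * (b * v) := by gcongr
      _ = 1 / (b : ℝ) * v := by field_simp

end IndependentBatch

/-! ### The online minibatches satisfy the abstract hypotheses -/

section OnlineSampling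

variable {Ω Ξ : Type*} {mΩ : MeasurableSpace Ω} {μ : Measure Ω} [MeasurableSpace Ξ]
  {P : Measure Ξ} {d p T : ℕ} {f : Vec p → ℝ} {g : Ξ → Vec d → Vec p} {r : Vec d → ℝ}
  {lf Lf lg Lg sg sg' : ℝ≥0} {ξ : ℕ → ℕ → Ω → Ξ} {ζ : Ω → ℕ} {b : ℕ → ℕ} {δ : ℝ}

/-- The information of each sample of the online problem. -/
@[reducible]
def onlineSource (T : ℕ) (b : ℕ → ℕ) (ξ : ℕ → ℕ → Ω → Ξ) (q : (t : Fin T) × Fin (b t)) :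
    MeasurableSpace Ω :=
  MeasurableSpace.comap (ξ q.1 q.2) inferInstance

lemma measurable_onlineBatchMean_jet {𝒢 : MeasurableSpace Ω} {t : ℕ}
    (hξ : ∀ i < b t, Measurable[𝒢] (ξ t i)) (hg : ∀ k, InnerRegular (g k) lg Lg)
    (hm : ∀ x, Measurable fun k => g k x) :
    Measurable[MeasurableSpace.prod inferInstance 𝒢] fun q : Vec d × Ω =>
      batchMean (onlineBatches b ξ q.2 t) fun k => jet (g k) q.1 := by
  have h1 : Measurable (Function.uncurry fun (z : Vec d) (k : Ξ) => jet (g k) z) :=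
    measurable_uncurry_of_continuous_of_measurable (fun k => (hg k).continuous_jet)
      (measurable_jet hm fun k => (hg k).diff)
  simp only [batchMean_onlineBatches]
  refine Measurable.const_smul (Finset.measurable_sum _ fun i _ => ?_) (1 / (b t : ℝ))
  exact measurable_comp_snd h1 (hξ i i.2)

lemma onlineTau_pos (hδ : 0 < δ) (hle : δ ≤ √(2 * sigma0Sq lf Lf lg sg sg')) :
    1 ≤ onlineTau (sigma0Sq lf Lf lg sg sg') δ := by
  unfold onlineTau
  rw [Nat.one_le_floor_iff, Real.one_le_sqrt, one_le_div (by positivity)]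
  exact (Real.le_sqrt' hδ).mp hle

lemma two_sigma0Sq_pos (hδ : 0 < δ) (hle : δ ≤ √(2 * sigma0Sq lf Lf lg sg sg')) :
    0 < 2 * sigma0Sq lf Lf lg sg sg' :=
  Real.sqrt_pos.mp (hδ.trans_le hle)

/-- The iteration that draws a sample of the online problem. -/
def sampleLevel (q : (t : Fin T) × Fin (b t)) : ℕ := q.1

lemma OnlineSampling.onlineSource_le (hs : OnlineSampling μ P T b ξ ζ)
    (q : (t : Fin T) × Fin (b t)) : onlineSource T b ξ q ≤ mΩ :=
  (hs.meas q.1 q.1.2 q.2 q.2.2).comap_le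

lemma measurable_sample_level {t : ℕ} (ht : t < T) {i : ℕ} (hi : i < b t) :
    Measurable[levelAlgebra (onlineSource T b ξ) sampleLevel t] (ξ t i) := by
  have h1 : Measurable[onlineSource T b ξ ⟨⟨t, ht⟩, ⟨i, hi⟩⟩] (ξ t i) := comap_measurable _
  exact h1.mono (le_levelAlgebra (m := onlineSource T b ξ) sampleLevel ⟨⟨t, ht⟩, ⟨i, hi⟩⟩) le_rfl

lemma OnlineSampling.indep_level (hs : OnlineSampling μ P T b ξ ζ) (t : ℕ) :
    Indep (pastAlgebra (onlineSource T b ξ) sampleLevel t)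
      (levelAlgebra (onlineSource T b ξ) sampleLevel t) μ :=
  indep_pastAlgebra hs.onlineSource_le hs.indep.iIndep sampleLevel t

variable [IsProbabilityMeasure μ] [IsProbabilityMeasure P]

/-- The vector u stands for the frozen old error in an update; a refresh is the case u = 0. -/
lemma OnlineSampling.batch_moments {H : Type*} [NormedAddCommGroup H] [InnerProductSpace ℝ H]
    [CompleteSpace H] [MeasurableSpace H] [BorelSpace H] [SecondCountableTopology H]
    (hs : OnlineSampling μ P T b ξ ζ) {t : ℕ} (ht : t < T) (hb : 1 ≤ b t)
    {h : Ξ → H} (hh : Measurable h) {m : H} (hint : Integrable h P) (hm : ∫ k, h k ∂P = m)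
    (hi : Integrable (fun k => ‖h k - m‖ ^ 2) P) {v : ℝ} (hv : ∫ k, ‖h k - m‖ ^ 2 ∂P ≤ v)
    {w : ℝ} (hw : 1 / (b t : ℝ) * v ≤ w) (u : H) :
    ∫⁻ ω, ‖u + (batchMean (onlineBatches b ξ ω t) h - m)‖ₑ ^ 2 ∂μ ≤
      ‖u‖ₑ ^ 2 + ENNReal.ofReal w := by
  have hind : ∀ i j : Fin (b t), i ≠ j → IndepFun (ξ t i) (ξ t j) μ := fun i j hij => by
    have := hs.indep.indepFun (i := ⟨⟨t, ht⟩, i⟩) (j := ⟨⟨t, ht⟩, j⟩) (by simpa using hij)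
    exact this
  obtain ⟨h1, h2, h3, h4⟩ := independent_batch_moments (μ := μ) (P := P) hb
    (X := fun i => ξ t i) (fun i => hs.meas t ht i i.2) (fun i => hs.law t ht i i.2) hind hh hint
    hm hi hv
  simp only [batchMean_onlineBatches]
  exact lintegral_enorm_add_sq_le h1 h2 h3 (h4.trans hw) u

lemma OnlineSampling.refresh_le (hs : OnlineSampling μ P T b ξ ζ)
    (h : Regular f g (onlineMean P g) r lf Lf lg Lg) (hv : BoundedVariance P g sg sg') {t : ℕ}
    (ht : t < T) (hb : 1 ≤ b t) {w : ℝ} (hw : 1 / (b t : ℝ) * sigma0Sq lf Lf lg sg sg' ≤ w)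
    (z : Vec d) :
    ∫⁻ ω, ‖errPairing lf Lf lg (batchMean (onlineBatches b ξ ω t) fun k => jet (g k) z) -
      errPairing lf Lf lg (jet (onlineMean P g) z)‖ₑ ^ 2 ∂μ ≤ ENNReal.ofReal w := by
  obtain ⟨h1, h2⟩ := integral_errPairing_variance_le (lf := lf) (Lf := Lf) (lg := lg) hv z
  have h3 := hs.batch_moments ht hb
    (h := fun k => errPairing lf Lf lg (jet (g k) z))
    ((errPairing lf Lf lg).continuous.measurable.comp (measurable_jet hv.meas h.g_diff z))
    ((errPairing lf Lf lg).integrable_comp (integrable_jet h hv z))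
    (by rw [(errPairing lf Lf lg).integral_comp_comm (integrable_jet h hv z), integral_jet h hv])
    h1 h2 hw 0
  simp_rw [map_batchMean]
  simp only [zero_add] at h3
  refine h3.trans ?_
  simp

/-- Both jets of an increment are evaluated at the same sample, so the variance is at most the
second moment of their difference, which is bounded samplewise by G_0 ‖z - z'‖². -/
lemma OnlineSampling.update_le (hs : OnlineSampling μ P T b ξ ζ)
    (h : Regular f g (onlineMean P g) r lf Lf lg Lg) (hv : BoundedVariance P g sg sg') {t : ℕ}
    (ht : t < T) (hb : 1 ≤ b t) (u : Pairs d p) (z z' : Vec d) :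
    ∫⁻ ω, ‖u + (errPairing lf Lf lg ((batchMean (onlineBatches b ξ ω t) fun k => jet (g k) z) -
        batchMean (onlineBatches b ξ ω t) fun k => jet (g k) z') -
      errPairing lf Lf lg (jet (onlineMean P g) z - jet (onlineMean P g) z'))‖ₑ ^ 2 ∂μ ≤
    ‖u‖ₑ ^ 2 + ENNReal.ofReal (G0 lf Lf lg Lg / b t * ‖z - z'‖ ^ 2) := by
  have hjm := fun x => (errPairing lf Lf lg).continuous.measurable.comp
    (measurable_jet hv.meas h.g_diff x)
  have hji := fun x => (errPairing lf Lf lg).integrable_comp (integrable_jet h hv x)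
  have hbd : ∀ k, ‖errPairing lf Lf lg (jet (g k) z) - errPairing lf Lf lg (jet (g k) z')‖ ^ 2 ≤
      G0 lf Lf lg Lg * ‖z - z'‖ ^ 2 := fun k =>
    norm_errPairing_sub_sq_le (h.g_lip k) (h.g_jac_lip k) z z'
  have hmeas : Measurable fun k =>
    errPairing lf Lf lg (jet (g k) z) - errPairing lf Lf lg (jet (g k) z') :=
    (hjm z).sub (hjm z')
  have hsq : Integrable (fun k =>
      ‖errPairing lf Lf lg (jet (g k) z) - errPairing lf Lf lg (jet (g k) z')‖ ^ 2) P :=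
    Integrable.of_bound (hmeas.norm.pow_const 2).aestronglyMeasurable
      (G0 lf Lf lg Lg * ‖z - z'‖ ^ 2) (Filter.Eventually.of_forall fun k => by
        rw [Real.norm_eq_abs, abs_of_nonneg (by positivity)]; exact hbd k)
  have hmean : ∫ k, (errPairing lf Lf lg (jet (g k) z) -
      errPairing lf Lf lg (jet (g k) z')) ∂P =
      errPairing lf Lf lg (jet (onlineMean P g) z - jet (onlineMean P g) z') := by
    rw [integral_sub (hji z) (hji z'),
      (errPairing lf Lf lg).integral_comp_comm (integrable_jet h hv z),
      (errPairing lf Lf lg).integral_comp_comm (integrable_jet h hv z'), integral_jet h hv,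
      integral_jet h hv, map_sub]
  obtain ⟨h1, h2⟩ := integral_norm_sub_mean_sq_le hmeas.aestronglyMeasurable hsq hmean
  have h3 : ∫ k, ‖errPairing lf Lf lg (jet (g k) z) - errPairing lf Lf lg (jet (g k) z')‖ ^ 2 ∂P ≤
      G0 lf Lf lg Lg * ‖z - z'‖ ^ 2 := by
    have := integral_mono hsq (integrable_const _) hbd
    simpa using this
  have h4 := hs.batch_moments ht hb hmeas ((hji z).sub (hji z')) hmean h1 (h2.trans h3)
    (w := G0 lf Lf lg Lg / b t * ‖z - z'‖ ^ 2) (le_of_eq (by ring)) u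
  refine le_trans (le_of_eq (lintegral_congr fun ω => ?_)) h4
  rw [map_sub, map_batchMean, map_batchMean, ← batchMean_sub]

lemma one_le_onlineBatch (hδ : 0 < δ) (hle : δ ≤ √(2 * sigma0Sq lf Lf lg sg sg')) (t : ℕ) :
    1 ≤ onlineBatch (sigma0Sq lf Lf lg sg sg') δ t := by
  unfold onlineBatch
  split_ifs
  · have := two_sigma0Sq_pos hδ hle
    exact Nat.ceil_pos.mpr (by positivity)
  · exact onlineTau_pos hδ hle

/-- The minibatches of the online problem, with sample sizes `b t` that are at least
`2 σ_0² / δ²` at a refresh and equal to `τ` otherwise. -/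
lemma OnlineSampling.sampling {τ : ℕ} (hs : OnlineSampling μ P T b ξ ζ)
    (h : Regular f g (onlineMean P g) r lf Lf lg Lg) (hv : BoundedVariance P g sg sg')
    (hδ : 0 < δ) (hb : ∀ t, 1 ≤ b t)
    (hrefresh : ∀ t, t % τ = 0 → 2 * sigma0Sq lf Lf lg sg sg' / δ ^ 2 ≤ b t)
    (hupdate : ∀ t, t % τ ≠ 0 → b t = τ) :
    Sampling μ T τ g (onlineMean P g) lf Lf lg Lg
      (δ ^ 2 / 2) (fun t ω => onlineBatches b ξ ω t)
      (pastAlgebra (onlineSource T b ξ) sampleLevel)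
      (levelAlgebra (onlineSource T b ξ) sampleLevel) where
  past_le t _ := pastAlgebra_le hs.onlineSource_le _ _
  past_mono t _ := pastAlgebra_mono _ _
  batch_le t _ := levelAlgebra_le _ _
  indep t _ := hs.indep_level t
  meas t ht :=
    measurable_onlineBatchMean_jet (fun _ hi => measurable_sample_level ht hi) h.innerRegular
      hv.meas
  refresh t ht hτ z := by
    refine hs.refresh_le h hv ht (hb t) ?_ z
    -- The batch mean has variance at most σ_0² / b, and b ≥ 2 σ_0² / δ² makes this at most δ² / 2.
    have h3 := hrefresh t hτ
    rw [div_le_iff₀ (by positivity)] at h3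
    have h4 : (0 : ℝ) < b t := by exact_mod_cast hb t
    rw [one_div_mul_eq_div, div_le_iff₀ h4]
    linarith
  update t ht hτ u z z' := by
    have h1 := hs.update_le h hv ht (hb t) u z z'
    rwa [hupdate t hτ] at h1

end OnlineSampling

/-! ### The random output index -/

section RandomIndex

variable {Ω : Type*} {mΩ : MeasurableSpace Ω} {μ : Measure Ω} {T : ℕ} {ζ : Ω → ℕ}

lemma map_real_singleton_of_uniform (hlaw : μ.map ζ = uniformOn (Set.Iio T)) {t : ℕ}
    (ht : t < T) : (μ.map ζ).real {t} = 1 / (T : ℝ) := by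
  have e : Set.Iio T = (Finset.range T : Set ℕ) := by ext; simp
  rw [hlaw, e, uniformOn_real_singleton]
  simp [ht]

lemma ae_lt_of_uniform (hζ : Measurable ζ) (hlaw : μ.map ζ = uniformOn (Set.Iio T)) :
    ∀ᵐ ω ∂μ, ζ ω < T := by
  have h1 : ∀ᵐ t ∂(μ.map ζ), t < T := by
    rw [hlaw, ae_iff]
    refine (uniformOn_eq_zero_iff (Set.finite_Iio T)).mpr ?_
    ext t
    simp
  exact ae_of_ae_map hζ.aemeasurable h1

/-- Averaging over a uniformly random index that is independent of the summands. -/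
lemma integral_uniform_index [IsProbabilityMeasure μ] (hζ : Measurable ζ)
    (hlaw : μ.map ζ = uniformOn (Set.Iio T)) {Y : ℕ → Ω → ℝ}
    (hind : ∀ t < T, IndepFun ζ (Y t) μ) (hi : ∀ t < T, Integrable (Y t) μ) :
    Integrable (fun ω => Y (ζ ω) ω) μ ∧
      ∫ ω, Y (ζ ω) ω ∂μ = 1 / (T : ℝ) * ∑ t ∈ Finset.range T, ∫ ω, Y t ω ∂μ := by
  set I : ℕ → ℕ → ℝ := fun t s => if s = t then 1 else 0 with hI
  have hIm : ∀ t, Measurable fun ω => I t (ζ ω) := fun t => (measurable_of_countable (I t)).comp hζ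
  have hIi : ∀ t, Integrable (fun ω => I t (ζ ω)) μ := fun t =>
    Integrable.of_bound (hIm t).aestronglyMeasurable 1 (Filter.Eventually.of_forall fun ω => by
      simp only [hI]; split_ifs <;> simp)
  have hIint : ∀ t < T, ∫ ω, I t (ζ ω) ∂μ = 1 / (T : ℝ) := fun t ht => by
    rw [← map_real_singleton_of_uniform hlaw ht,
      ← integral_map (f := I t) hζ.aemeasurable (measurable_of_countable _).aestronglyMeasurable,
      ← integral_indicator_one (measurableSet_singleton t)]
    refine integral_congr_ae (Filter.Eventually.of_forall fun s => ?_)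
    simp [hI, Set.indicator_apply]
  have hindep : ∀ t < T, IndepFun (fun ω => I t (ζ ω)) (Y t) μ := fun t ht =>
    (hind t ht).comp (measurable_of_countable (I t)) measurable_id
  have hprod : ∀ t < T, Integrable (fun ω => I t (ζ ω) * Y t ω) μ := fun t ht =>
    (hindep t ht).integrable_mul (hIi t) (hi t ht)
  have hval : ∀ t < T, ∫ ω, I t (ζ ω) * Y t ω ∂μ = 1 / (T : ℝ) * ∫ ω, Y t ω ∂μ := fun t ht => by
    rw [(hindep t ht).integral_fun_mul_eq_mul_integral (hIi t).aestronglyMeasurable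
      (hi t ht).aestronglyMeasurable, hIint t ht]
  -- Expand over the events ζ = t, each independent of Y t and of probability 1/T.
  have e : (fun ω => Y (ζ ω) ω) =ᵐ[μ] fun ω => ∑ t ∈ Finset.range T, I t (ζ ω) * Y t ω := by
    filter_upwards [ae_lt_of_uniform hζ hlaw] with ω hω
    rw [Finset.sum_eq_single_of_mem (ζ ω) (Finset.mem_range.mpr hω)]
    · simp [hI]
    · intro t _ ht
      simp [hI, ht.symm]
  refine ⟨(integrable_finsetSum _ fun t ht => hprod t (Finset.mem_range.mp ht)).congr e.symm, ?_⟩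
  rw [integral_congr_ae e, integral_finsetSum _ fun t ht => hprod t (Finset.mem_range.mp ht),
    Finset.mul_sum]
  exact Finset.sum_congr rfl fun t ht => hval t (Finset.mem_range.mp ht)

/-- Instead of Jensen's inequality, integrate X ≤ X² / (2ε) + ε / 2. Measurability of X is recovered
from that of X², since X = √(X²). -/
lemma integral_le_of_integral_sq_le [IsProbabilityMeasure μ] {X : Ω → ℝ} (h0 : ∀ ω, 0 ≤ X ω)
    (hi : Integrable (fun ω => X ω ^ 2) μ) {ε : ℝ} (hε : 0 < ε)
    (h : ∫ ω, X ω ^ 2 ∂μ ≤ ε ^ 2) : Integrable X μ ∧ ∫ ω, X ω ∂μ ≤ ε := by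
  have hm : AEStronglyMeasurable X μ := by
    have h1 := Real.continuous_sqrt.comp_aestronglyMeasurable hi.aestronglyMeasurable
    simpa only [Real.sqrt_sq (h0 _)] using h1
  have hb : ∀ ω, X ω ≤ (2 * ε)⁻¹ * X ω ^ 2 + ε / 2 := fun ω => by
    have e : (2 * ε)⁻¹ * X ω ^ 2 + ε / 2 - X ω = (2 * ε)⁻¹ * (X ω - ε) ^ 2 := by
      field_simp; ring
    have : 0 ≤ (2 * ε)⁻¹ * (X ω - ε) ^ 2 := by positivity
    linarith
  have hj : Integrable (fun ω => (2 * ε)⁻¹ * X ω ^ 2 + ε / 2) μ :=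
    (hi.const_mul _).add (integrable_const _)
  have hX : Integrable X μ := hj.mono' hm (Filter.Eventually.of_forall fun ω => by
    rw [Real.norm_eq_abs, abs_of_nonneg (h0 ω)]; exact hb ω)
  refine ⟨hX, (integral_mono hX hj hb).trans ?_⟩
  rw [integral_add (hi.const_mul _) (integrable_const _), integral_const_mul, integral_const]
  have h1 : (2 * ε)⁻¹ * ∫ ω, X ω ^ 2 ∂μ ≤ (2 * ε)⁻¹ * ε ^ 2 := by gcongr
  have h2 : (2 * ε)⁻¹ * ε ^ 2 = ε / 2 := by field_simp
  rw [probReal_univ, one_smul]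
  linarith

end RandomIndex

/-! ### The accuracy of the random output -/

section Averaged

variable {Ω Ξ : Type*} {mΩ : MeasurableSpace Ω} {d p : ℕ}
  {f : Vec p → ℝ} {g : Ξ → Vec d → Vec p} {gbar : Vec d → Vec p}
  {r : Vec d → ℝ} {lf Lf lg Lg : ℝ≥0} {T τ : ℕ} {β V : ℝ} {lam : ℕ → ℝ} {x₀ : Vec d}
  {B : ℕ → Ω → Multiset Ξ} {ℱ 𝒢 : ℕ → MeasurableSpace Ω} {μ : Measure Ω}

lemma Sampling.integral_accuracy_sq_le [IsProbabilityMeasure μ]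
    (hs : Sampling μ T τ g gbar lf Lf lg Lg V B ℱ 𝒢) (hreg : Regular f g gbar r lf Lf lg Lg)
    (hin : InnerRegular gbar lg Lg) (hβ : AdmissibleBeta lf Lf lg Lg β) (hV : 0 ≤ V) (hτ : 0 < τ)
    (h : AdmissibleLam T β lam) (hT : 0 < T) {ζ : Ω → ℕ} (hζ : Measurable ζ)
    (hlaw : μ.map ζ = uniformOn (Set.Iio T)) {𝒜 : MeasurableSpace Ω}
    (hpast : ∀ t < T, ℱ t ≤ 𝒜) (hind : Indep (MeasurableSpace.comap ζ inferInstance) 𝒜 μ) :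
    Integrable (fun ω => accuracy f g gbar r (dimParams τ β lam) x₀ (B · ω) (ζ ω) ^ 2) μ ∧
      ∫ ω, accuracy f g gbar r (dimParams τ β lam) x₀ (B · ω) (ζ ω) ^ 2 ∂μ ≤
        4000 * (gap f gbar r x₀ / (T * β) + V) := by
  obtain ⟨h1, h2⟩ := hs.sum_integral_accuracy_sq_le (x₀ := x₀) hreg hin hβ hV hτ h
  obtain ⟨h3, h4⟩ := integral_uniform_index hζ hlaw
    (Y := fun t ω => accuracy f g gbar r (dimParams τ β lam) x₀ (B · ω) t ^ 2)
    (fun t ht => indep_of_indep_of_le_right hind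
      (((hs.measurable_accuracy hreg hin hβ.1 h ht).mono (hpast t ht) le_rfl).pow_const 2).comap_le)
    h1
  refine ⟨h3, h4.le.trans ?_⟩
  have hT' : (0 : ℝ) < T := by exact_mod_cast hT
  have hβ0 := hβ.1
  calc 1 / (T : ℝ) * ∑ t ∈ Finset.range T,
        ∫ ω, accuracy f g gbar r (dimParams τ β lam) x₀ (B · ω) t ^ 2 ∂μ
      ≤ 1 / (T : ℝ) * (4000 * (gap f gbar r x₀ / β + T * V)) := by gcongr
    _ = 4000 * (gap f gbar r x₀ / (T * β) + V) := by field_simp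

end Averaged

/-! ### Counting evaluations -/

section Evaluations

lemma accuracy_nonneg {Ξ : Type*} {d p : ℕ} (f : Vec p → ℝ) (g : Ξ → Vec d → Vec p)
    (gbar : Vec d → Vec p) (r : Vec d → ℝ) (par : Params) (x₀ : Vec d) (A : ℕ → Multiset Ξ)
    (t : ℕ) : 0 ≤ accuracy f g gbar r par x₀ A t :=
  norm_nonneg _

variable {Ξ : Type*} {d p : ℕ} {f : Vec p → ℝ} {g : Ξ → Vec d → Vec p} {r : Vec d → ℝ}
  {x₀ : Vec d} {A : ℕ → Multiset Ξ}

/-- The quotient is the ceiling of t / τ, the number of refreshes among the first t iterations. A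
sample costs 2 evaluations at a refresh and 4 in an update, which evaluates value and Jacobian at
two points. -/
lemma run_evals_le {par : Params} (hτ : 0 < par.τ) {M m t : ℕ}
    (hfull : ∀ s < t, s % par.τ = 0 → Multiset.card (A s) ≤ M)
    (hpart : ∀ s < t, s % par.τ ≠ 0 → Multiset.card (A s) ≤ m) :
    (run f g r par x₀ A t).evals ≤ 2 * M * ((t + (par.τ - 1)) / par.τ) + 4 * t * m := by
  induction t with
  | zero => simp [run]
  | succ t ih =>
    have h1 := ih (fun s hs => hfull s (by omega)) fun s hs => hpart s (by omega)
    have e : (run f g r par x₀ A (t + 1)).evals = (run f g r par x₀ A t).evals +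
      if t % par.τ = 0 then 2 * Multiset.card (A t) else 4 * Multiset.card (A t) := rfl
    rw [e]
    have e2 : t + 1 + (par.τ - 1) = t + par.τ := by omega
    rw [e2, Nat.add_div_right _ hτ]
    split_ifs with h0
    · have h2 := hfull t (by omega) h0
      have e3 : (t + (par.τ - 1)) / par.τ = t / par.τ := by
        obtain ⟨q, rfl⟩ := Nat.dvd_of_mod_eq_zero h0
        rw [Nat.mul_add_div hτ, Nat.div_eq_of_lt (by omega : par.τ - 1 < par.τ),
          Nat.mul_div_cancel_left _ hτ, add_zero]
      rw [e3] at h1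
      nlinarith
    · have h2 := hpart t (by omega) h0
      have h3 : (t + (par.τ - 1)) / par.τ ≤ t / par.τ + 1 := by
        rw [← Nat.add_div_right _ hτ]
        exact Nat.div_le_div_right (by omega)
      have h4 : 2 * M * ((t + (par.τ - 1)) / par.τ) ≤ 2 * M * (t / par.τ + 1) :=
        Nat.mul_le_mul_left _ h3
      nlinarith

lemma run_evals_le_real {par : Params} (hτ : 0 < par.τ) {b : ℕ → ℕ} {M t : ℕ}
    (hA : ∀ s < t, Multiset.card (A s) = b s)
    (hfull : ∀ s, s % par.τ = 0 → b s = M) (hpart : ∀ s, s % par.τ ≠ 0 → b s = par.τ) :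
    ((run f g r par x₀ A t).evals : ℝ) ≤ 2 * M * (t / par.τ + 1) + 4 * t * par.τ := by
  have h1 := run_evals_le (f := f) (g := g) (r := r) (x₀ := x₀) (A := A) hτ (M := M) (m := par.τ)
    (t := t) (fun s hs h0 => ((hA s hs).trans (hfull s h0)).le)
    fun s hs h0 => ((hA s hs).trans (hpart s h0)).le
  have h2 : ((run f g r par x₀ A t).evals : ℝ) ≤
      2 * M * (((t + (par.τ - 1)) / par.τ : ℕ) : ℝ) + 4 * t * par.τ := by exact_mod_cast h1
  have h3 : (((t + (par.τ - 1)) / par.τ : ℕ) : ℝ) ≤ t / par.τ + 1 := by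
    have h4 : (t + (par.τ - 1)) / par.τ ≤ t / par.τ + 1 := by
      rw [← Nat.add_div_right _ hτ]
      exact Nat.div_le_div_right (by omega)
    have h5 : (((t + (par.τ - 1)) / par.τ : ℕ) : ℝ) ≤ ((t / par.τ : ℕ) : ℝ) + 1 := by
      exact_mod_cast h4
    have h6 : ((t / par.τ : ℕ) : ℝ) ≤ (t : ℝ) / par.τ := Nat.cast_div_le
    linarith
  refine h2.trans ?_
  gcongr

end Evaluations

/-! ### Iteration counts and evaluation budgets -/

section Budgets

/-- The number of iterations used for accuracy `ε` from the scaled initial gap `K`. -/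
noncomputable def iterationCount (K ε : ℝ) : ℕ := ⌊8000 * (K / ε ^ 2)⌋₊ + 1

variable {K ε : ℝ}

lemma iterationCount_pos : 0 < iterationCount K ε := Nat.succ_pos _

lemma iterationCount_le (hK : 0 ≤ K) : (iterationCount K ε : ℝ) ≤ 8000 * (K / ε ^ 2) + 1 := by
  unfold iterationCount
  push_cast
  have := Nat.floor_le (a := 8000 * (K / ε ^ 2)) (by positivity)
  linarith

/-- With 8000 = 2 · 4000 the gap uses half of ε², leaving the other half for the refresh error. -/
lemma div_iterationCount_le (hε : 0 < ε) :
    4000 * (K / iterationCount K ε) ≤ ε ^ 2 / 2 := by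
  have h1 := Nat.lt_floor_add_one (8000 * (K / ε ^ 2))
  have h2 : (0 : ℝ) < iterationCount K ε := by exact_mod_cast iterationCount_pos
  have h3 : 8000 * (K / ε ^ 2) ≤ iterationCount K ε := by
    unfold iterationCount; push_cast; exact h1.le
  have hε2 : 0 < ε ^ 2 := by positivity
  have h4 : 8000 * K ≤ iterationCount K ε * ε ^ 2 := by
    rwa [← mul_div_assoc, div_le_iff₀ hε2] at h3
  rw [← mul_div_assoc, div_le_iff₀ h2]
  linarith

/-- With s = ⌊√n⌋ one has n ≤ s² + 2s ≤ 3s², so the refreshes cost O(n + sT), as the updates cost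
O(sT). The summand 1 in the bound on T is absorbed by s ≤ n. -/
lemma finite_budget_le {n : ℕ} (hn : 0 < n) {T : ℝ} (hK : 0 ≤ K) (hT0 : 0 ≤ T)
    (hT : T ≤ 8000 * (K / ε ^ 2) + 1) :
    2 * (n : ℝ) * (T / Nat.sqrt n + 1) + 4 * T * Nat.sqrt n ≤
      10 ^ 9 * (n + √n * K * ε⁻¹ ^ 2) := by
  have hs1 : (1 : ℝ) ≤ Nat.sqrt n := by exact_mod_cast Nat.sqrt_pos.mpr hn
  have hs2 : (Nat.sqrt n : ℝ) ≤ n := by exact_mod_cast Nat.sqrt_le_self n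
  have hs3 : (Nat.sqrt n : ℝ) ≤ √n := Real.nat_sqrt_le_real_sqrt
  have hs4 : (n : ℝ) ≤ 3 * Nat.sqrt n * Nat.sqrt n := by
    have h1 : (n : ℝ) ≤ Nat.sqrt n * Nat.sqrt n + Nat.sqrt n + Nat.sqrt n := by
      exact_mod_cast Nat.sqrt_le_add n
    nlinarith
  set s : ℝ := (Nat.sqrt n : ℝ)
  have h1 : (n : ℝ) * (T / s) ≤ 3 * s * T := by
    rw [← mul_div_assoc, div_le_iff₀ (by linarith)]
    nlinarith
  have h2 : s * T ≤ s * (8000 * (K / ε ^ 2) + 1) := by gcongr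
  have h3 : s * (K / ε ^ 2) ≤ √n * (K / ε ^ 2) := by gcongr
  have h4 : √n * K * ε⁻¹ ^ 2 = √n * (K / ε ^ 2) := by rw [inv_pow]; ring
  have h5 : 0 ≤ √n * (K / ε ^ 2) := by positivity
  rw [h4]
  nlinarith

/-- With S = √(2q) / δ ≥ 1, refresh batches have size at most 2S² and τ lies between S/2 and S, so
the cost is at most 12 S T + 4 S². Terms in S and S² are absorbed by S³, and S = 100 √(2q) / ε ≤ 200
√q / ε. -/
lemma online_budget_le {q δ T : ℝ} (hε : 0 < ε) (hδ : δ = 1 / 100 * ε) (hle : δ ≤ √(2 * q))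
    (hq : 0 ≤ q) (hK : 0 ≤ K) (hT0 : 0 ≤ T) (hT : T ≤ 8000 * (K / ε ^ 2) + 1) :
    2 * (⌈2 * q / δ ^ 2⌉₊ : ℝ) * (T / onlineTau q δ + 1) + 4 * T * onlineTau q δ ≤
      10 ^ 9 * (√q ^ 3 + √q * K) * ε⁻¹ ^ 3 := by
  have hδ0 : 0 < δ := by rw [hδ]; positivity
  set S : ℝ := √(2 * q / δ ^ 2) with hS
  have hSsq : S ^ 2 = 2 * q / δ ^ 2 := Real.sq_sqrt (by positivity)
  have hS1 : 1 ≤ S := by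
    rw [hS, Real.one_le_sqrt, one_le_div (by positivity)]
    exact (Real.le_sqrt' hδ0).mp hle
  have hM : (⌈2 * q / δ ^ 2⌉₊ : ℝ) ≤ 2 * S ^ 2 := by
    have := Nat.ceil_lt_add_one (a := 2 * q / δ ^ 2) (by positivity)
    rw [← hSsq] at this ⊢
    nlinarith
  have hτ1 : (onlineTau q δ : ℝ) ≤ S := Nat.floor_le (by linarith)
  have hτ2 : S ≤ 2 * onlineTau q δ := by
    have h1 := Nat.lt_floor_add_one S
    have h2 : (1 : ℝ) ≤ (⌊S⌋₊ : ℝ) := by exact_mod_cast (Nat.one_le_floor_iff S).mpr hS1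
    have e : onlineTau q δ = ⌊S⌋₊ := rfl
    rw [e]; linarith
  set τ : ℝ := (onlineTau q δ : ℝ)
  have hτ0 : 0 < τ := by linarith
  have h1 : T / τ ≤ 2 * T / S := by
    rw [div_le_div_iff₀ hτ0 (by linarith)]
    nlinarith
  have h2 : 2 * (⌈2 * q / δ ^ 2⌉₊ : ℝ) * (T / τ + 1) + 4 * T * τ ≤
      2 * (2 * S ^ 2) * (2 * T / S + 1) + 4 * T * S := by gcongr
  have h3 : 2 * (2 * S ^ 2) * (2 * T / S + 1) + 4 * T * S = 12 * (S * T) + 4 * S ^ 2 := by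
    field_simp; ring
  have h4 : S * T ≤ S * (8000 * (K / ε ^ 2) + 1) := by gcongr
  have h5 : S ≤ S ^ 3 := le_self_pow₀ hS1 (by norm_num)
  have h6 : S ^ 2 ≤ S ^ 3 := pow_le_pow_right₀ hS1 (by norm_num)
  have hSle : S ≤ 200 * (√q / ε) := by
    refine abs_le_of_sq_le_sq' ?_ (by positivity) |>.2
    rw [hSsq, hδ, mul_pow 200, div_pow √q, Real.sq_sqrt hq]
    have e : 2 * q / (1 / 100 * ε) ^ 2 = 20000 * (q / ε ^ 2) := by field_simp; ring
    rw [e]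
    have : 0 ≤ q / ε ^ 2 := by positivity
    nlinarith
  have h7 : S ^ 3 ≤ (200 * (√q / ε)) ^ 3 := by gcongr
  have h8 : S * (K / ε ^ 2) ≤ 200 * (√q / ε) * (K / ε ^ 2) := by gcongr
  have e1 : (200 * (√q / ε)) ^ 3 = 8000000 * (√q ^ 3 * ε⁻¹ ^ 3) := by
    rw [inv_pow]; ring
  have e2 : 200 * (√q / ε) * (K / ε ^ 2) = 200 * (√q * K * ε⁻¹ ^ 3) := by
    rw [inv_pow]; field_simp
  have h9 : 0 ≤ √q ^ 3 * ε⁻¹ ^ 3 := by positivity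
  have h10 : 0 ≤ √q * K * ε⁻¹ ^ 3 := by positivity
  rw [e1] at h7
  rw [e2] at h8
  have e3 : 10 ^ 9 * (√q ^ 3 + √q * K) * ε⁻¹ ^ 3 =
    10 ^ 9 * (√q ^ 3 * ε⁻¹ ^ 3) + 10 ^ 9 * (√q * K * ε⁻¹ ^ 3) := by ring
  rw [e3]
  nlinarith

end Budgets

/-! ### Accuracy and cost for the two problems -/

section Conclusions

variable {Ω : Type*} {mΩ : MeasurableSpace Ω} {μ : Measure Ω}
  {d p T : ℕ} {f : Vec p → ℝ} {r : Vec d → ℝ} {lf Lf lg Lg : ℝ≥0} {β ε : ℝ}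
  {lam : ℕ → ℝ} {x₀ : Vec d} {ζ : Ω → ℕ}

section FiniteSum

variable {n : ℕ} {g : Fin n → Vec d → Vec p} {A : ℕ → Ω → Finset (Fin n)}

lemma FiniteSampling.integral_accuracy_sq_le [IsProbabilityMeasure μ]
    (hs : FiniteSampling μ T (finiteBatch n) A ζ)
    (hn : 0 < n) (h : Regular f g (finiteMean g) r lf Lf lg Lg)
    (hβ : AdmissibleBeta lf Lf lg Lg β) (hT : 0 < T) (hlam : AdmissibleLam T β lam) :
    Integrable (fun ω => accuracy f g (finiteMean g) r (dimParams (Nat.sqrt n) β lam) x₀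
      (finiteBatches A ω) (ζ ω) ^ 2) μ ∧
    ∫ ω, accuracy f g (finiteMean g) r (dimParams (Nat.sqrt n) β lam) x₀
      (finiteBatches A ω) (ζ ω) ^ 2 ∂μ ≤ 4000 * (gap f (finiteMean g) r x₀ / (T * β)) := by
  -- Every past is generated by part of the sample family, from which ζ is independent as a whole.
  have hpast : ∀ t < T, pastAlgebra (finiteSource T A) Fin.val t ≤
      MeasurableSpace.comap (fun ω (t : Fin T) => A t ω) inferInstance := fun t _ =>
    iSup₂_le fun i _ => Measurable.comap_le <|
      (measurable_pi_apply i).comp (comap_measurable fun ω (t : Fin T) => A t ω)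
  have h1 := (hs.sampling hn h).integral_accuracy_sq_le (x₀ := x₀) h (innerRegular_finiteMean h)
    hβ le_rfl (Nat.sqrt_pos.mpr hn) hlam hT hs.ζ_meas hs.ζ_law hpast hs.ζ_indep
  rwa [add_zero] at h1

lemma FiniteSampling.ae_evals_le (hs : FiniteSampling μ T (finiteBatch n) A ζ) (hn : 0 < n)
    (f : Vec p → ℝ) (g : Fin n → Vec d → Vec p) (r : Vec d → ℝ) (β : ℝ) (lam : ℕ → ℝ)
    (x₀ : Vec d) :
    ∀ᵐ ω ∂μ, ((run f g r (dimParams (Nat.sqrt n) β lam) x₀ (finiteBatches A ω) T).evals : ℝ) ≤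
      2 * n * (T / Nat.sqrt n + 1) + 4 * T * Nat.sqrt n := by
  have hcard : ∀ᵐ ω ∂μ, ∀ t : Fin T, (A t ω).card = finiteBatch n t :=
    ae_all_iff.mpr fun t => ae_card_eq (hs.meas t t.2) (hs.law t t.2)
  filter_upwards [hcard] with ω hω
  exact run_evals_le_real (par := dimParams (Nat.sqrt n) β lam) (Nat.sqrt_pos.mpr hn)
    (b := finiteBatch n) (fun s hs => hω ⟨s, hs⟩) (fun s h0 => if_pos h0) fun s h0 => if_neg h0

end FiniteSum

section Online

variable {Ξ : Type*} {g : Ξ → Vec d → Vec p} {sg sg' : ℝ≥0} {ξ : ℕ → ℕ → Ω → Ξ} {δ : ℝ}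

lemma OnlineSampling.integral_accuracy_sq_le [MeasurableSpace Ξ] {P : Measure Ξ}
    [IsProbabilityMeasure μ] [IsProbabilityMeasure P]
    (hs : OnlineSampling μ P T (onlineBatch (sigma0Sq lf Lf lg sg sg') δ) ξ ζ)
    (h : Regular f g (onlineMean P g) r lf Lf lg Lg) (hv : BoundedVariance P g sg sg')
    (hβ : AdmissibleBeta lf Lf lg Lg β) (hδ : 0 < δ)
    (hle : δ ≤ √(2 * sigma0Sq lf Lf lg sg sg')) (hT : 0 < T) (hlam : AdmissibleLam T β lam) :
    Integrable (fun ω => accuracy f g (onlineMean P g) r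
      (dimParams (onlineTau (sigma0Sq lf Lf lg sg sg') δ) β lam) x₀
      (onlineBatches (onlineBatch (sigma0Sq lf Lf lg sg sg') δ) ξ ω) (ζ ω) ^ 2) μ ∧
    ∫ ω, accuracy f g (onlineMean P g) r
      (dimParams (onlineTau (sigma0Sq lf Lf lg sg sg') δ) β lam) x₀
      (onlineBatches (onlineBatch (sigma0Sq lf Lf lg sg sg') δ) ξ ω) (ζ ω) ^ 2 ∂μ ≤
      4000 * (gap f (onlineMean P g) r x₀ / (T * β) + δ ^ 2 / 2) := by
  have hrefresh : ∀ t, t % onlineTau (sigma0Sq lf Lf lg sg sg') δ = 0 →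
      2 * sigma0Sq lf Lf lg sg sg' / δ ^ 2 ≤ onlineBatch (sigma0Sq lf Lf lg sg sg') δ t :=
    fun t h0 => by
      rw [onlineBatch, if_pos h0]
      exact Nat.le_ceil _
  have hsamp := hs.sampling h hv hδ (one_le_onlineBatch hδ hle) hrefresh fun t h0 => if_neg h0
  have hpos := onlineTau_pos hδ hle
  generalize onlineBatch (sigma0Sq lf Lf lg sg sg') δ = b at *
  have hpast : ∀ t < T, pastAlgebra (onlineSource T b ξ) sampleLevel t ≤
      MeasurableSpace.comap (fun ω (q : (t : Fin T) × Fin (b t)) => ξ q.1 q.2 ω)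
        inferInstance := fun t _ =>
    iSup₂_le fun q _ => Measurable.comap_le <|
      (measurable_pi_apply q).comp
        (comap_measurable fun ω (q : (t : Fin T) × Fin (b t)) => ξ q.1 q.2 ω)
  exact hsamp.integral_accuracy_sq_le h (innerRegular_onlineMean h hv) hβ (by positivity) hpos
    hlam hT hs.ζ_meas hs.ζ_law hpast hs.ζ_indep

lemma online_evals_le (hδ : 0 < δ) (hle : δ ≤ √(2 * sigma0Sq lf Lf lg sg sg')) (f : Vec p → ℝ)
    (g : Ξ → Vec d → Vec p) (r : Vec d → ℝ) (β : ℝ) (lam : ℕ → ℝ) (x₀ : Vec d)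
    (ξ : ℕ → ℕ → Ω → Ξ) (ω : Ω) (T : ℕ) :
    ((run f g r (dimParams (onlineTau (sigma0Sq lf Lf lg sg sg') δ) β lam) x₀
      (onlineBatches (onlineBatch (sigma0Sq lf Lf lg sg sg') δ) ξ ω) T).evals : ℝ) ≤
      2 * (⌈2 * sigma0Sq lf Lf lg sg sg' / δ ^ 2⌉₊ : ℝ) *
        (T / onlineTau (sigma0Sq lf Lf lg sg sg') δ + 1) +
        4 * T * onlineTau (sigma0Sq lf Lf lg sg sg') δ :=
  run_evals_le_real (par := dimParams (onlineTau (sigma0Sq lf Lf lg sg sg') δ) β lam)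
    (onlineTau_pos hδ hle) (b := onlineBatch (sigma0Sq lf Lf lg sg sg') δ)
    (fun s _ => by simp [onlineBatches]) (fun s h0 => if_pos h0) fun s h0 => if_neg h0

end Online

end Conclusions

end MVRC

/-! ### The main theorem -/

open MVRC in
theorem theorem1 :
    ∃ C c : ℝ, 0 < C ∧ 0 < c ∧
    -- the finite-sum problem
    (∀ (d p n : ℕ) (f : Vec p → ℝ) (g : Fin n → Vec d → Vec p) (r : Vec d → ℝ)
        (lf Lf lg Lg : ℝ≥0) (x₀ : Vec d) (β : ℝ),
      0 < n → Regular f g (finiteMean g) r lf Lf lg Lg → AdmissibleBeta lf Lf lg Lg β →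
      -- convergence rate
      (∀ (T : ℕ) (lam : ℕ → ℝ) (Ω : Type u) [MeasurableSpace Ω] (μ : Measure Ω)
          [IsProbabilityMeasure μ] (A : ℕ → Ω → Finset (Fin n)) (ζ : Ω → ℕ),
        0 < T → AdmissibleLam T β lam → FiniteSampling μ T (finiteBatch n) A ζ →
        Integrable (fun ω => accuracy f g (finiteMean g) r (dimParams (Nat.sqrt n) β lam) x₀
          (finiteBatches A ω) (ζ ω) ^ 2) μ ∧
        ∫ ω, accuracy f g (finiteMean g) r (dimParams (Nat.sqrt n) β lam) x₀
          (finiteBatches A ω) (ζ ω) ^ 2 ∂μ ≤ C * (gap f (finiteMean g) r x₀ / (T * β))) ∧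
      -- sample complexity
      (∀ ε : ℝ, 0 < ε → ∃ T : ℕ, 0 < T ∧
        ∀ (lam : ℕ → ℝ) (Ω : Type u) [MeasurableSpace Ω] (μ : Measure Ω)
          [IsProbabilityMeasure μ] (A : ℕ → Ω → Finset (Fin n)) (ζ : Ω → ℕ),
        AdmissibleLam T β lam → FiniteSampling μ T (finiteBatch n) A ζ →
        Integrable (fun ω => accuracy f g (finiteMean g) r (dimParams (Nat.sqrt n) β lam) x₀
          (finiteBatches A ω) (ζ ω)) μ ∧
        ∫ ω, accuracy f g (finiteMean g) r (dimParams (Nat.sqrt n) β lam) x₀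
          (finiteBatches A ω) (ζ ω) ∂μ ≤ ε ∧
        ∀ᵐ ω ∂μ, ((run f g r (dimParams (Nat.sqrt n) β lam) x₀
            (finiteBatches A ω) T).evals : ℝ) ≤
          C * (n + √n * (gap f (finiteMean g) r x₀ / β) * ε⁻¹ ^ 2))) ∧
    -- the online problem
    (∀ (d p : ℕ) (Ξ : Type v) [MeasurableSpace Ξ] (P : Measure Ξ) [IsProbabilityMeasure P]
        (f : Vec p → ℝ) (g : Ξ → Vec d → Vec p) (r : Vec d → ℝ)
        (lf Lf lg Lg sg sg' : ℝ≥0) (x₀ : Vec d) (β : ℝ),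
      Regular f g (onlineMean P g) r lf Lf lg Lg → BoundedVariance P g sg sg' →
      AdmissibleBeta lf Lf lg Lg β →
      -- convergence rate
      (∀ (ε : ℝ) (T : ℕ) (lam : ℕ → ℝ) (Ω : Type u) [MeasurableSpace Ω] (μ : Measure Ω)
          [IsProbabilityMeasure μ] (ξ : ℕ → ℕ → Ω → Ξ) (ζ : Ω → ℕ),
        0 < ε → ε ≤ √(2 * sigma0Sq lf Lf lg sg sg') →
        0 < T → AdmissibleLam T β lam →
        OnlineSampling μ P T (onlineBatch (sigma0Sq lf Lf lg sg sg') ε) ξ ζ →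
        Integrable (fun ω => accuracy f g (onlineMean P g) r
          (dimParams (onlineTau (sigma0Sq lf Lf lg sg sg') ε) β lam) x₀
          (onlineBatches (onlineBatch (sigma0Sq lf Lf lg sg sg') ε) ξ ω) (ζ ω) ^ 2) μ ∧
        ∫ ω, accuracy f g (onlineMean P g) r
          (dimParams (onlineTau (sigma0Sq lf Lf lg sg sg') ε) β lam) x₀
          (onlineBatches (onlineBatch (sigma0Sq lf Lf lg sg sg') ε) ξ ω) (ζ ω) ^ 2 ∂μ ≤
          C * (ε ^ 2 + gap f (onlineMean P g) r x₀ / (T * β))) ∧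
      -- sample complexity; the parameter choices are made with `δ = c ε`
      (∀ ε δ : ℝ, 0 < ε → δ = c * ε → δ ≤ √(2 * sigma0Sq lf Lf lg sg sg') →
        ∃ T : ℕ, 0 < T ∧
        ∀ (lam : ℕ → ℝ) (Ω : Type u) [MeasurableSpace Ω] (μ : Measure Ω)
          [IsProbabilityMeasure μ] (ξ : ℕ → ℕ → Ω → Ξ) (ζ : Ω → ℕ),
        AdmissibleLam T β lam →
        OnlineSampling μ P T (onlineBatch (sigma0Sq lf Lf lg sg sg') δ) ξ ζ →
        Integrable (fun ω => accuracy f g (onlineMean P g) r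
          (dimParams (onlineTau (sigma0Sq lf Lf lg sg sg') δ) β lam) x₀
          (onlineBatches (onlineBatch (sigma0Sq lf Lf lg sg sg') δ) ξ ω) (ζ ω)) μ ∧
        ∫ ω, accuracy f g (onlineMean P g) r
          (dimParams (onlineTau (sigma0Sq lf Lf lg sg sg') δ) β lam) x₀
          (onlineBatches (onlineBatch (sigma0Sq lf Lf lg sg sg') δ) ξ ω) (ζ ω) ∂μ ≤ ε ∧
        ∀ᵐ ω ∂μ, ((run f g r (dimParams (onlineTau (sigma0Sq lf Lf lg sg sg') δ) β lam) x₀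
            (onlineBatches (onlineBatch (sigma0Sq lf Lf lg sg sg') δ) ξ ω) T).evals : ℝ) ≤
          C * (√(sigma0Sq lf Lf lg sg sg') ^ 3 + √(sigma0Sq lf Lf lg sg sg') *
            (gap f (onlineMean P g) r x₀ / β)) * ε⁻¹ ^ 3)) := by
  -- The evaluation budgets determine the size of C. With c = 1/100 the refresh error contributes
  -- 4000 · δ² / 2 = ε² / 5, which fits in the half of ε² left by the gap.
  refine ⟨10 ^ 9, 1 / 100, by norm_num, by norm_num, ?_, ?_⟩
  · intro d p n f g r lf Lf lg Lg x₀ β hn h hβ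
    have hgap := gap_nonneg h x₀
    have hβ0 := hβ.1
    refine ⟨fun T lam Ω _ μ _ A ζ hT hlam hs => ?_, fun ε hε => ?_⟩
    · obtain ⟨h1, h2⟩ := hs.integral_accuracy_sq_le (x₀ := x₀) hn h hβ hT hlam
      refine ⟨h1, h2.trans ?_⟩
      gcongr
      norm_num
    · set K := gap f (finiteMean g) r x₀ / β with hK
      have hK0 : 0 ≤ K := by positivity
      refine ⟨iterationCount K ε, iterationCount_pos, fun lam Ω _ μ _ A ζ hlam hs => ?_⟩
      obtain ⟨h1, h2⟩ := hs.integral_accuracy_sq_le (x₀ := x₀) hn h hβ iterationCount_pos hlam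
      have h3 := div_iterationCount_le (K := K) hε
      have e : gap f (finiteMean g) r x₀ / (iterationCount K ε * β) = K / iterationCount K ε := by
        rw [hK, div_div, mul_comm β]
      rw [e] at h2
      obtain ⟨h4, h5⟩ := integral_le_of_integral_sq_le (fun ω => accuracy_nonneg ..) h1 hε
        (h2.trans (by linarith [sq_nonneg ε]))
      refine ⟨h4, h5, ?_⟩
      filter_upwards [hs.ae_evals_le hn f g r β lam x₀] with ω hω
      exact hω.trans (finite_budget_le hn hK0 (Nat.cast_nonneg _) (iterationCount_le hK0))
  · intro d p Ξ _ P _ f g r lf Lf lg Lg sg sg' x₀ β h hv hβ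
    have hgap := gap_nonneg h x₀
    have hβ0 := hβ.1
    refine ⟨fun ε T lam Ω _ μ _ ξ ζ hε hle hT hlam hs => ?_, fun ε δ hε hδ hle => ?_⟩
    · obtain ⟨h1, h2⟩ := hs.integral_accuracy_sq_le (x₀ := x₀) h hv hβ hε hle hT hlam
      refine ⟨h1, h2.trans ?_⟩
      have h3 : 0 ≤ gap f (onlineMean P g) r x₀ / (T * β) := by positivity
      nlinarith [sq_nonneg ε]
    · set K := gap f (onlineMean P g) r x₀ / β with hK
      have hK0 : 0 ≤ K := by positivity
      have hδ0 : 0 < δ := by rw [hδ]; positivity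
      have hq : 0 ≤ sigma0Sq lf Lf lg sg sg' := by unfold sigma0Sq; positivity
      refine ⟨iterationCount K ε, iterationCount_pos, fun lam Ω _ μ _ ξ ζ hlam hs => ?_⟩
      obtain ⟨h1, h2⟩ := hs.integral_accuracy_sq_le (x₀ := x₀) h hv hβ hδ0 hle iterationCount_pos
        hlam
      have h3 := div_iterationCount_le (K := K) hε
      have e : gap f (onlineMean P g) r x₀ / (iterationCount K ε * β) = K / iterationCount K ε := by
        rw [hK, div_div, mul_comm β]
      rw [e] at h2
      obtain ⟨h4, h5⟩ := integral_le_of_integral_sq_le (fun ω => accuracy_nonneg ..) h1 hε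
        (h2.trans (by rw [hδ]; linarith [sq_nonneg ε]))
      exact ⟨h4, h5, Filter.Eventually.of_forall fun ω =>
        (online_evals_le hδ0 hle f g r β lam x₀ ξ ω _).trans
          (online_budget_le hε hδ hle hq hK0 (Nat.cast_nonneg _) (iterationCount_le hK0))⟩
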